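/- Let $d\ge 1$, $\Omega=[0,1]^d$, $T>0$. Let $K:\mathbb R^d\times\mathbb R^d\to\mathbb R$ be measurable, nonnegative, symmetric, with $K\in L^{\infty,2}(\Omega^2)$, i.e. $\sup_{x\in\Omega}\|K(x,\cdot)\|_{L^2(\Omega)}<\infty$; let $g\in L^2(\Omega)$ and $f\in L^1([0,T];L^2(\Omega))$. *The problem.* Let $\partial|\cdot|(x)=\{1\}$ for $x>0$, $\{-1\}$ for $x<0$, $[-1,1]$ for $x=0$. For $u,\eta\in L^1(\Omega)$ write $\eta\in\Delta_1^K u$ if there is a measurable $w$ on $\Omega^2$ with $|w|\le 1$, $w(x,y)=-w(y,x)$, $w(x,y)\in\partial|\cdot|(u(y)-u(x))$ a.e., and $\eta(x)=-\int_\Omega K(x,y)w(x,y)\,dy$ for a.e. $x$. A solution on $[0,T]$ with kernel $K$ and data $(f,g)$ is a $u\in C([0,T];L^1(\Omega))\cap W^{1,1}(]0,T[;L^1(\Omega))$ with $u(0)=g$ and $\partial_t u=-\eta+f$ a.e. in $\Omega\times]0,T[$, where $\eta(\cdot,t)\in\Delta_1^Ku(\cdot,t)$ for a.e. $t$. *Discretization.*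 Let $n\ge1$ and, for each coordinate $k$, let $0=x_{k,0}<\dots<x_{k,n}=1$. Let $\Omega_i=\prod_k\,]x_{k,i_k-1},x_{k,i_k}]$ for $i\in[n]^d$, $h_i=|\Omega_i|$, and let $\delta_n$ be the largest side length of a cell. Let $P_n$ take averages over the cells ($(P_nu)_i=h_i^{-1}\int_{\Omega_i}u$, and $(P_nK)_{ij}=(h_ih_j)^{-1}\int_{\Omega_i\times\Omega_j}K$), and let $I_n$ be piecewise constant extension: $I_nv=\sum_i v_i\chi_{\Omega_i}$, where $\chi_{\Omega_i}$ equals $1$ on $\Omega_i$ and $0$ elsewhere, and similarly for matrices. The space semi-discrete problem is $$b'(t)=-\eta(t)+P_nf(\cdot,t)\ \text{ for a.e. }t\in[0,T],\qquad b(0)=P_ng,$$ for an absolutely continuous $b:[0,T]\to\mathbb R^{n^d}$, where, for a.e. $t$, $\eta_i(t)=-\sum_j h_j(P_nK)_{ij}w_{ij}$ for some $w$ (depending on $t$) with $|w_{ij}|\le1$, $w_{ij}=-w_{ji}$, $w_{ij}\in\partial|\cdot|(b_j(t)-b_i(t))$ (for instance $w_{ij}=\operatorname{sign}(b_j(t)-b_i(t))$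 with $\operatorname{sign}0=0$). Put $u_n(\cdot,t)=I_nb(t)$ and $f_n(\cdot,t)=I_nP_nf(\cdot,t)$. **Theorem.** (i) The problem with kernel $K$ and data $(f,g)$ has a unique solution $u$. The semi-discrete problem has a solution $b$, and for every such $b$ the function $u_n$ is the unique solution of the problem with kernel $I_nP_nK$ and data $(f_n,I_nP_ng)$. (ii) $u,u_n\in C([0,T];L^2(\Omega))$ and $$\|u_n-u\|_{C([0,T];L^2(\Omega))}\le\|I_nP_ng-g\|_{L^2(\Omega)}+\|f_n-f\|_{L^1([0,T];L^2(\Omega))}+T\,\|I_nP_nK-K\|_{L^2(\Omega^2)}.$$ (iii) Let $0<s\le1$. For $S=\Omega$ or $S=\Omega^2$ let $$|F|_{\mathrm{Lip}(s,L^2(S))}=\sup_{h>0}h^{-s}\sup_{|z|<h}\Big(\int_{x,\,x+z\in S}|F(x+z)-F(x)|^2dx\Big)^{1/2},$$ where $|z|$ is the Euclidean norm, and let $\mathrm{Lip}(s,L^2(S))$ be the set of $F\in L^2(S)$ for which this is finite. If $g\in\mathrm{Lip}(s,L^2(\Omega))$, $K\in\mathrm{Lip}(s,L^2(\Omega^2))$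 and $\int_0^T|f(\cdot,t)|_{\mathrm{Lip}(s,L^2(\Omega))}dt<\infty$, then, with a constant $C_{d,s}>0$ that depends only on $d$ and $s$, $$\|u_n-u\|_{C([0,T];L^2(\Omega))}\le C_{d,s}\Big(|g|_{\mathrm{Lip}(s,L^2(\Omega))}+\int_0^T|f(\cdot,t)|_{\mathrm{Lip}(s,L^2(\Omega))}dt+T\,|K|_{\mathrm{Lip}(s,L^2(\Omega^2))}\Big)\delta_n^s .$$ In particular $\|u_n-u\|_{C([0,T];L^2(\Omega))}\le C(1+T)\delta_n^s$ with $C=C_{d,s}\big(|g|_{\mathrm{Lip}(s,L^2(\Omega))}+\int_0^T|f(\cdot,t)|_{\mathrm{Lip}(s,L^2(\Omega))}dt+|K|_{\mathrm{Lip}(s,L^2(\Omega^2))}\big)$, which depends only on $d,s,g,f,K$. -/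

import Mathlib

open MeasureTheory Set Filter Topology
open scoped ENNReal

namespace NonlocalOneLaplacian

noncomputable section

/-- Points of `ℝ^d` (as a set with its Lebesgue measure). -/
abbrev Pt (d : ℕ) : Type := Fin d → ℝ

/-- The domain `Ω = [0,1]^d`. -/
def dom (d : ℕ) : Set (Pt d) := Icc 0 1

/-- Lebesgue measure on `Ω`. -/
def μΩ (d : ℕ) : Measure (Pt d) := volume.restrict (dom d)

/-- Lebesgue measure on the time interval `[0,T]`. -/
def μT (T : ℝ) : Measure ℝ := volume.restrict (Icc 0 T)

/-! ### Function spaces -/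

/-- `‖F‖_{L^{∞,2}(Ω²)} = sup_{x ∈ Ω} ‖F(x,·)‖_{L²(Ω)}`. -/
def normLinfTwo {d : ℕ} (F : Pt d → Pt d → ℝ) : ℝ≥0∞ :=
  ⨆ x ∈ dom d, eLpNorm (F x) 2 (μΩ d)

/-- `‖F‖_{L²(Ω²)}`. -/
def normTwoSq {d : ℕ} (F : Pt d → Pt d → ℝ) : ℝ≥0∞ :=
  eLpNorm (Function.uncurry F) 2 ((μΩ d).prod (μΩ d))

/-- `‖u‖_{L¹([0,T];L^q(Ω))} = ∫₀ᵀ ‖u(·,t)‖_{L^q(Ω)} dt`; functions of space and time are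
written `u t x`. -/
def normL1L {d : ℕ} (q : ℝ≥0∞) (T : ℝ) (u : ℝ → Pt d → ℝ) : ℝ≥0∞ :=
  ∫⁻ t, eLpNorm (u t) q (μΩ d) ∂(μT T)

/-- `u ∈ L¹([0,T];L^q(Ω))`. -/
def MemL1L {d : ℕ} (q : ℝ≥0∞) (T : ℝ) (u : ℝ → Pt d → ℝ) : Prop :=
  AEStronglyMeasurable (Function.uncurry u) ((μT T).prod (μΩ d)) ∧ normL1L q T u < ∞

/-- `‖u‖_{C([0,T];L^q(Ω))} = sup_{t ∈ [0,T]} ‖u(·,t)‖_{L^q(Ω)}`. -/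
def normCL {d : ℕ} (q : ℝ≥0∞) (T : ℝ) (u : ℝ → Pt d → ℝ) : ℝ≥0∞ :=
  ⨆ t ∈ Icc (0 : ℝ) T, eLpNorm (u t) q (μΩ d)

/-- `u ∈ C([0,T];L^q(Ω))`. -/
def MemCL {d : ℕ} (q : ℝ≥0∞) (T : ℝ) (u : ℝ → Pt d → ℝ) : Prop :=
  (∀ t ∈ Icc (0 : ℝ) T, MemLp (u t) q (μΩ d)) ∧
    ∀ t₀ ∈ Icc (0 : ℝ) T,
      Tendsto (fun t => eLpNorm (u t - u t₀) q (μΩ d)) (𝓝[Icc (0 : ℝ) T] t₀) (𝓝 0)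

/-- `v ∈ L¹(]0,T[;L¹(Ω))` is the time derivative of `u`, i.e. `u(t) = u(0) + ∫₀ᵗ v(s) ds` in
`L¹(Ω)` for all `t ∈ [0,T]`.  Together with `u ∈ C([0,T];L¹(Ω))`, existence of such a `v` says
that `u ∈ W^{1,1}(]0,T[;L¹(Ω))`. -/
def HasTimeDeriv {d : ℕ} (T : ℝ) (u v : ℝ → Pt d → ℝ) : Prop :=
  MemL1L 1 T v ∧ ∀ t ∈ Icc (0 : ℝ) T, ∀ᵐ x ∂(μΩ d), u t x = u 0 x + ∫ s in (0 : ℝ)..t, v s x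

/-! ### The 1-Laplacian and the evolution problem -/

/-- The subdifferential of `|·|` on `ℝ`. -/
def absSubdiff (x : ℝ) : Set ℝ :=
  if 0 < x then {1} else if x = 0 then Icc (-1) 1 else {-1}

/-- `η ∈ Δ₁^K u`: the graph of the set-valued nonlocal 1-Laplacian in `L¹(Ω) × L¹(Ω)`. -/
def oneLap {d : ℕ} (K : Pt d → Pt d → ℝ) (u : Pt d → ℝ) : Set (Pt d → ℝ) :=
  {η | MemLp u 1 (μΩ d) ∧ MemLp η 1 (μΩ d) ∧ ∃ w : Pt d → Pt d → ℝ,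
    AEStronglyMeasurable (Function.uncurry w) ((μΩ d).prod (μΩ d)) ∧
    (∀ᵐ p ∂((μΩ d).prod (μΩ d)), |w p.1 p.2| ≤ 1) ∧
    (∀ᵐ p ∂((μΩ d).prod (μΩ d)), w p.1 p.2 = -w p.2 p.1) ∧
    (∀ᵐ p ∂((μΩ d).prod (μΩ d)), w p.1 p.2 ∈ absSubdiff (u p.2 - u p.1)) ∧
    ∀ᵐ x ∂(μΩ d), η x = -∫ y, K x y * w x y ∂(μΩ d)}

/-- `u` is a solution on `[0,T]` of the nonlocal evolution problem with `p = 1`, kernel `K`,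
second member `f` and initial datum `g`: `u ∈ C([0,T];L¹(Ω)) ∩ W^{1,1}(]0,T[;L¹(Ω))`,
`u(0) = g`, and `∂ₜu = -η + f` a.e. with `η(·,t) ∈ Δ₁^K u(·,t)`. -/
def IsSolution {d : ℕ} (K : Pt d → Pt d → ℝ) (f : ℝ → Pt d → ℝ) (g : Pt d → ℝ) (T : ℝ)
    (u : ℝ → Pt d → ℝ) : Prop :=
  MemCL 1 T u ∧ u 0 =ᵐ[μΩ d] g ∧ ∃ v η : ℝ → Pt d → ℝ, HasTimeDeriv T u v ∧
    (∀ᵐ p ∂((μT T).prod (μΩ d)), v p.1 p.2 = -η p.1 p.2 + f p.1 p.2) ∧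
    ∀ᵐ t ∂(μT T), η t ∈ oneLap K (u t)

/-- `u` is the unique solution (in the Banach space `C([0,T];L¹(Ω))`, whose elements at a fixed
time are classes of functions up to null sets). -/
def IsUniqueSolution {d : ℕ} (K : Pt d → Pt d → ℝ) (f : ℝ → Pt d → ℝ) (g : Pt d → ℝ) (T : ℝ)
    (u : ℝ → Pt d → ℝ) : Prop :=
  IsSolution K f g T u ∧
    ∀ v, IsSolution K f g T v → ∀ t ∈ Icc (0 : ℝ) T, v t =ᵐ[μΩ d] u t

/-! ### Meshes, projector and injector -/

/-- A partition of `[0,1]^d` into `n^d` boxes: for each coordinate `k`, nodes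
`0 = x_{k,0} < x_{k,1} < ⋯ < x_{k,n} = 1`. -/
structure Mesh (d n : ℕ) where
  node : Fin d → Fin (n + 1) → ℝ
  strictMono : ∀ k, StrictMono (node k)
  node_zero : ∀ k, node k 0 = 0
  node_last : ∀ k, node k (Fin.last n) = 1

/-- Multi-indices in `[n]^d`. -/
abbrev Idx (d n : ℕ) : Type := Fin d → Fin n

namespace Mesh

variable {d n : ℕ} (P : Mesh d n)

/-- The cell `∏ₖ ]x_{k,i_k - 1}, x_{k,i_k}]`. -/
def cell (i : Idx d n) : Set (Pt d) :=
  Set.univ.pi fun k => Ioc (P.node k (i k).castSucc) (P.node k (i k).succ)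

/-- The volume `h_i` of a cell. -/
def vol (i : Idx d n) : ℝ := volume.real (P.cell i)

/-- The maximal mesh size `δ_n`: the largest side of a cell. -/
def size : ℝ := ⨆ k : Fin d, ⨆ j : Fin n, (P.node k j.succ - P.node k j.castSucc)

/-- The projector `P_n` on functions: cell averages. -/
def proj (u : Pt d → ℝ) (i : Idx d n) : ℝ := (P.vol i)⁻¹ * ∫ x in P.cell i, u x

/-- The projector `P_n` on kernels: averages over products of cells. -/
def projK (K : Pt d → Pt d → ℝ) (i j : Idx d n) : ℝ :=
  (P.vol i * P.vol j)⁻¹ * ∫ p in P.cell i ×ˢ P.cell j, K p.1 p.2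

/-- The injector `I_n`: piecewise constant extension of a vector. -/
def inj (v : Idx d n → ℝ) (x : Pt d) : ℝ := ∑ i, (P.cell i).indicator (fun _ => v i) x

/-- The injector `I_n` on matrices. -/
def injK (A : Idx d n → Idx d n → ℝ) (x y : Pt d) : ℝ :=
  ∑ i, ∑ j, (P.cell i ×ˢ P.cell j).indicator (fun _ => A i j) (x, y)

/-- The discrete 1-Laplacian, a set-valued operator on `ℝ^{n^d}`. -/
def discOneLap (A : Idx d n → Idx d n → ℝ) (u : Idx d n → ℝ) : Set (Idx d n → ℝ) :=
  {η | ∃ w : Idx d n → Idx d n → ℝ, (∀ i j, |w i j| ≤ 1) ∧ (∀ i j, w i j = -w j i) ∧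
    (∀ i j, w i j ∈ absSubdiff (u j - u i)) ∧ ∀ i, η i = -∑ j, P.vol j * A i j * w i j}

/-- The selection of the discrete 1-Laplacian through `sign` (with `sign 0 = 0`) belongs to it. -/
theorem sign_mem_discOneLap (A : Idx d n → Idx d n → ℝ) (u : Idx d n → ℝ) :
    (fun i => -∑ j, P.vol j * A i j * Real.sign (u j - u i)) ∈ P.discOneLap A u := by
  refine ⟨fun i j => Real.sign (u j - u i), fun i j => ?_, fun i j => ?_, fun i j => ?_,
    fun i => rfl⟩
  · rcases Real.sign_apply_eq (u j - u i) with h | h | h <;> simp [h]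
  · rw [← Real.sign_neg, neg_sub]
  · rcases lt_trichotomy (u j - u i) 0 with h | h | h
    · simp [absSubdiff, Real.sign_of_neg h, h.not_gt, h.ne]
    · simp [absSubdiff, h]
    · simp [absSubdiff, Real.sign_of_pos h, h]

/-- `b` is a solution on `[0,T]` of the space semi-discrete problem
`b'(t) = -η(t) + F(t)`, `η(t) ∈ (discrete 1-Laplacian with kernel A)(b(t))`, `b(0) = b₀`;
`b` is absolutely continuous on `[0,T]` and the equation holds for a.e. `t`. -/
def IsSemidiscreteSolution (A : Idx d n → Idx d n → ℝ) (F : ℝ → Idx d n → ℝ)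
    (b₀ : Idx d n → ℝ) (T : ℝ) (b : ℝ → Idx d n → ℝ) : Prop :=
  b 0 = b₀ ∧ ∃ v η : ℝ → Idx d n → ℝ,
    (∀ i, Integrable (fun t => v t i) (μT T)) ∧
    (∀ t ∈ Icc (0 : ℝ) T, ∀ i, b t i = b 0 i + ∫ s in (0 : ℝ)..t, v s i) ∧
    (∀ᵐ t ∂(μT T), ∀ i, v t i = -η t i + F t i) ∧
    ∀ᵐ t ∂(μT T), η t ∈ P.discOneLap A (b t)

end Mesh

/-! ### Lipschitz spaces -/

/-- The `L²(S)` modulus of smoothness `ω(F,h)₂ = sup_{|z| < h} ‖F(· + z) - F‖_{L²({x, x+z ∈ S})}`,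
where `len` is the Euclidean length on the ambient space. -/
def modulus {E : Type*} [AddCommGroup E] [MeasureSpace E] (len : E → ℝ) (S : Set E)
    (F : E → ℝ) (h : ℝ) : ℝ≥0∞ :=
  ⨆ z : E, ⨆ _ : len z < h,
    eLpNorm (fun x => F (x + z) - F x) 2 (volume.restrict {x | x ∈ S ∧ x + z ∈ S})

/-- The semi-norm `|F|_{Lip(s,L²(S))} = sup_{h > 0} h^{-s} ω(F,h)₂`. -/
def lipSemi {E : Type*} [AddCommGroup E] [MeasureSpace E] (len : E → ℝ) (S : Set E)
    (s : ℝ) (F : E → ℝ) : ℝ≥0∞ :=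
  ⨆ h : ℝ, ⨆ _ : 0 < h, ENNReal.ofReal (h ^ (-s)) * modulus len S F h

/-- Euclidean length on `ℝ^d`. -/
def len {d : ℕ} (z : Pt d) : ℝ := √(∑ k, z k ^ 2)

/-- Euclidean length on `ℝ^d × ℝ^d = ℝ^{2d}`. -/
def lenTwo {d : ℕ} (z : Pt d × Pt d) : ℝ := √(∑ k, z.1 k ^ 2 + ∑ k, z.2 k ^ 2)

/-- `|F|_{Lip(s,L²(Ω))}`. -/
def lipΩ {d : ℕ} (s : ℝ) (F : Pt d → ℝ) : ℝ≥0∞ := lipSemi len (dom d) s F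

/-- `|F|_{Lip(s,L²(Ω²))}`. -/
def lipΩΩ {d : ℕ} (s : ℝ) (F : Pt d → Pt d → ℝ) : ℝ≥0∞ :=
  lipSemi lenTwo (dom d ×ˢ dom d) s (Function.uncurry F)

/-- `F ∈ Lip(s,L²(Ω))`. -/
def MemLipΩ {d : ℕ} (s : ℝ) (F : Pt d → ℝ) : Prop :=
  MemLp F 2 (μΩ d) ∧ lipΩ s F < ∞

/-- `F ∈ Lip(s,L²(Ω²))`. -/
def MemLipΩΩ {d : ℕ} (s : ℝ) (F : Pt d → Pt d → ℝ) : Prop :=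
  MemLp (Function.uncurry F) 2 ((μΩ d).prod (μΩ d)) ∧ lipΩΩ s F < ∞

/-! ### Standing assumptions on the data -/

/-- The kernel is nonnegative, measurable, symmetric and in `L^{∞,2}(Ω²)`; `g ∈ L²(Ω)`;
`f ∈ L¹([0,T];L²(Ω))`. -/
structure Data (d : ℕ) (K : Pt d → Pt d → ℝ) (f : ℝ → Pt d → ℝ) (g : Pt d → ℝ) (T : ℝ) :
    Prop where
  meas : Measurable (Function.uncurry K)
  nonneg : ∀ x y, 0 ≤ K x y
  symm : ∀ x y, K x y = K y x
  bdd : normLinfTwo K < ∞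
  memg : MemLp g 2 (μΩ d)
  memf : MemL1L 2 T f
  pos : 0 < T

end

end NonlocalOneLaplacian

open NonlocalOneLaplacian

/-! The 1-Laplacian is multivalued and discontinuous, but it is monotone in `L²`, and its values are
bounded because the sign fields are bounded by 1 and the rows of the kernel are uniformly
integrable. Monotonicity is a symmetrization: for `K` symmetric and `a` antisymmetric, `∫∫ U(x) K a
= -½ ∫∫ K a (U(y) - U(x))`, and for `a = w₁ - w₂`, `U = u₁ - u₂` the last integrand is nonnegative,
since `K ≥ 0` and the subdifferential of `|·|` is monotone. Two kernels are compared through `K₁w₁ -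
K₂w₂ = K₁(w₁ - w₂) + (K₁ - K₂)w₂`, whose second term costs at most `‖K₁ - K₂‖` in `L²`
(`InLap.neg_integral_sub_mul_sub_le`).

Stability: as the operator has bounded values, the time derivative of a solution lies in `L¹(L²)`
and the energy identity `L12.integral_sq_eq` holds. The difference `D` of two solutions then
satisfies, in integrated form, `d/dt ‖D‖² ≤ 2 (‖f₁ - f₂‖ + ‖K₁ - K₂‖) ‖D‖`, and a Gronwall argument
yields `MildSol.eLpNorm_sub_le`. Equal data give uniqueness. Estimate (ii) follows because the
piecewise constant extension of a semi-discrete solution solves the continuum problem with projected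
data.

Existence (`exists_inLap`) is proved on an arbitrary finite measure space, which covers both `Ω` and
the finite set of cells. Explicit Euler steps with the `sign` selection stay within `O(τ)` in `L¹`
of the primitives they generate; monotonicity and boundedness make these primitives Cauchy in `L²`,
uniformly in time. The sign fields converge only weakly, but the functions converge strongly, and
this is enough to identify the weak limit as a sign field of the limit function.

Rate: a cell average is the best constant in `L²`, hence no worse than the value of the function at
any point of a comparison cube of side `δ_n`. Averaging over that cube and changing variables to
differences bounds the projection error by the modulus of smoothness (`eLpNorm_sub_le_modulus`),
with no regularity assumption on the shape of the cells. -/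

namespace NonlocalOneLaplacian

/-! ### Primitives in time -/

section Primitive

variable {X : Type*}

/-- The primitive in time `t ↦ ∫_{s ≤ t} V(s,·) dm(s)`. -/
noncomputable def cum (m : Measure ℝ) (V : ℝ → X → ℝ) (t : ℝ) (x : X) : ℝ :=
  ∫ s in Iic t, V s x ∂m

theorem enorm_cum_le {m : Measure ℝ} {V : ℝ → X → ℝ} (t : ℝ) (x : X) : ‖cum m V t x‖ₑ ≤ ∫⁻ s, ‖V s x‖ₑ ∂m :=
  (enorm_integral_le_lintegral_enorm _).trans (lintegral_mono' Measure.restrict_le_self le_rfl)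

variable [MeasurableSpace X]

/-- Jointly measurable elements of `L¹(m; L²(μ))`. -/
structure L12 (m : Measure ℝ) (μ : Measure X) (V : ℝ → X → ℝ) : Prop where
  meas : Measurable (Function.uncurry V)
  fin : ∫⁻ s, eLpNorm (V s) 2 μ ∂m < ∞

variable {m : Measure ℝ} {μ : Measure X} {V : ℝ → X → ℝ}

theorem eLpNorm_two_sq (h : X → ℝ) : eLpNorm h 2 μ ^ 2 = ∫⁻ x, ‖h x‖ₑ ^ 2 ∂μ := by
  rw [eLpNorm_eq_lintegral_rpow_enorm_toReal two_ne_zero ENNReal.ofNat_ne_top,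
    ← ENNReal.rpow_natCast, ← ENNReal.rpow_mul]
  simp

theorem eLpNorm_two_le_iff {h : X → ℝ} {c : ℝ≥0∞} :
    eLpNorm h 2 μ ≤ c ↔ ∫⁻ x, ‖h x‖ₑ ^ 2 ∂μ ≤ c ^ 2 := by
  rw [← eLpNorm_two_sq]
  exact (ENNReal.pow_le_pow_left_iff two_ne_zero).symm

theorem ennreal_add_sq_le (a b : ℝ≥0∞) : (a + b) ^ 2 ≤ 2 * (a ^ 2 + b ^ 2) := by
  have := ENNReal.rpow_add_le_mul_rpow_add_rpow a b (p := 2) (by norm_num)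
  norm_num at this
  exact this

theorem lintegral_enorm_mul_le (h k : X → ℝ) (hh : AEMeasurable h μ) (hk : AEMeasurable k μ) :
    ∫⁻ x, ‖h x‖ₑ * ‖k x‖ₑ ∂μ ≤ eLpNorm h 2 μ * eLpNorm k 2 μ := by
  have := ENNReal.lintegral_mul_le_Lp_mul_Lq μ (p := 2) (q := 2) Real.HolderConjugate.two_two
    hh.enorm hk.enorm
  rw [eLpNorm_eq_lintegral_rpow_enorm_toReal two_ne_zero ENNReal.ofNat_ne_top,
    eLpNorm_eq_lintegral_rpow_enorm_toReal two_ne_zero ENNReal.ofNat_ne_top]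
  simpa using this

theorem measurable_eLpNorm_two [SFinite μ] (hV : Measurable (Function.uncurry V)) :
    Measurable fun s => eLpNorm (V s) 2 μ := by
  simp_rw [eLpNorm_eq_lintegral_rpow_enorm_toReal (two_ne_zero (α := ℝ≥0∞)) ENNReal.ofNat_ne_top]
  exact (Measurable.lintegral_prod_right' (f := fun p : ℝ × X => ‖V p.1 p.2‖ₑ ^ (2 : ℝ≥0∞).toReal)
    (hV.enorm.pow_const _)).pow_const _

/-- Minkowski's integral inequality with exponent `2`. -/
theorem lintegral_sq_lintegral_le [SFinite m] [SFinite μ] (hV : Measurable (Function.uncurry V)) :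
    ∫⁻ x, (∫⁻ s, ‖V s x‖ₑ ∂m) ^ 2 ∂μ ≤ (∫⁻ s, eLpNorm (V s) 2 μ ∂m) ^ 2 := by
  have hs : ∀ s, Measurable (V s) := fun s => hV.of_uncurry_left
  have hx : ∀ x, Measurable (fun s => V s x) := fun x => hV.of_uncurry_right
  have hn := measurable_eLpNorm_two (μ := μ) hV
  -- Expanding the square as a double integral in time allows Cauchy–Schwarz in space for each pair
  -- of times.
  calc ∫⁻ x, (∫⁻ s, ‖V s x‖ₑ ∂m) ^ 2 ∂μ
      = ∫⁻ x, ∫⁻ s, ∫⁻ r, ‖V s x‖ₑ * ‖V r x‖ₑ ∂m ∂m ∂μ := by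
        refine lintegral_congr fun x => ?_
        rw [sq, ← lintegral_mul_const _ (hx x).enorm]
        refine lintegral_congr fun s => ?_
        rw [lintegral_const_mul _ (hx x).enorm]
    _ = ∫⁻ s, ∫⁻ x, ∫⁻ r, ‖V s x‖ₑ * ‖V r x‖ₑ ∂m ∂μ ∂m := by
        refine lintegral_lintegral_swap ?_
        refine Measurable.aemeasurable ?_
        refine Measurable.lintegral_prod_right' (ν := m)
          (f := fun p : (X × ℝ) × ℝ => ‖V p.1.2 p.1.1‖ₑ * ‖V p.2 p.1.1‖ₑ) ?_
        exact (hV.comp (by fun_prop : Measurable fun p : (X × ℝ) × ℝ => (p.1.2, p.1.1))).enorm.mul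
          (hV.comp (by fun_prop : Measurable fun p : (X × ℝ) × ℝ => (p.2, p.1.1))).enorm
    _ = ∫⁻ s, ∫⁻ r, ∫⁻ x, ‖V s x‖ₑ * ‖V r x‖ₑ ∂μ ∂m ∂m := by
        refine lintegral_congr fun s => lintegral_lintegral_swap (Measurable.aemeasurable ?_)
        exact ((hs s).comp measurable_fst).enorm.mul
          (hV.comp (by fun_prop : Measurable fun p : X × ℝ => (p.2, p.1))).enorm
    _ ≤ ∫⁻ s, ∫⁻ r, eLpNorm (V s) 2 μ * eLpNorm (V r) 2 μ ∂m ∂m := by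
        gcongr with s r
        exact lintegral_enorm_mul_le _ _ (hs s).aemeasurable (hs r).aemeasurable
    _ = (∫⁻ s, eLpNorm (V s) 2 μ ∂m) ^ 2 := by
        simp_rw [lintegral_const_mul _ hn]
        rw [lintegral_mul_const _ hn, sq]

theorem measurable_cum [SFinite m] (hV : Measurable (Function.uncurry V)) :
    Measurable (Function.uncurry (cum m V)) := by
  have : Function.uncurry (cum m V) =
      fun p : ℝ × X => ∫ s, {q : (ℝ × X) × ℝ | q.2 ≤ q.1.1}.indicator
        (fun q => V q.2 q.1.2) (p, s) ∂m := by
    ext ⟨t, x⟩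
    rw [Function.uncurry_apply_pair, cum, ← integral_indicator measurableSet_Iic]
    rfl
  rw [this]
  refine (StronglyMeasurable.integral_prod_right' (f := {q : (ℝ × X) × ℝ | q.2 ≤ q.1.1}.indicator
        (fun q => V q.2 q.1.2)) (Measurable.stronglyMeasurable ?_)).measurable
  exact (hV.comp (by fun_prop : Measurable fun p : (ℝ × X) × ℝ => (p.2, p.1.2))).indicator
    (measurableSet_le measurable_snd (measurable_fst.comp measurable_fst))

theorem L12.lintegral_sq_lt_top [SFinite m] [SFinite μ] (hV : L12 m μ V) :
    ∫⁻ x, (∫⁻ s, ‖V s x‖ₑ ∂m) ^ 2 ∂μ < ∞ :=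
  (lintegral_sq_lintegral_le hV.meas).trans_lt (ENNReal.pow_lt_top hV.fin)

theorem L12.integrable [SFinite m] [IsFiniteMeasure μ] (hV : L12 m μ V) :
    Integrable (Function.uncurry V) (m.prod μ) := by
  refine ⟨hV.meas.aestronglyMeasurable, ?_⟩
  rw [hasFiniteIntegral_iff_enorm, lintegral_prod _ hV.meas.enorm.aemeasurable]
  have h : ∀ s, ∫⁻ x, ‖V s x‖ₑ ∂μ ≤ eLpNorm (V s) 2 μ * μ univ ^ (1 / 2 : ℝ) := fun s => by
    have := eLpNorm_le_eLpNorm_mul_rpow_measure_univ (μ := μ) (p := 1) (q := 2) (by norm_num)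
      (hV.meas.of_uncurry_left (x := s)).aestronglyMeasurable
    rw [eLpNorm_one_eq_lintegral_enorm] at this
    convert this using 3
    norm_num
  refine (lintegral_mono h).trans_lt ?_
  rw [lintegral_mul_const' _ _ (by finiteness)]
  exact ENNReal.mul_lt_top hV.fin (by finiteness)

theorem L12.ae_integrable [SFinite m] [IsFiniteMeasure μ] (hV : L12 m μ V) :
    ∀ᵐ x ∂μ, Integrable (fun s => V s x) m :=
  hV.integrable.prod_left_ae

theorem L12.sub [SFinite μ] {W : ℝ → X → ℝ} (hV : L12 m μ V) (hW : L12 m μ W) :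
    L12 m μ (fun t x => V t x - W t x) := by
  refine ⟨hV.meas.sub hW.meas, ?_⟩
  have h : ∀ s, eLpNorm (fun x => V s x - W s x) 2 μ ≤ eLpNorm (V s) 2 μ + eLpNorm (W s) 2 μ :=
    fun s => eLpNorm_sub_le (hV.meas.of_uncurry_left).aestronglyMeasurable
      (hW.meas.of_uncurry_left).aestronglyMeasurable (by norm_num)
  refine (lintegral_mono h).trans_lt ?_
  rw [lintegral_add_left (measurable_eLpNorm_two hV.meas)]
  exact ENNReal.add_lt_top.2 ⟨hV.fin, hW.fin⟩

theorem L12.of_bounded [IsFiniteMeasure m] [IsFiniteMeasure μ] {C : ℝ}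
    (hV : Measurable (Function.uncurry V)) (hC : ∀ᵐ p ∂m.prod μ, |V p.1 p.2| ≤ C) :
    L12 m μ V := by
  refine ⟨hV, ?_⟩
  have h : ∀ᵐ s ∂m, eLpNorm (V s) 2 μ ≤ μ univ ^ (2 : ℝ≥0∞).toReal⁻¹ * ENNReal.ofReal C := by
    filter_upwards [Measure.ae_ae_of_ae_prod hC] with s hs
    exact eLpNorm_le_of_ae_bound hs
  refine (lintegral_mono_ae h).trans_lt ?_
  rw [lintegral_const]
  finiteness

/-- This envelope dominates `cum m V t` for all times at once; it is square integrable by Minkowski.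
-/
theorem L12.memLp_enorm [SFinite m] [SFinite μ] (hV : L12 m μ V) :
    MemLp (fun x => (∫⁻ s, ‖V s x‖ₑ ∂m).toReal) 2 μ := by
  have hm : Measurable fun x => (∫⁻ s, ‖V s x‖ₑ ∂m) :=
    Measurable.lintegral_prod_left' (f := fun p : ℝ × X => ‖V p.1 p.2‖ₑ) hV.meas.enorm
  refine ⟨hm.ennreal_toReal.aestronglyMeasurable, ?_⟩
  refine lt_of_le_of_lt (eLpNorm_two_le_iff.2
    (le_trans (lintegral_mono fun x => ?_) (lintegral_sq_lintegral_le hV.meas))) hV.fin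
  gcongr
  exact (Real.enorm_of_nonneg ENNReal.toReal_nonneg).trans_le ENNReal.ofReal_toReal_le

theorem L12.ae_abs_cum_le [SFinite m] [IsFiniteMeasure μ] (hV : L12 m μ V) :
    ∀ᵐ x ∂μ, ∀ t, |cum m V t x| ≤ (∫⁻ s, ‖V s x‖ₑ ∂m).toReal := by
  filter_upwards [hV.ae_integrable] with x hx t
  have := ENNReal.toReal_mono hx.2.ne (enorm_cum_le (m := m) (V := V) t x)
  simpa using this

theorem L12.ae_memLp [SFinite μ] (hV : L12 m μ V) : ∀ᵐ s ∂m, MemLp (V s) 2 μ := by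
  filter_upwards [ae_lt_top (measurable_eLpNorm_two hV.meas) hV.fin.ne] with s hs
  exact ⟨hV.meas.of_uncurry_left.aestronglyMeasurable, hs⟩

theorem L12.memLp_cum [SFinite m] [IsFiniteMeasure μ] (hV : L12 m μ V) (t : ℝ) :
    MemLp (cum m V t) 2 μ := by
  refine hV.memLp_enorm.mono (measurable_cum hV.meas).of_uncurry_left.aestronglyMeasurable ?_
  filter_upwards [hV.ae_abs_cum_le] with x hx
  simpa using hx t

/-! ### The chain rule for squares of primitives, and energy -/

theorem continuous_setIntegral_Iic [NullSingletonClass m] {v : ℝ → ℝ} (hv : Integrable v m) :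
    Continuous fun t => ∫ s in Iic t, v s ∂m := by
  have h := intervalIntegral.continuous_primitive (μ := m) (f := v)
    (fun a b => hv.intervalIntegrable) 0
  have h2 : (fun t => ∫ s in Iic t, v s ∂m) =
      fun t => (∫ s in (0 : ℝ)..t, v s ∂m) + ∫ s in Iic 0, v s ∂m := by
    ext t
    rw [← intervalIntegral.integral_Iic_sub_Iic hv.integrableOn hv.integrableOn]
    ring
  rw [h2]
  exact h.add continuous_const

/-- The square is a double integral of `v s * v r`, and the triangles `r ≤ s` and `r > s` contribute
equally by Fubini and symmetry. Since `m` has no atoms, open and closed triangles are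
interchangeable. This replaces differentiation of the square. -/
theorem sq_integral_eq [SFinite m] [NullSingletonClass m] {v : ℝ → ℝ} (hv : Integrable v m) :
    (∫ s, v s ∂m) ^ 2 = 2 * ∫ s, v s * ∫ r in Iic s, v r ∂m ∂m := by
  have h1 : ∀ s, (∫ r, v r ∂m) = (∫ r in Iic s, v r ∂m) + ∫ r in Ioi s, v r ∂m := fun s => by
    rw [← integral_add_compl measurableSet_Iic hv, compl_Iic]
  have hvv : Integrable (fun p : ℝ × ℝ => v p.1 * v p.2) (m.prod m) := hv.mul_prod hv
  have i1 : Integrable (fun s => v s * ∫ r in Iic s, v r ∂m) m := by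
    have := (hvv.indicator (measurableSet_le measurable_snd measurable_fst)).integral_prod_left
    refine this.congr (Eventually.of_forall fun s => ?_)
    simp only
    rw [← integral_indicator measurableSet_Iic, ← integral_const_mul]
    refine integral_congr_ae (Eventually.of_forall fun r => ?_)
    by_cases h : r ≤ s <;> simp [indicator, h]
  have i2 : Integrable (fun s => v s * ∫ r in Ioi s, v r ∂m) m := by
    have := (hv.mul_const (∫ r, v r ∂m)).sub i1
    refine this.congr (Eventually.of_forall fun s => ?_)
    simp only [Pi.sub_apply]
    rw [h1 s]
    ring
  have h2 : ∫ s, v s * ∫ r in Ioi s, v r ∂m ∂m = ∫ s, v s * ∫ r in Iic s, v r ∂m ∂m := by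
    calc ∫ s, v s * ∫ r in Ioi s, v r ∂m ∂m
        = ∫ s, ∫ r, {p : ℝ × ℝ | p.1 < p.2}.indicator (fun p => v p.1 * v p.2) (s, r) ∂m ∂m := by
          refine integral_congr_ae (Eventually.of_forall fun s => ?_)
          simp only
          rw [← integral_indicator measurableSet_Ioi, ← integral_const_mul]
          refine integral_congr_ae (Eventually.of_forall fun r => ?_)
          by_cases h : s < r <;> simp [indicator, h]
      _ = ∫ r, ∫ s, {p : ℝ × ℝ | p.1 < p.2}.indicator (fun p => v p.1 * v p.2) (s, r) ∂m ∂m :=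
          integral_integral_swap (hvv.indicator (measurableSet_lt measurable_fst measurable_snd))
      _ = ∫ r, v r * ∫ s in Iio r, v s ∂m ∂m := by
          refine integral_congr_ae (Eventually.of_forall fun r => ?_)
          simp only
          rw [← integral_indicator measurableSet_Iio, ← integral_const_mul]
          refine integral_congr_ae (Eventually.of_forall fun s => ?_)
          by_cases h : s < r <;> simp [indicator, h, mul_comm]
      _ = _ := by simp_rw [integral_Iic_eq_integral_Iio]
  calc (∫ s, v s ∂m) ^ 2 = ∫ s, v s * (∫ r, v r ∂m) ∂m := by rw [integral_mul_const, sq]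
    _ = ∫ s, (v s * (∫ r in Iic s, v r ∂m) + v s * ∫ r in Ioi s, v r ∂m) ∂m := by
        refine integral_congr_ae (Eventually.of_forall fun s => ?_)
        simp only
        rw [h1 s]
        ring
    _ = _ := by
        rw [integral_add i1 i2, h2]
        ring

/-- The integrated form of `(y²)' = 2 y y'` for `y = a + ∫ v`: the previous identity is applied to
`m` restricted to `Iic t`, a restriction that inner integrals up to `s ≤ t` do not see. -/
theorem sq_add_setIntegral_Iic [IsFiniteMeasure m] [NullSingletonClass m] {v : ℝ → ℝ} (hv : Integrable v m)
    (a t : ℝ) :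
    (a + ∫ s in Iic t, v s ∂m) ^ 2 =
      a ^ 2 + 2 * ∫ s in Iic t, v s * (a + ∫ r in Iic s, v r ∂m) ∂m := by
  have h := sq_integral_eq (m := m.restrict (Iic t)) hv.restrict
  have h1 : ∫ s in Iic t, v s * ∫ r in Iic s, v r ∂(m.restrict (Iic t)) ∂m =
      ∫ s in Iic t, v s * ∫ r in Iic s, v r ∂m ∂m := by
    refine setIntegral_congr_fun measurableSet_Iic fun s hs => ?_
    rw [Measure.restrict_restrict measurableSet_Iic,
      inter_eq_left.2 (Iic_subset_Iic.2 hs)]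
  have hb : Integrable (fun s => v s * ∫ r in Iic s, v r ∂m) m := by
    refine hv.mul_bdd (c := ∫ s, ‖v s‖ ∂m) (continuous_setIntegral_Iic hv).aestronglyMeasurable
      (Eventually.of_forall fun s => ?_)
    exact (norm_integral_le_integral_norm _).trans
      (setIntegral_le_integral hv.norm (Eventually.of_forall fun _ => norm_nonneg _))
  simp_rw [mul_add]
  rw [integral_add (hv.mul_const a).integrableOn hb.integrableOn, integral_mul_const, add_sq, h, h1]
  ring

/-- With `G = ∫ ‖V s ·‖ dm(s)`, integrating in time bounds the product by `G (‖U‖ + G) ≤ 2 (‖U‖² +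
G²)`, and `G` is in `L²(μ)` by Minkowski. Thus Fubini applies although `V` is only integrable in
time. -/
theorem L12.integrable_mul_cum [IsFiniteMeasure m] [IsFiniteMeasure μ] (hV : L12 m μ V)
    {U : X → ℝ} (hU : Measurable U) (hU2 : MemLp U 2 μ) :
    Integrable (fun p : ℝ × X => V p.1 p.2 * (U p.2 + cum m V p.1 p.2)) (m.prod μ) := by
  have hm : Measurable (fun p : ℝ × X => V p.1 p.2 * (U p.2 + cum m V p.1 p.2)) :=
    hV.meas.mul ((hU.comp measurable_snd).add (measurable_cum hV.meas))
  have hG : Measurable fun x => (∫⁻ s, ‖V s x‖ₑ ∂m) :=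
    Measurable.lintegral_prod_left' (f := fun p : ℝ × X => ‖V p.1 p.2‖ₑ) hV.meas.enorm
  refine ⟨hm.aestronglyMeasurable, ?_⟩
  rw [hasFiniteIntegral_iff_enorm, lintegral_prod_symm _ hm.enorm.aemeasurable]
  calc ∫⁻ x, ∫⁻ s, ‖V s x * (U x + cum m V s x)‖ₑ ∂m ∂μ
      ≤ ∫⁻ x, ∫⁻ s, ‖V s x‖ₑ * (‖U x‖ₑ + ∫⁻ s, ‖V s x‖ₑ ∂m) ∂m ∂μ := by
        gcongr with x s
        rw [enorm_mul]
        gcongr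
        exact (enorm_add_le _ _).trans (by gcongr; exact enorm_cum_le s x)
    _ = ∫⁻ x, (∫⁻ s, ‖V s x‖ₑ ∂m) * (‖U x‖ₑ + ∫⁻ s, ‖V s x‖ₑ ∂m) ∂μ := by
        refine lintegral_congr fun x => ?_
        rw [lintegral_mul_const _ hV.meas.of_uncurry_right.enorm]
    _ ≤ ∫⁻ x, 2 * (‖U x‖ₑ ^ 2 + (∫⁻ s, ‖V s x‖ₑ ∂m) ^ 2) ∂μ := by
        refine lintegral_mono fun x => le_trans ?_ (ennreal_add_sq_le _ _)
        rw [sq]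
        gcongr
        exact le_add_self
    _ = 2 * (∫⁻ x, ‖U x‖ₑ ^ 2 ∂μ + ∫⁻ x, (∫⁻ s, ‖V s x‖ₑ ∂m) ^ 2 ∂μ) := by
        rw [lintegral_const_mul, lintegral_add_left (hU.enorm.pow_const 2)]
        exact (hU.enorm.pow_const 2).add (hG.pow_const 2)
    _ < ∞ := by
        refine ENNReal.mul_lt_top (by simp) (ENNReal.add_lt_top.2 ⟨?_, hV.lintegral_sq_lt_top⟩)
        rw [← eLpNorm_two_sq]
        exact ENNReal.pow_lt_top hU2.2

/-- The energy identity for `U + ∫ V`. -/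
theorem L12.integral_sq_eq [IsFiniteMeasure m] [NullSingletonClass m] [IsFiniteMeasure μ] (hV : L12 m μ V)
    {U : X → ℝ} (hU : Measurable U) (hU2 : MemLp U 2 μ) (t : ℝ) :
    ∫ x, (U x + cum m V t x) ^ 2 ∂μ =
      ∫ x, U x ^ 2 ∂μ + 2 * ∫ s in Iic t, ∫ x, V s x * (U x + cum m V s x) ∂μ ∂m := by
  have hi := hV.integrable_mul_cum hU hU2
  have hi' : Integrable (fun p : ℝ × X => V p.1 p.2 * (U p.2 + cum m V p.1 p.2))
      ((m.restrict (Iic t)).prod μ) :=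
    hi.mono_measure (Measure.prod_mono Measure.restrict_le_self le_rfl)
  rw [integral_integral_swap hi', ← integral_const_mul, ← integral_add hU2.integrable_sq
    (hi'.integral_prod_right.const_mul 2)]
  refine integral_congr_ae ?_
  filter_upwards [hV.ae_integrable] with x hx
  exact sq_add_setIntegral_Iic hx (U x) t

/-- Dominated convergence: at almost every point the primitive is continuous in time, and the square
of `2 ∫ ‖V s ·‖ dm(s)` is an integrable majorant. -/
theorem L12.tendsto_eLpNorm_cum_sub [SFinite m] [NullSingletonClass m] [IsFiniteMeasure μ]
    (hV : L12 m μ V) (t₀ : ℝ) :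
    Tendsto (fun t => eLpNorm (cum m V t - cum m V t₀) 2 μ) (𝓝 t₀) (𝓝 0) := by
  have hc : ∀ t, Measurable (cum m V t) := fun t => (measurable_cum hV.meas).of_uncurry_left
  have key : Tendsto (fun t => ∫⁻ x, ‖cum m V t x - cum m V t₀ x‖ₑ ^ 2 ∂μ) (𝓝 t₀)
      (𝓝 (∫⁻ x, 0 ∂μ)) := by
    refine tendsto_lintegral_filter_of_dominated_convergence
      (fun x => (2 * ∫⁻ s, ‖V s x‖ₑ ∂m) ^ 2)
      (Eventually.of_forall fun t => ((hc t).sub (hc t₀)).enorm.pow_const 2)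
      (Eventually.of_forall fun t => Eventually.of_forall fun x => ?_) ?_ ?_
    · gcongr
      rw [two_mul]
      refine (enorm_sub_le).trans (add_le_add (enorm_cum_le t x) (enorm_cum_le t₀ x))
    · simp_rw [mul_pow]
      rw [lintegral_const_mul' _ _ (by simp)]
      exact (ENNReal.mul_lt_top (by simp) hV.lintegral_sq_lt_top).ne
    · filter_upwards [hV.ae_integrable] with x hx
      have h : Continuous fun t => cum m V t x - cum m V t₀ x :=
        (continuous_setIntegral_Iic hx).sub continuous_const
      have h1 := h.tendsto t₀
      simp only [sub_self] at h1
      have h2 := ((ENNReal.continuous_pow 2).comp continuous_enorm).tendsto (0 : ℝ)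
      simp only [Function.comp, enorm_zero, ne_eq, OfNat.ofNat_ne_zero, not_false_eq_true, zero_pow] at h2
      exact h2.comp h1
  rw [lintegral_zero] at key
  have h3 := (ENNReal.continuous_rpow_const (y := (1 / 2 : ℝ))).tendsto 0
  rw [ENNReal.zero_rpow_of_pos (by norm_num)] at h3
  refine (h3.comp key).congr fun t => ?_
  simp only [Function.comp]
  have := eLpNorm_two_sq (μ := μ) (cum m V t - cum m V t₀)
  simp only [Pi.sub_apply] at this
  rw [← this, ← ENNReal.rpow_natCast, ← ENNReal.rpow_mul]
  norm_num

/-! ### Measure on the time interval, and a Gronwall inequality -/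

instance (T : ℝ) : IsFiniteMeasure (μT T) := by unfold μT; infer_instance

instance (T : ℝ) : NullSingletonClass (μT T) := by unfold μT; infer_instance

theorem ae_mem_Icc (T : ℝ) : ∀ᵐ t ∂(μT T), t ∈ Icc 0 T := ae_restrict_mem measurableSet_Icc

theorem intervalIntegral_eq_setIntegral_Iic {T t : ℝ} (ht : t ∈ Icc 0 T) (v : ℝ → ℝ) :
    ∫ s in (0 : ℝ)..t, v s = ∫ s in Iic t, v s ∂(μT T) := by
  rw [intervalIntegral.integral_of_le ht.1, μT, Measure.restrict_restrict measurableSet_Iic,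
    ← integral_Icc_eq_integral_Ioc]
  congr 2
  ext s
  simp only [mem_Icc, mem_inter_iff, mem_Iic]
  exact ⟨fun h => ⟨h.2, h.1, h.2.trans ht.2⟩, fun h => ⟨h.2.1, h.1⟩⟩

/-- A nonlinear Gronwall inequality. -/
theorem sqrt_le_of_le_integral_mul_sqrt {T A : ℝ} {φ c : ℝ → ℝ} (hφ : ∀ t, 0 ≤ φ t)
    (hA : 0 ≤ A) (hc : ∀ t, 0 ≤ c t) (hci : Integrable c (μT T)) (hφc : ContinuousOn φ (Icc 0 T))
    (h : ∀ t ∈ Icc 0 T, φ t ≤ A + 2 * ∫ s in Iic t, c s * √(φ s) ∂(μT T)) :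
    ∀ t ∈ Icc 0 T, √(φ t) ≤ √A + ∫ s in Iic t, c s ∂(μT T) := by
  -- Enlarging `A` to `B` makes the comparison strict. The comparison function `χ` solves `χ² = B +
  -- 2 ∫ c χ` exactly, by the chain rule for squares.
  have main : ∀ B, A < B → ∀ t ∈ Icc 0 T, √(φ t) ≤ √B + ∫ s in Iic t, c s ∂(μT T) := by
    intro B hB
    set χ : ℝ → ℝ := fun t => √B + ∫ s in Iic t, c s ∂(μT T) with hχ
    have hχc : Continuous χ := continuous_const.add (continuous_setIntegral_Iic hci)
    have hχ0 : ∀ t, 0 ≤ χ t := fun t =>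
      add_nonneg (Real.sqrt_nonneg _) (integral_nonneg fun s => hc s)
    have hχsq : ∀ t, χ t ^ 2 = B + 2 * ∫ s in Iic t, c s * χ s ∂(μT T) := fun t => by
      have := sq_add_setIntegral_Iic hci (√B) t
      rwa [Real.sq_sqrt (hA.trans hB.le)] at this
    by_contra! hcon
    obtain ⟨t₁, ht₁, hlt⟩ := hcon
    set S : Set ℝ := Icc 0 T ∩ {t | χ t ≤ √(φ t)} with hS
    have hSc : IsClosed S := by
      have := (hφc.sqrt.sub hχc.continuousOn).preimage_isClosed_of_isClosed isClosed_Icc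
        (isClosed_Ici (a := (0 : ℝ)))
      convert this using 2
      ext t
      simp
    have hSne : S.Nonempty := ⟨t₁, ht₁, hlt.le⟩
    have hSb : BddBelow S := ⟨0, fun t ht => ht.1.1⟩
    have h0 : sInf S ∈ S := hSc.csInf_mem hSne hSb
    set t₀ := sInf S with ht₀
    -- The time `t₀` is the first one at which `χ ≤ √φ`; strictly before it the order is reversed.
    have hbefore : ∀ s ∈ Icc 0 T, s < t₀ → √(φ s) < χ s := fun s hs hst => by
      by_contra! hcon
      exact absurd (csInf_le hSb ⟨hs, hcon⟩) (not_le.2 hst)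
    have hle : ∫ s in Iic t₀, c s * √(φ s) ∂(μT T) ≤ ∫ s in Iic t₀, c s * χ s ∂(μT T) := by
      -- The comparison is available only for `s < t₀`; the endpoint has measure zero.
      rw [integral_Iic_eq_integral_Iio, integral_Iic_eq_integral_Iio]
      refine integral_mono_of_nonneg
        (Eventually.of_forall fun s => mul_nonneg (hc s) (Real.sqrt_nonneg _)) ?_ ?_
      · refine Integrable.integrableOn (hci.mul_bdd (c := √B + ∫ s, c s ∂(μT T))
          hχc.aestronglyMeasurable (Eventually.of_forall fun s => ?_))
        rw [Real.norm_of_nonneg (hχ0 s)]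
        exact add_le_add le_rfl (setIntegral_le_integral hci (Eventually.of_forall hc))
      · filter_upwards [ae_restrict_mem measurableSet_Iio, ae_restrict_of_ae (ae_mem_Icc T)]
          with s hs hs'
        exact mul_le_mul_of_nonneg_left (hbefore s hs' hs).le (hc s)
    -- At `t₀` this gives `φ ≤ A + 2 ∫ c √φ ≤ A + 2 ∫ c χ < χ² ≤ φ`, a contradiction.
    have h1 := h t₀ h0.1
    have h2 := hχsq t₀
    have h3 : χ t₀ ^ 2 ≤ φ t₀ := by
      rw [← Real.sq_sqrt (hφ t₀)]
      exact pow_le_pow_left₀ (hχ0 _) h0.2 2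
    linarith
  intro t ht
  have hlim : Tendsto (fun B => √B + ∫ s in Iic t, c s ∂(μT T)) (𝓝[>] A)
      (𝓝 (√A + ∫ s in Iic t, c s ∂(μT T))) :=
    ((Real.continuous_sqrt.tendsto A).add tendsto_const_nhds).mono_left nhdsWithin_le_nhds
  refine ge_of_tendsto hlim ?_
  filter_upwards [self_mem_nhdsWithin] with B hB
  exact main B hB t ht

end Primitive

/-! ### The 1-Laplacian on a finite measure space -/

section Operator

variable {X : Type*} [MeasurableSpace X] {μ : Measure X} {K K₁ K₂ : X → X → ℝ} {M M₁ M₂ : ℝ}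

/-- Admissible kernels on a measure space. -/
structure Ker (μ : Measure X) (K : X → X → ℝ) (M : ℝ) : Prop where
  meas : Measurable (Function.uncurry K)
  nonneg : ∀ x y, 0 ≤ K x y
  symm : ∀ x y, K x y = K y x
  row : ∀ᵐ x ∂μ, ∫⁻ y, ‖K x y‖ₑ ∂μ ≤ ENNReal.ofReal M
  sq : MemLp (Function.uncurry K) 2 (μ.prod μ)

/-- `η` is a value at `u` of the 1-Laplacian with kernel `K` on the measure space `(X, μ)`. -/
def InLap (μ : Measure X) (K : X → X → ℝ) (u η : X → ℝ) : Prop :=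
  ∃ w : X → X → ℝ, AEStronglyMeasurable (Function.uncurry w) (μ.prod μ) ∧
    (∀ᵐ p ∂(μ.prod μ), |w p.1 p.2| ≤ 1) ∧ (∀ᵐ p ∂(μ.prod μ), w p.1 p.2 = -w p.2 p.1) ∧
    (∀ᵐ p ∂(μ.prod μ), w p.1 p.2 ∈ absSubdiff (u p.2 - u p.1)) ∧
    ∀ᵐ x ∂μ, η x = -∫ y, K x y * w x y ∂μ

/-- This form replaces the case distinction by a bound and one equation linear in `w`, both of which
can be checked on weak limits. -/
theorem mem_absSubdiff_iff {w r : ℝ} : w ∈ absSubdiff r ↔ |w| ≤ 1 ∧ w * r = |r| := by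
  unfold absSubdiff
  rcases lt_trichotomy r 0 with h | h | h
  · rw [if_neg h.not_gt, if_neg h.ne, abs_of_neg h, mem_singleton_iff]
    constructor
    · rintro rfl; simp
    · rintro ⟨-, h2⟩
      exact mul_right_cancel₀ h.ne (by linarith)
  · subst h; simp [abs_le]
  · rw [if_pos h, abs_of_pos h, mem_singleton_iff]
    constructor
    · rintro rfl; simp
    · rintro ⟨-, h2⟩
      exact mul_right_cancel₀ h.ne' (by linarith)

/-- Expanding, the product equals `|r₁| + |r₂| - w₁ r₂ - w₂ r₁`, and each mixed term is at most the
corresponding absolute value. -/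
theorem absSubdiff_monotone {w₁ w₂ r₁ r₂ : ℝ} (h₁ : w₁ ∈ absSubdiff r₁) (h₂ : w₂ ∈ absSubdiff r₂) :
    0 ≤ (w₁ - w₂) * (r₁ - r₂) := by
  rw [mem_absSubdiff_iff] at h₁ h₂
  have a : w₁ * r₂ ≤ |r₂| := (le_abs_self _).trans (by
    rw [abs_mul]; exact mul_le_of_le_one_left (abs_nonneg _) h₁.1)
  have b : w₂ * r₁ ≤ |r₁| := (le_abs_self _).trans (by
    rw [abs_mul]; exact mul_le_of_le_one_left (abs_nonneg _) h₂.1)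
  nlinarith [h₁.2, h₂.2]

theorem MemLp.integral_sq_eq {h : X → ℝ} (hh : MemLp h 2 μ) :
    ∫ x, h x ^ 2 ∂μ = (eLpNorm h 2 μ).toReal ^ 2 := by
  rw [← ENNReal.toReal_pow, eLpNorm_two_sq, integral_eq_lintegral_of_nonneg_ae
    (Eventually.of_forall fun x => sq_nonneg _) hh.integrable_sq.aestronglyMeasurable]
  congr 1
  refine lintegral_congr fun x => ?_
  rw [← sq_abs, ENNReal.ofReal_pow (abs_nonneg _), Real.enorm_eq_ofReal_abs]

theorem MemLp.abs_integral_mul_le {h k : X → ℝ} (hh : MemLp h 2 μ) (hk : MemLp k 2 μ) :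
    |∫ x, h x * k x ∂μ| ≤ (eLpNorm h 2 μ).toReal * (eLpNorm k 2 μ).toReal := by
  rw [← ENNReal.toReal_mul]
  have h1 := enorm_integral_le_lintegral_enorm (μ := μ) (fun x => h x * k x)
  simp_rw [enorm_mul] at h1
  have h2 := ENNReal.toReal_mono (ENNReal.mul_ne_top hh.2.ne hk.2.ne)
    (h1.trans (lintegral_enorm_mul_le h k hh.1.aemeasurable hk.1.aemeasurable))
  simpa using h2

theorem ae_ae_of_ae_prod_swap {Y : Type*} [MeasurableSpace Y] {ν : Measure Y} [SFinite μ]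
    [SFinite ν] {P : X × Y → Prop} (h : ∀ᵐ p ∂(μ.prod ν), P p) :
    ∀ᵐ y ∂ν, ∀ᵐ x ∂μ, P (x, y) :=
  Measure.ae_ae_of_ae_prod (p := fun q : Y × X => P q.swap)
    (Measure.measurePreserving_swap.quasiMeasurePreserving.ae h)

theorem Ker.ae_abs_integral_le [SFinite μ] (hK : Ker μ K M) (hM : 0 ≤ M) {w : X → X → ℝ}
    (hw : ∀ᵐ p ∂(μ.prod μ), |w p.1 p.2| ≤ 1) : ∀ᵐ x ∂μ, |∫ y, K x y * w x y ∂μ| ≤ M := by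
  filter_upwards [hK.row, Measure.ae_ae_of_ae_prod hw] with x hx hwx
  have h1 : ‖∫ y, K x y * w x y ∂μ‖ₑ ≤ ENNReal.ofReal M := by
    refine (enorm_integral_le_lintegral_enorm _).trans (le_trans (lintegral_mono_ae ?_) hx)
    filter_upwards [hwx] with y hy
    rw [enorm_mul]
    refine mul_le_of_le_one_right' ?_
    rw [Real.enorm_eq_ofReal_abs]
    simpa using hy
  rw [Real.enorm_eq_ofReal_abs] at h1
  exact (ENNReal.ofReal_le_ofReal_iff hM).1 h1

theorem aestronglyMeasurable_integral_mul [SFinite μ] (hK : Measurable (Function.uncurry K))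
    {w : X → X → ℝ} (hw : AEStronglyMeasurable (Function.uncurry w) (μ.prod μ)) :
    AEStronglyMeasurable (fun x => ∫ y, K x y * w x y ∂μ) μ :=
  (hK.aestronglyMeasurable.mul hw).integral_prod_right'

theorem InLap.ae_abs_le [SFinite μ] (hK : Ker μ K M) (hM : 0 ≤ M) {u η : X → ℝ}
    (h : InLap μ K u η) : ∀ᵐ x ∂μ, |η x| ≤ M := by
  obtain ⟨w, -, h1, -, -, h2⟩ := h
  filter_upwards [h2, hK.ae_abs_integral_le hM h1] with x hx hx'
  rw [hx, abs_neg]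
  exact hx'

theorem InLap.memLp [IsFiniteMeasure μ] (hK : Ker μ K M) (hM : 0 ≤ M) {u η : X → ℝ}
    (h : InLap μ K u η) (q : ℝ≥0∞) : MemLp η q μ := by
  refine MemLp.of_bound ?_ M (h.ae_abs_le hK hM)
  obtain ⟨w, h0, -, -, -, h2⟩ := h
  exact (aestronglyMeasurable_integral_mul hK.meas h0).neg.congr (h2.mono fun x hx => hx.symm)

theorem integrable_kernel_mul [IsFiniteMeasure μ] (hK : MemLp (Function.uncurry K) 2 (μ.prod μ))
    {a : X → X → ℝ} (ha : AEStronglyMeasurable (Function.uncurry a) (μ.prod μ)) {C : ℝ}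
    (hC : ∀ᵐ p ∂(μ.prod μ), |a p.1 p.2| ≤ C) {U : X → ℝ} (hU : MemLp U 2 μ) :
    Integrable (fun p : X × X => U p.1 * (K p.1 p.2 * a p.1 p.2)) (μ.prod μ) := by
  have h1 : Integrable (fun p : X × X => U p.1 * K p.1 p.2) (μ.prod μ) :=
    (hU.comp_fst μ).integrable_mul hK
  exact (h1.mul_bdd ha hC).congr (Eventually.of_forall fun p => by simp only; ring_nf; rfl)

/-- Swapping the variables changes the sign of `K a`, so the integral of `U(x) K a` is minus that of
`U(y) K a`. Twice the left side is therefore `-∫∫ K a (U(y) - U(x))`, which is nonpositive. The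
bound on `a` and `K ∈ L²` justify Fubini. -/
theorem integral_mul_kernel_nonpos [IsFiniteMeasure μ] (hK : Ker μ K M) {a : X → X → ℝ}
    (ha : AEStronglyMeasurable (Function.uncurry a) (μ.prod μ)) {C : ℝ}
    (hC : ∀ᵐ p ∂(μ.prod μ), |a p.1 p.2| ≤ C) (hanti : ∀ᵐ p ∂(μ.prod μ), a p.1 p.2 = -a p.2 p.1)
    {U : X → ℝ} (hU : MemLp U 2 μ) (hmono : ∀ᵐ p ∂(μ.prod μ), 0 ≤ a p.1 p.2 * (U p.2 - U p.1)) :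
    ∫ x, U x * ∫ y, K x y * a x y ∂μ ∂μ ≤ 0 := by
  have hi := integrable_kernel_mul hK.sq ha hC hU
  have e1 : ∫ x, U x * ∫ y, K x y * a x y ∂μ ∂μ =
      ∫ p : X × X, U p.1 * (K p.1 p.2 * a p.1 p.2) ∂(μ.prod μ) := by
    rw [integral_prod _ hi]
    simp_rw [integral_const_mul]
  have e2 : ∫ p : X × X, U p.1 * (K p.1 p.2 * a p.1 p.2) ∂(μ.prod μ) =
      -∫ p : X × X, U p.2 * (K p.1 p.2 * a p.1 p.2) ∂(μ.prod μ) := by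
    rw [← integral_prod_swap, ← integral_neg]
    refine integral_congr_ae ?_
    filter_upwards [hanti] with p hp
    simp only [Prod.fst_swap, Prod.snd_swap]
    rw [hK.symm p.2 p.1, hp]
    ring
  have hi2 : Integrable (fun p : X × X => U p.2 * (K p.1 p.2 * a p.1 p.2)) (μ.prod μ) := by
    refine hi.swap.neg.congr ?_
    filter_upwards [hanti] with p hp
    simp only [Pi.neg_apply, Function.comp, Prod.fst_swap, Prod.snd_swap]
    rw [hK.symm p.2 p.1, hp]
    ring
  have e3 : 0 ≤ ∫ p : X × X, (U p.2 * (K p.1 p.2 * a p.1 p.2) - U p.1 * (K p.1 p.2 * a p.1 p.2))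
      ∂(μ.prod μ) := by
    refine integral_nonneg_of_ae ?_
    filter_upwards [hmono] with p hp
    have := mul_nonneg (hK.nonneg p.1 p.2) hp
    simp only [Pi.zero_apply]
    linarith
  rw [integral_sub hi2 hi] at e3
  rw [e1]
  linarith

/-- Two-kernel form of the monotonicity of the 1-Laplacian. -/
theorem InLap.neg_integral_sub_mul_sub_le [IsProbabilityMeasure μ] (hK₁ : Ker μ K₁ M₁)
    (hK₂ : Ker μ K₂ M₂) {u₁ u₂ η₁ η₂ : X → ℝ} (h₁ : InLap μ K₁ u₁ η₁) (h₂ : InLap μ K₂ u₂ η₂)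
    (hu : MemLp (u₁ - u₂) 2 μ) :
    -∫ x, (u₁ - u₂) x * (η₁ x - η₂ x) ∂μ ≤ (eLpNorm (u₁ - u₂) 2 μ).toReal *
      (eLpNorm (fun p : X × X => K₁ p.1 p.2 - K₂ p.1 p.2) 2 (μ.prod μ)).toReal := by
  obtain ⟨w₁, m₁, b₁, a₁, s₁, e₁⟩ := h₁
  obtain ⟨w₂, m₂, b₂, a₂, s₂, e₂⟩ := h₂
  set U := u₁ - u₂ with hU
  have hd : MemLp (Function.uncurry fun x y => K₁ x y - K₂ x y) 2 (μ.prod μ) := hK₁.sq.sub hK₂.sq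
  have b₁₂ : ∀ᵐ p ∂(μ.prod μ), |w₁ p.1 p.2 - w₂ p.1 p.2| ≤ 2 := by
    filter_upwards [b₁, b₂] with p h1 h2
    exact (abs_sub _ _).trans (by linarith)
  have m₁₂ : AEStronglyMeasurable (Function.uncurry fun x y => w₁ x y - w₂ x y) (μ.prod μ) :=
    m₁.sub m₂
  have i1 := integrable_kernel_mul hK₁.sq m₁₂ b₁₂ hu
  have i2 := integrable_kernel_mul hd m₂ b₂ hu
  have hneg := integral_mul_kernel_nonpos hK₁ m₁₂ b₁₂ (by
    filter_upwards [a₁, a₂] with p h1 h2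
    rw [h1, h2]; ring) hu (by
    filter_upwards [s₁, s₂] with p h1 h2
    have := absSubdiff_monotone h1 h2
    rw [hU]
    simp only [Pi.sub_apply]
    linarith)
  have i1' : Integrable (fun x => U x * ∫ y, K₁ x y * (w₁ x y - w₂ x y) ∂μ) μ := by
    have := i1.integral_prod_left
    simpa only [integral_const_mul] using this
  have i2' : Integrable (fun x => U x * ∫ y, (K₁ x y - K₂ x y) * w₂ x y ∂μ) μ := by
    have := i2.integral_prod_left
    simpa only [integral_const_mul] using this
  have one : MemLp (fun _ : X => (1 : ℝ)) 2 μ := memLp_const 1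
  have r1 := (integrable_kernel_mul hK₁.sq m₁₂ b₁₂ one).prod_right_ae
  have r2 := (integrable_kernel_mul hd m₂ b₂ one).prod_right_ae
  have r3 := (integrable_kernel_mul hK₁.sq m₁ b₁ one).prod_right_ae
  have r4 := (integrable_kernel_mul hK₂.sq m₂ b₂ one).prod_right_ae
  -- The splitting `K₁w₁ - K₂w₂ = K₁(w₁ - w₂) + (K₁ - K₂)w₂`: the first term is handled by
  -- monotonicity for the single kernel `K₁`, the second by Cauchy–Schwarz and `|w₂| ≤ 1`.
  have key : -∫ x, U x * (η₁ x - η₂ x) ∂μ =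
      ∫ x, U x * ∫ y, K₁ x y * (w₁ x y - w₂ x y) ∂μ ∂μ +
      ∫ x, U x * ∫ y, (K₁ x y - K₂ x y) * w₂ x y ∂μ ∂μ := by
    rw [← integral_add i1' i2', ← integral_neg]
    refine integral_congr_ae ?_
    filter_upwards [e₁, e₂, r1, r2, r3, r4] with x h1 h2 h3 h4 h5 h6
    simp only [one_mul] at h3 h4 h5 h6
    rw [h1, h2, ← mul_add, ← integral_add h3 h4, ← mul_neg, neg_sub_neg, neg_sub,
      ← integral_sub h5 h6]
    congr 1
    refine integral_congr_ae (Eventually.of_forall fun y => ?_)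
    simp only
    ring
  rw [key]
  have e2 : ∫ x, U x * ∫ y, (K₁ x y - K₂ x y) * w₂ x y ∂μ ∂μ =
      ∫ p : X × X, U p.1 * ((K₁ p.1 p.2 - K₂ p.1 p.2) * w₂ p.1 p.2) ∂(μ.prod μ) := by
    rw [integral_prod _ i2]
    simp_rw [integral_const_mul]
  -- Total mass one makes the lift of `U` to the product isometric, so no volume factor enters the
  -- final estimate.
  have hUf : eLpNorm (fun p : X × X => U p.1) 2 (μ.prod μ) = eLpNorm U 2 μ :=
    eLpNorm_comp_measurePreserving hu.1 measurePreserving_fst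
  have hdw : MemLp (fun p : X × X => (K₁ p.1 p.2 - K₂ p.1 p.2) * w₂ p.1 p.2) 2 (μ.prod μ) := by
    refine hd.mono (hd.1.mul m₂) ?_
    filter_upwards [b₂] with p hp
    rw [norm_mul]
    exact mul_le_of_le_one_right (norm_nonneg _) hp
  have hdw2 : eLpNorm (fun p : X × X => (K₁ p.1 p.2 - K₂ p.1 p.2) * w₂ p.1 p.2) 2 (μ.prod μ) ≤
      eLpNorm (fun p : X × X => K₁ p.1 p.2 - K₂ p.1 p.2) 2 (μ.prod μ) := by
    refine eLpNorm_mono_ae ?_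
    filter_upwards [b₂] with p hp
    rw [norm_mul]
    exact mul_le_of_le_one_right (norm_nonneg _) hp
  have e3 := MemLp.abs_integral_mul_le (hu.comp_fst μ) hdw
  rw [hUf] at e3
  have e4 := mul_le_mul_of_nonneg_left (ENNReal.toReal_mono hd.2.ne hdw2)
    (ENNReal.toReal_nonneg (a := eLpNorm U 2 μ))
  rw [e2]
  exact (add_le_of_nonpos_left hneg).trans (((le_abs_self _).trans e3).trans e4)

end Operator

/-! ### Stability of solutions -/

section Stability

variable {X : Type*} [MeasurableSpace X] {μ : Measure X} {K K₁ K₂ : X → X → ℝ} {M M₁ M₂ T : ℝ}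

/-- The evolution equation on a measure space, without regularity requirements in time. -/
def WeakSol (μ : Measure X) (K : X → X → ℝ) (f : ℝ → X → ℝ) (g : X → ℝ) (T : ℝ)
    (u : ℝ → X → ℝ) : Prop :=
  ∃ v η : ℝ → X → ℝ, AEStronglyMeasurable (Function.uncurry v) ((μT T).prod μ) ∧
    (∀ t ∈ Icc (0 : ℝ) T, ∀ᵐ x ∂μ, u t x = g x + ∫ s in (0 : ℝ)..t, v s x) ∧
    (∀ᵐ p ∂((μT T).prod μ), v p.1 p.2 = -η p.1 p.2 + f p.1 p.2) ∧
    ∀ᵐ t ∂(μT T), InLap μ K (u t) (η t)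

/-- The data of a mild form of a solution: a primitive of a measurable `V` in `L¹(L²)`. -/
structure MildSol (μ : Measure X) (K : X → X → ℝ) (f : ℝ → X → ℝ) (g : X → ℝ) (T : ℝ)
    (u : ℝ → X → ℝ) (V : ℝ → X → ℝ) (U : X → ℝ) : Prop where
  l12 : L12 (μT T) μ V
  meas : Measurable U
  memLp : MemLp U 2 μ
  init : U =ᵐ[μ] g
  eq : ∀ t ∈ Icc 0 T, u t =ᵐ[μ] fun x => U x + cum (μT T) V t x
  incl : ∀ᵐ t ∂(μT T), ∃ η, InLap μ K (u t) η ∧ ∀ᵐ x ∂μ, V t x = -η x + f t x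

/-- The derivative is `-η + f` with `η` bounded by `M`, so it inherits the `L¹(L²)` integrability of
`f` even though a solution is only required to live in `L¹`. Passing to measurable representatives
then puts the energy method at disposal. -/
theorem WeakSol.exists_mildSol [IsFiniteMeasure μ] (hK : Ker μ K M) (hM : 0 ≤ M)
    {f : ℝ → X → ℝ} {g : X → ℝ} {u : ℝ → X → ℝ} (hg : MemLp g 2 μ)
    (hf : AEStronglyMeasurable (Function.uncurry f) ((μT T).prod μ))
    (hf2 : ∫⁻ t, eLpNorm (f t) 2 μ ∂(μT T) < ∞) (h : WeakSol μ K f g T u) :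
    ∃ V U, MildSol μ K f g T u V U := by
  obtain ⟨v, η, hv, hu, heq, hη⟩ := h
  set V : ℝ → X → ℝ := Function.curry (hv.mk _) with hV
  have hVm : Measurable (Function.uncurry V) := by
    rw [hV, Function.uncurry_curry]
    exact hv.stronglyMeasurable_mk.measurable
  have hvV : ∀ᵐ p ∂((μT T).prod μ), v p.1 p.2 = V p.1 p.2 := hv.ae_eq_mk
  have hincl : ∀ᵐ t ∂(μT T), InLap μ K (u t) (η t) ∧ ∀ᵐ x ∂μ, V t x = -η t x + f t x := by
    filter_upwards [hη, Measure.ae_ae_of_ae_prod hvV, Measure.ae_ae_of_ae_prod heq]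
      with t h1 h2 h3
    refine ⟨h1, ?_⟩
    filter_upwards [h2, h3] with x h4 h5
    rw [← h4, h5]
  have hfm : ∀ᵐ t ∂(μT T), AEStronglyMeasurable (f t) μ := hf.prodMk_left
  have hfin : ∫⁻ s, eLpNorm (V s) 2 μ ∂(μT T) < ∞ := by
    have hb : ∀ᵐ s ∂(μT T), eLpNorm (V s) 2 μ ≤
        μ univ ^ (2 : ℝ≥0∞).toReal⁻¹ * ENNReal.ofReal M + eLpNorm (f s) 2 μ := by
      filter_upwards [hincl, hfm] with s hs hfs
      have e : V s =ᵐ[μ] -η s + f s := hs.2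
      rw [eLpNorm_congr_ae e]
      refine (eLpNorm_add_le (hs.1.memLp hK hM 2).1.neg hfs (by norm_num)).trans ?_
      rw [eLpNorm_neg]
      gcongr
      exact eLpNorm_le_of_ae_bound (hs.1.ae_abs_le hK hM)
    refine (lintegral_mono_ae hb).trans_lt ?_
    rw [lintegral_add_left measurable_const, lintegral_const]
    exact ENNReal.add_lt_top.2 ⟨by finiteness, hf2⟩
  set U := hg.1.mk g with hU
  have hgU : g =ᵐ[μ] U := hg.1.ae_eq_mk
  refine ⟨V, U, ⟨hVm, hfin⟩, hg.1.stronglyMeasurable_mk.measurable, (memLp_congr_ae hgU).1 hg,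
    hgU.symm, fun t ht => ?_, hincl.mono fun t ht => ⟨η t, ht⟩⟩
  filter_upwards [hu t ht, hgU, ae_ae_of_ae_prod_swap hvV] with x h1 h2 h3
  rw [h1, h2, intervalIntegral_eq_setIntegral_Iic ht]
  congr 1
  exact integral_congr_ae (ae_restrict_of_ae h3)

theorem MildSol.memLp_at [IsFiniteMeasure μ] {f : ℝ → X → ℝ} {g : X → ℝ} {u V : ℝ → X → ℝ}
    {U : X → ℝ} (h : MildSol μ K f g T u V U) : ∀ t ∈ Icc 0 T, MemLp (u t) 2 μ := fun t ht =>
  (memLp_congr_ae (h.eq t ht)).2 (h.memLp.add (h.l12.memLp_cum t))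

theorem MildSol.tendsto [IsFiniteMeasure μ] {f : ℝ → X → ℝ} {g : X → ℝ} {u V : ℝ → X → ℝ}
    {U : X → ℝ} (h : MildSol μ K f g T u V U) : ∀ t₀ ∈ Icc 0 T,
    Tendsto (fun t => eLpNorm (u t - u t₀) 2 μ) (𝓝[Icc 0 T] t₀) (𝓝 0) := by
  intro t₀ ht₀
  refine ((h.l12.tendsto_eLpNorm_cum_sub t₀).mono_left nhdsWithin_le_nhds).congr' ?_
  filter_upwards [self_mem_nhdsWithin] with t ht
  refine eLpNorm_congr_ae ?_
  filter_upwards [h.eq t ht, h.eq t₀ ht₀] with x h1 h2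
  simp only [Pi.sub_apply]
  rw [h1, h2]
  ring

/-- The energy of the difference obeys `φ' ≤ 2 c √φ` in integrated form, where `c` is the norm of
`f₁ - f₂` plus that of `K₁ - K₂`; the nonlinear Gronwall inequality integrates this without loss.
The row bounds `M₁` and `M₂` do not appear in the result. -/
theorem MildSol.eLpNorm_sub_le [IsProbabilityMeasure μ] (hT : 0 ≤ T) (hK₁ : Ker μ K₁ M₁)
    (hK₂ : Ker μ K₂ M₂) (hM₁ : 0 ≤ M₁) (hM₂ : 0 ≤ M₂) {f₁ f₂ : ℝ → X → ℝ} {g₁ g₂ : X → ℝ}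
    {u₁ u₂ V₁ V₂ : ℝ → X → ℝ} {U₁ U₂ : X → ℝ}
    (hf₁ : AEStronglyMeasurable (Function.uncurry f₁) ((μT T).prod μ))
    (hf₂ : AEStronglyMeasurable (Function.uncurry f₂) ((μT T).prod μ))
    (hf : ∫⁻ t, eLpNorm (fun x => f₁ t x - f₂ t x) 2 μ ∂(μT T) < ∞)
    (h₁ : MildSol μ K₁ f₁ g₁ T u₁ V₁ U₁) (h₂ : MildSol μ K₂ f₂ g₂ T u₂ V₂ U₂) :
    ∀ t ∈ Icc 0 T, eLpNorm (u₁ t - u₂ t) 2 μ ≤ eLpNorm (fun x => g₁ x - g₂ x) 2 μ +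
      ∫⁻ t, eLpNorm (fun x => f₁ t x - f₂ t x) 2 μ ∂(μT T) +
      ENNReal.ofReal T * eLpNorm (fun p : X × X => K₁ p.1 p.2 - K₂ p.1 p.2) 2 (μ.prod μ) := by
  set m := μT T with hm
  set V : ℝ → X → ℝ := fun t x => V₁ t x - V₂ t x with hV
  set U : X → ℝ := fun x => U₁ x - U₂ x with hU
  have hVl : L12 m μ V := h₁.l12.sub h₂.l12
  have hUm : Measurable U := h₁.meas.sub h₂.meas
  have hU2 : MemLp U 2 μ := h₁.memLp.sub h₂.memLp
  set D : ℝ → X → ℝ := fun t x => U x + cum m V t x with hD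
  have hD2 : ∀ t, MemLp (D t) 2 μ := fun t => hU2.add (hVl.memLp_cum t)
  have huD : ∀ t ∈ Icc 0 T, u₁ t - u₂ t =ᵐ[μ] D t := by
    intro t ht
    filter_upwards [h₁.eq t ht, h₂.eq t ht, h₁.l12.ae_integrable, h₂.l12.ae_integrable]
      with x e1 e2 i1 i2
    simp only [Pi.sub_apply, hD, hU, hV, cum]
    rw [e1, e2, integral_sub i1.integrableOn i2.integrableOn]
    simp only [cum]
    ring
  -- the second members
  have hfm : AEStronglyMeasurable (fun p : ℝ × X => f₁ p.1 p.2 - f₂ p.1 p.2) (m.prod μ) :=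
    hf₁.sub hf₂
  -- A jointly measurable representative is needed for the spatial norm to be measurable in time.
  set F : ℝ → X → ℝ := Function.curry (hfm.mk _) with hF
  have hFm : Measurable (Function.uncurry F) := by
    rw [hF, Function.uncurry_curry]
    exact hfm.stronglyMeasurable_mk.measurable
  have hfF : ∀ᵐ t ∂m, (fun x => f₁ t x - f₂ t x) =ᵐ[μ] F t :=
    Measure.ae_ae_of_ae_prod hfm.ae_eq_mk
  have hFint : ∫⁻ t, eLpNorm (F t) 2 μ ∂m = ∫⁻ t, eLpNorm (fun x => f₁ t x - f₂ t x) 2 μ ∂m :=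
    lintegral_congr_ae (hfF.mono fun t ht => (eLpNorm_congr_ae ht).symm)
  rw [← hFint] at hf ⊢
  set κ := eLpNorm (fun p : X × X => K₁ p.1 p.2 - K₂ p.1 p.2) 2 (μ.prod μ) with hκ
  have hκt : κ ≠ ∞ := (hK₁.sq.sub hK₂.sq).2.ne
  set c : ℝ → ℝ := fun s => (eLpNorm (F s) 2 μ).toReal + κ.toReal with hc
  have hc0 : ∀ s, 0 ≤ c s := fun s => add_nonneg ENNReal.toReal_nonneg ENNReal.toReal_nonneg
  have hFi : Integrable (fun s => (eLpNorm (F s) 2 μ).toReal) m :=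
    integrable_toReal_of_lintegral_ne_top (measurable_eLpNorm_two hFm).aemeasurable hf.ne
  have hci : Integrable c m := hFi.add (integrable_const _)
  -- the energy
  set φ : ℝ → ℝ := fun t => ∫ x, D t x ^ 2 ∂μ with hφ
  have hφs : ∀ t, √(φ t) = (eLpNorm (D t) 2 μ).toReal := fun t => by
    rw [hφ]
    simp only
    rw [MemLp.integral_sq_eq (hD2 t), Real.sqrt_sq ENNReal.toReal_nonneg]
  have hen : ∀ t, φ t = ∫ x, U x ^ 2 ∂μ + 2 * ∫ s in Iic t, ∫ x, V s x * D s x ∂μ ∂m :=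
    hVl.integral_sq_eq hUm hU2
  have hψ : Integrable (fun s => ∫ x, V s x * D s x ∂μ) m :=
    (hVl.integrable_mul_cum hUm hU2).integral_prod_left
  have hφc : Continuous φ := by
    rw [show φ = fun t => ∫ x, U x ^ 2 ∂μ + 2 * ∫ s in Iic t, ∫ x, V s x * D s x ∂μ ∂m from
      funext hen]
    exact continuous_const.add (continuous_const.mul (continuous_setIntegral_Iic hψ))
  -- Since `V = -(η₁ - η₂) + F`, the operator part is bounded by the two-kernel monotonicity and the
  -- rest by Cauchy–Schwarz.
  have hpair : ∀ᵐ s ∂m, ∫ x, V s x * D s x ∂μ ≤ c s * √(φ s) := by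
    filter_upwards [h₁.incl, h₂.incl, hfF, ae_mem_Icc T, hVl.ae_memLp]
      with s ⟨η₁, l1, e1⟩ ⟨η₂, l2, e2⟩ hFs hs hV2
    have hus := huD s hs
    have hu2 : MemLp (u₁ s - u₂ s) 2 μ := (memLp_congr_ae hus).2 (hD2 s)
    have hVe : ∀ᵐ x ∂μ, V s x = -(η₁ x - η₂ x) + F s x := by
      filter_upwards [e1, e2, hFs] with x h3 h4 h5
      simp only [hV]
      rw [h3, h4, ← h5]
      ring
    have hη : MemLp (fun x => η₁ x - η₂ x) 2 μ :=
      (l1.memLp hK₁ hM₁ 2).sub (l2.memLp hK₂ hM₂ 2)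
    have hF2 : MemLp (F s) 2 μ := by
      refine (memLp_congr_ae ?_).1 (hV2.add hη)
      filter_upwards [hVe] with x hx
      simp only [Pi.add_apply]
      rw [hx]
      ring
    have e3 : ∫ x, V s x * D s x ∂μ =
        -∫ x, (u₁ s - u₂ s) x * (η₁ x - η₂ x) ∂μ + ∫ x, F s x * D s x ∂μ := by
      have j1 : Integrable (fun x => -((u₁ s - u₂ s) x * (η₁ x - η₂ x))) μ :=
        (hu2.integrable_mul hη).neg
      have j2 : Integrable (fun x => F s x * D s x) μ := hF2.integrable_mul (hD2 s)
      rw [← integral_neg, ← integral_add j1 j2]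
      refine integral_congr_ae ?_
      filter_upwards [hVe, hus] with x hx hx'
      rw [hx, hx']
      ring
    have e4 := l1.neg_integral_sub_mul_sub_le hK₁ hK₂ l2 hu2
    have e5 := (le_abs_self _).trans (MemLp.abs_integral_mul_le hF2 (hD2 s))
    rw [e3, hφs, hc]
    rw [eLpNorm_congr_ae hus] at e4
    simp only
    linarith
  have hmain := sqrt_le_of_le_integral_mul_sqrt (T := T) (A := ∫ x, U x ^ 2 ∂μ) (φ := φ) (c := c)
    (fun t => integral_nonneg fun x => sq_nonneg _) (integral_nonneg fun x => sq_nonneg _)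
    hc0 hci hφc.continuousOn (fun t ht => by
      rw [hen t]
      have : ∫ s in Iic t, ∫ x, V s x * D s x ∂μ ∂m ≤ ∫ s in Iic t, c s * √(φ s) ∂m := by
        refine integral_mono_ae hψ.integrableOn (Integrable.integrableOn ?_)
          (ae_restrict_of_ae hpair)
        -- Continuity on the compact time interval bounds `√φ`, so that `c √φ` is integrable.
        obtain ⟨B, hB⟩ := isCompact_Icc.exists_bound_of_continuousOn
          (s := Icc 0 T) hφc.sqrt.continuousOn
        exact hci.mul_bdd hφc.sqrt.aestronglyMeasurable ((ae_mem_Icc T).mono hB)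
      linarith)
  intro t ht
  have h3 := hmain t ht
  rw [hφs, MemLp.integral_sq_eq hU2, Real.sqrt_sq ENNReal.toReal_nonneg] at h3
  have h4 : ∫ s in Iic t, c s ∂m ≤ (∫⁻ t, eLpNorm (F t) 2 μ ∂m).toReal + T * κ.toReal := by
    refine (setIntegral_le_integral hci (Eventually.of_forall hc0)).trans_eq ?_
    rw [hc, integral_add hFi (integrable_const _), integral_const,
      integral_toReal (measurable_eLpNorm_two hFm).aemeasurable
        (ae_lt_top (measurable_eLpNorm_two hFm) hf.ne), hm, μT, measureReal_restrict_apply_univ]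
    simp [hT]
  have hgU : eLpNorm (fun x => g₁ x - g₂ x) 2 μ = eLpNorm U 2 μ := by
    refine eLpNorm_congr_ae ?_
    filter_upwards [h₁.init, h₂.init] with x e1 e2
    simp only [hU]
    rw [e1, e2]
  rw [eLpNorm_congr_ae (huD t ht), hgU, ← ENNReal.ofReal_toReal (hD2 t).2.ne,
    ← ENNReal.ofReal_toReal hU2.2.ne, ← ENNReal.ofReal_toReal hf.ne, ← ENNReal.ofReal_toReal hκt,
    ← ENNReal.ofReal_mul hT, ← ENNReal.ofReal_add ENNReal.toReal_nonneg ENNReal.toReal_nonneg,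
    ← ENNReal.ofReal_add (by positivity) (by positivity)]
  exact ENNReal.ofReal_le_ofReal (by linarith)

end Stability

/-! ### Weak limits of bounded functions -/

section WeakLimit

variable {Z : Type*} [MeasurableSpace Z] {ν : Measure Z}

/-- Banach–Alaoglu in the dual of `L²`, which Riesz identifies with `L²`. Taking the limit along a
free ultrafilter requires neither a subsequence nor separability. -/
theorem exists_weak_limit [IsFiniteMeasure ν] (w : ℕ → Z → ℝ) (hw : ∀ n, Measurable (w n))
    (hb : ∀ n z, |w n z| ≤ 1) :
    ∃ v : Z → ℝ, Measurable v ∧ MemLp v 2 ν ∧ ∀ h : Z → ℝ, MemLp h 2 ν →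
      Tendsto (fun n => ∫ z, w n z * h z ∂ν) (hyperfilter ℕ : Filter ℕ) (𝓝 (∫ z, v z * h z ∂ν)) := by
  have hm : ∀ n, MemLp (w n) 2 ν := fun n =>
    MemLp.of_bound (hw n).aestronglyMeasurable 1 (Eventually.of_forall (hb n))
  set R : ℝ := (ν univ ^ (2 : ℝ≥0∞).toReal⁻¹ * ENNReal.ofReal 1).toReal with hR
  set φ : ℕ → WeakDual ℝ (Lp ℝ 2 ν) := fun n =>
    StrongDual.toWeakDual (InnerProductSpace.toDual ℝ (Lp ℝ 2 ν) ((hm n).toLp (w n))) with hφ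
  have hball : ∀ n, φ n ∈ WeakDual.toStrongDual ⁻¹' Metric.closedBall (0 : StrongDual ℝ (Lp ℝ 2 ν)) R := by
    intro n
    rw [mem_preimage, mem_closedBall_zero_iff]
    change ‖InnerProductSpace.toDual ℝ (Lp ℝ 2 ν) ((hm n).toLp (w n))‖ ≤ R
    rw [LinearIsometryEquiv.norm_map, Lp.norm_toLp]
    exact ENNReal.toReal_mono (by finiteness) (eLpNorm_le_of_ae_bound (Eventually.of_forall (hb n)))
  obtain ⟨ψ, -, hψ⟩ := (WeakDual.isCompact_closedBall (𝕜 := ℝ)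
    (0 : StrongDual ℝ (Lp ℝ 2 ν)) R).ultrafilter_le_nhds ((hyperfilter ℕ).map φ)
      (tendsto_principal.2 (Eventually.of_forall hball))
  set v₀ : Lp ℝ 2 ν := (InnerProductSpace.toDual ℝ (Lp ℝ 2 ν)).symm (WeakDual.toStrongDual ψ)
    with hv₀
  refine ⟨v₀, (Lp.stronglyMeasurable v₀).measurable, Lp.memLp v₀, fun h hh => ?_⟩
  have hev := ((WeakDual.eval_continuous (𝕜 := ℝ) (hh.toLp h)).tendsto ψ).comp hψ
  have e1 : ∀ n, φ n (hh.toLp h) = ∫ z, w n z * h z ∂ν := by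
    intro n
    change inner ℝ ((hm n).toLp (w n)) (hh.toLp h) = _
    rw [L2.inner_def]
    refine integral_congr_ae ?_
    filter_upwards [(hm n).coeFn_toLp, hh.coeFn_toLp] with z h1 h2
    rw [h1, h2]
    simp [mul_comm]
  have e2 : ψ (hh.toLp h) = ∫ z, v₀ z * h z ∂ν := by
    have : ψ (hh.toLp h) = inner ℝ v₀ (hh.toLp h) := by
      rw [hv₀, InnerProductSpace.toDual_symm_apply]
      rfl
    rw [this, L2.inner_def]
    refine integral_congr_ae ?_
    filter_upwards [hh.coeFn_toLp] with z h2
    rw [h2]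
    simp [mul_comm]
  rw [e2] at hev
  refine Tendsto.congr e1 ?_
  exact hev

/-- Testing with the indicator of `{v > 1}` gives `∫ (v - 1) ≤ 0` over that set, which must then be
null. -/
theorem ae_le_one_of_weak_limit [IsFiniteMeasure ν] {ι : Type*} {l : Filter ι} [l.NeBot]
    {w : ι → Z → ℝ} (hw : ∀ n, Measurable (w n)) (hb : ∀ n z, |w n z| ≤ 1) {v : Z → ℝ}
    (hv : Measurable v) (hv2 : MemLp v 2 ν)
    (hlim : ∀ h : Z → ℝ, MemLp h 2 ν →
      Tendsto (fun n => ∫ z, w n z * h z ∂ν) l (𝓝 (∫ z, v z * h z ∂ν))) :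
    ∀ᵐ z ∂ν, v z ≤ 1 := by
  set S : Set Z := {z | 1 < v z} with hS
  have hSm : MeasurableSet S := measurableSet_lt measurable_const hv
  have hvi : Integrable v ν := hv2.integrable (by norm_num)
  have e : ∀ k : Z → ℝ, ∫ z, k z * S.indicator (fun _ => (1 : ℝ)) z ∂ν = ∫ z in S, k z ∂ν :=
    fun k => by
      rw [← integral_indicator hSm]
      refine integral_congr_ae (Eventually.of_forall fun z => ?_)
      by_cases h : z ∈ S <;> simp [h]
  have h1 := hlim (S.indicator fun _ => 1) ((memLp_const 1).indicator hSm)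
  simp_rw [e] at h1
  have h2 : ∫ z in S, v z ∂ν ≤ ∫ z in S, 1 ∂ν := by
    refine le_of_tendsto h1 (Eventually.of_forall fun n => ?_)
    refine integral_mono ?_ (integrable_const _) fun z => (le_abs_self _).trans (hb n z)
    exact ((Integrable.of_bound (hw n).aestronglyMeasurable 1
      (Eventually.of_forall (hb n)))).integrableOn
  have h3 : ∫ z in S, (v z - 1) ∂ν = 0 := by
    refine le_antisymm ?_ (setIntegral_nonneg hSm fun z hz => sub_nonneg.2 (le_of_lt hz))
    rw [integral_sub hvi.integrableOn (integrable_const _)]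
    linarith
  rw [setIntegral_eq_zero_iff_of_nonneg_ae
    ((ae_restrict_mem hSm).mono fun z hz => sub_nonneg.2 (le_of_lt hz))
    (hvi.sub (integrable_const _)).integrableOn] at h3
  filter_upwards [(ae_restrict_iff' hSm).1 h3] with z hz
  by_contra! hcon
  have := hz hcon
  simp only [Pi.zero_apply] at this
  linarith

theorem ae_abs_le_one_of_weak_limit [IsFiniteMeasure ν] {ι : Type*} {l : Filter ι} [l.NeBot]
    {w : ι → Z → ℝ} (hw : ∀ n, Measurable (w n)) (hb : ∀ n z, |w n z| ≤ 1) {v : Z → ℝ}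
    (hv : Measurable v) (hv2 : MemLp v 2 ν)
    (hlim : ∀ h : Z → ℝ, MemLp h 2 ν →
      Tendsto (fun n => ∫ z, w n z * h z ∂ν) l (𝓝 (∫ z, v z * h z ∂ν))) :
    ∀ᵐ z ∂ν, |v z| ≤ 1 := by
  have h2 := ae_le_one_of_weak_limit (ν := ν) (l := l) (w := fun n z => -w n z)
    (fun n => (hw n).neg) (fun n z => by rw [abs_neg]; exact hb n z) hv.neg hv2.neg
    (fun h hh => by
      simp only [neg_mul, integral_neg, Pi.neg_apply]
      exact (hlim h hh).neg)
  filter_upwards [ae_le_one_of_weak_limit hw hb hv hv2 hlim, h2] with z h3 h4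
  exact abs_le.2 ⟨by simp only [Pi.neg_apply] at h4; linarith, h3⟩

end WeakLimit

/-! ### The explicit Euler scheme -/

section Euler

variable {X : Type*} [MeasurableSpace X] {μ : Measure X} {K : X → X → ℝ} {M T τ : ℝ}
  {f : ℝ → X → ℝ} {g : X → ℝ}

theorem measurable_realSign : Measurable Real.sign :=
  Measurable.ite measurableSet_Iio measurable_const
    (Measurable.ite measurableSet_Ioi measurable_const measurable_const)

theorem abs_sign_le (r : ℝ) : |Real.sign r| ≤ 1 := by
  rcases Real.sign_apply_eq r with h | h | h <;> simp [h]

theorem sign_mul_self_eq_abs (r : ℝ) : Real.sign r * r = |r| := by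
  rcases lt_trichotomy r 0 with h | h | h
  · simp [Real.sign_of_neg h, abs_of_neg h]
  · simp [h]
  · simp [Real.sign_of_pos h, abs_of_pos h]

theorem sign_mem_absSubdiff (r : ℝ) : Real.sign r ∈ absSubdiff r :=
  mem_absSubdiff_iff.2 ⟨abs_sign_le r, sign_mul_self_eq_abs r⟩

/-- The selection of the 1-Laplacian through `sign`. -/
noncomputable def signLap (μ : Measure X) (K : X → X → ℝ) (u : X → ℝ) (x : X) : ℝ :=
  -∫ y, K x y * Real.sign (u y - u x) ∂μ

theorem measurable_signLap [SFinite μ] (hK : Measurable (Function.uncurry K)) {u : X → ℝ}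
    (hu : Measurable u) : Measurable (signLap μ K u) := by
  refine (StronglyMeasurable.integral_prod_right'
    (f := fun p : X × X => K p.1 p.2 * Real.sign (u p.2 - u p.1)) ?_).measurable.neg
  exact (hK.mul (measurable_realSign.comp
    ((hu.comp measurable_snd).sub (hu.comp measurable_fst)))).stronglyMeasurable

theorem Ker.ae_abs_signLap_le (hK : Ker μ K M) (hM : 0 ≤ M) :
    ∀ᵐ x ∂μ, ∀ u : X → ℝ, |signLap μ K u x| ≤ M := by
  filter_upwards [hK.row] with x hx u
  have h1 : ‖∫ y, K x y * Real.sign (u y - u x) ∂μ‖ₑ ≤ ENNReal.ofReal M := by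
    refine (enorm_integral_le_lintegral_enorm _).trans (le_trans (lintegral_mono fun y => ?_) hx)
    rw [enorm_mul]
    refine mul_le_of_le_one_right' ?_
    rw [Real.enorm_eq_ofReal_abs]
    simpa using abs_sign_le _
  rw [Real.enorm_eq_ofReal_abs] at h1
  rw [signLap, abs_neg]
  exact (ENNReal.ofReal_le_ofReal_iff hM).1 h1

/-- Partial sums of the values of the operator along the Euler scheme with step `τ`. -/
noncomputable def eulerSum (μ : Measure X) (m : Measure ℝ) (K : X → X → ℝ) (f : ℝ → X → ℝ)
    (g : X → ℝ) (τ : ℝ) : ℕ → X → ℝ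
  | 0 => 0
  | k + 1 => fun x => eulerSum μ m K f g τ k x +
      signLap μ K (fun y => g y + cum m f (k * τ) y - τ * eulerSum μ m K f g τ k y) x

/-- Values of the Euler scheme at the nodes `k τ`. -/
noncomputable def eulerVal (μ : Measure X) (m : Measure ℝ) (K : X → X → ℝ) (f : ℝ → X → ℝ)
    (g : X → ℝ) (τ : ℝ) (k : ℕ) (x : X) : ℝ :=
  g x + cum m f (k * τ) x - τ * eulerSum μ m K f g τ k x

theorem eulerSum_succ (m : Measure ℝ) (k : ℕ) (x : X) : eulerSum μ m K f g τ (k + 1) x =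
    eulerSum μ m K f g τ k x + signLap μ K (eulerVal μ m K f g τ k) x := rfl

theorem measurable_eulerSum [SFinite μ] {m : Measure ℝ} [SFinite m]
    (hK : Measurable (Function.uncurry K)) (hf : Measurable (Function.uncurry f))
    (hg : Measurable g) (k : ℕ) : Measurable (eulerSum μ m K f g τ k) := by
  induction k with
  | zero => exact measurable_const
  | succ k ih =>
    refine ih.add (measurable_signLap hK ?_)
    exact (hg.add (measurable_cum hf).of_uncurry_left).sub (ih.const_mul τ)

theorem measurable_eulerVal [SFinite μ] {m : Measure ℝ} [SFinite m]
    (hK : Measurable (Function.uncurry K)) (hf : Measurable (Function.uncurry f))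
    (hg : Measurable g) (k : ℕ) : Measurable (eulerVal μ m K f g τ k) :=
  (hg.add (measurable_cum hf).of_uncurry_left).sub ((measurable_eulerSum hK hf hg k).const_mul τ)

theorem memLp_eulerVal [IsFiniteMeasure μ] {m : Measure ℝ} [SFinite m] (hK : Ker μ K M)
    (hM : 0 ≤ M) (hf : L12 m μ f) (hg : Measurable g) (hg2 : MemLp g 2 μ) (k : ℕ) :
    MemLp (eulerVal μ m K f g τ k) 2 μ := by
  refine (hg2.add (hf.memLp_cum _)).sub (MemLp.const_mul ?_ τ)
  refine MemLp.of_bound (measurable_eulerSum hK.meas hf.meas hg k).aestronglyMeasurable (k * M) ?_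
  filter_upwards [hK.ae_abs_signLap_le hM] with x hx
  induction k with
  | zero => simp [eulerSum]
  | succ k ih =>
    rw [eulerSum_succ]
    refine (norm_add_le _ _).trans ((add_le_add ih (hx _)).trans_eq ?_)
    push_cast
    ring

/-- The index of the time step that contains `s`. -/
noncomputable def stepIndex (τ s : ℝ) : ℕ := ⌈s / τ⌉₊ - 1

theorem measurable_stepIndex : Measurable (stepIndex τ) :=
  (measurable_from_top (f := fun n : ℕ => n - 1)).comp
    (Nat.measurable_ceil.comp (measurable_id.div_const τ))

theorem stepIndex_eq (hτ : 0 < τ) {k : ℕ} {s : ℝ} (hs : s ∈ Ioc (k * τ) ((k + 1 : ℕ) * τ)) :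
    stepIndex τ s = k := by
  have : ⌈s / τ⌉₊ = k + 1 := by
    rw [Nat.ceil_eq_iff (Nat.succ_ne_zero k)]
    exact ⟨by rw [lt_div_iff₀ hτ]; simpa using hs.1, by rw [div_le_iff₀ hτ]; exact hs.2⟩
  rw [stepIndex, this, Nat.add_sub_cancel]

/-- Steps are open on the left and closed on the right, so the node lies strictly before `s` and the
Euler value used at time `s` depends only on the past. -/
theorem stepIndex_mul_mem (hτ : 0 < τ) {s : ℝ} (hs : 0 < s) :
    stepIndex τ s * τ ∈ Ico (s - τ) s := by
  have h0 : 0 < ⌈s / τ⌉₊ := Nat.ceil_pos.2 (div_pos hs hτ)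
  have h1 : (stepIndex τ s : ℝ) = ⌈s / τ⌉₊ - 1 := by
    rw [stepIndex, Nat.cast_sub h0, Nat.cast_one]
  have h2 := Nat.ceil_lt_add_one (div_pos hs hτ).le
  have h3 := Nat.le_ceil (s / τ)
  rw [div_le_iff₀ hτ] at h3
  have h4 : ((⌈s / τ⌉₊ : ℝ) - 1) * τ < s := by
    rw [← lt_div_iff₀ hτ]; linarith
  rw [h1]
  exact ⟨by linarith, h4⟩

theorem measurable_uncurry_of_stepIndex {a : ℕ → X → ℝ} (ha : ∀ k, Measurable (a k)) :
    Measurable (Function.uncurry fun s x => a (stepIndex τ s) x) :=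
  (measurable_from_prod_countable_right (f := fun p : ℕ × X => a p.1 p.2) ha).comp
    ((measurable_stepIndex.comp measurable_fst).prodMk measurable_snd)

-- At a node the primitive of a step function is its Riemann sum. This exhibits the Euler values as
-- values of an exact primitive.
omit [MeasurableSpace X] in
theorem cum_stepIndex_eq_sum {a : ℕ → X → ℝ} {S : ℕ → X → ℝ} (hτ : 0 < τ) {x : X}
    (hb : ∀ k, |a k x| ≤ M) (hS0 : S 0 x = 0) (hS : ∀ k, S (k + 1) x = S k x + a k x) (k : ℕ)
    (hk : k * τ ≤ T) : cum (μT T) (fun s x => a (stepIndex τ s) x) (k * τ) x = τ * S k x := by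
  have hm : Measurable fun s => a (stepIndex τ s) x :=
    (measurable_from_top (f := fun k : ℕ => a k x)).comp measurable_stepIndex
  have hi : ∀ c d, IntervalIntegrable (fun s => a (stepIndex τ s) x) volume c d := fun c d => by
    refine (intervalIntegrable_const (c := M)).mono_fun hm.aestronglyMeasurable
      (Eventually.of_forall fun s => (hb _).trans (le_abs_self M))
  rw [cum, ← intervalIntegral_eq_setIntegral_Iic ⟨by positivity, hk⟩]
  -- The horizon `T` matters only for replacing `μT T` by Lebesgue measure; the induction on the
  -- interval integral no longer needs it.
  clear hk
  induction k with
  | zero => simp [hS0]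
  | succ k ih =>
    rw [← intervalIntegral.integral_add_adjacent_intervals (hi 0 (k * τ)) (hi _ _), ih, hS]
    have : ∫ s in (k * τ)..((k + 1 : ℕ) * τ), a (stepIndex τ s) x = τ * a k x := by
      rw [intervalIntegral.integral_of_le (by push_cast; linarith),
        setIntegral_congr_fun measurableSet_Ioc (g := fun _ => a k x)
          (fun s hs => by simp only; rw [stepIndex_eq hτ hs])]
      simp only [integral_const, smul_eq_mul]
      congr 1
      rw [measureReal_restrict_apply_univ, Real.volume_real_Ioc_of_le (by push_cast; linarith)]
      push_cast
      ring
    rw [this]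
    ring

theorem measurable_uncurry_signLap [SFinite μ] (hK : Measurable (Function.uncurry K))
    {u : ℝ → X → ℝ} (hu : Measurable (Function.uncurry u)) :
    Measurable (Function.uncurry fun s => signLap μ K (u s)) := by
  refine (StronglyMeasurable.integral_prod_right' (f := fun p : (ℝ × X) × X =>
    K p.1.2 p.2 * Real.sign (u p.1.1 p.2 - u p.1.1 p.1.2)) ?_).measurable.neg
  refine Measurable.stronglyMeasurable (Measurable.mul ?_ (measurable_realSign.comp ?_))
  · exact hK.comp (by fun_prop : Measurable fun p : (ℝ × X) × X => (p.1.2, p.2))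
  · exact (hu.comp (by fun_prop : Measurable fun p : (ℝ × X) × X => (p.1.1, p.2))).sub
      (hu.comp measurable_fst)

theorem ae_mem_Ioc (T : ℝ) : ∀ᵐ t ∂(μT T), t ∈ Ioc 0 T := by
  rw [μT, ← restrict_Ioc_eq_restrict_Icc]
  exact ae_restrict_mem measurableSet_Ioc

omit [MeasurableSpace X] in
theorem enorm_cum_sub_le {m : Measure ℝ} {V : ℝ → X → ℝ} {x : X} (hV : Integrable (fun s => V s x) m)
    {s s' : ℝ} (h : s' ∈ Ico (s - τ) s) :
    ‖cum m V s x - cum m V s' x‖ₑ ≤ ∫⁻ r in Ioc (s - τ) s, ‖V r x‖ₑ ∂m := by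
  rw [cum, cum, intervalIntegral.integral_Iic_sub_Iic hV.integrableOn hV.integrableOn,
    intervalIntegral.integral_of_le h.2.le]
  exact (enorm_integral_le_lintegral_enorm _).trans
    (lintegral_mono_set (Ioc_subset_Ioc_left h.1))

/-- The increment is at most the integral of `‖V r x‖` over a window of length `τ` ending at `s`. A
given `r` belongs only to the windows with `s ∈ [r, r + τ[`, so Tonelli produces the factor `τ`. -/
theorem lintegral_lintegral_enorm_cum_sub_le [IsFiniteMeasure μ] {V : ℝ → X → ℝ}
    (hV : L12 (μT T) μ V) {σ : ℝ → ℝ} (hσ : ∀ᵐ s ∂(μT T), σ s ∈ Ico (s - τ) s) :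
    ∫⁻ s, ∫⁻ x, ‖cum (μT T) V s x - cum (μT T) V (σ s) x‖ₑ ∂μ ∂(μT T) ≤
      ENNReal.ofReal τ * ∫⁻ s, ∫⁻ x, ‖V s x‖ₑ ∂μ ∂(μT T) := by
  set m := μT T with hm
  set n : ℝ → ℝ≥0∞ := fun r => ∫⁻ x, ‖V r x‖ₑ ∂μ with hn
  have hnm : Measurable n :=
    Measurable.lintegral_prod_right' (f := fun p : ℝ × X => ‖V p.1 p.2‖ₑ) hV.meas.enorm
  have hS : MeasurableSet {p : ℝ × ℝ | p.1 - τ < p.2 ∧ p.2 ≤ p.1} := by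
    have h1 : MeasurableSet {p : ℝ × ℝ | p.1 - τ < p.2} :=
      measurableSet_lt (by fun_prop) (by fun_prop)
    have h2 : MeasurableSet {p : ℝ × ℝ | p.2 ≤ p.1} := measurableSet_le (by fun_prop) (by fun_prop)
    exact h1.inter h2
  calc ∫⁻ s, ∫⁻ x, ‖cum m V s x - cum m V (σ s) x‖ₑ ∂μ ∂m
      ≤ ∫⁻ s, ∫⁻ x, ∫⁻ r in Ioc (s - τ) s, ‖V r x‖ₑ ∂m ∂μ ∂m := by
        refine lintegral_mono_ae ?_
        filter_upwards [hσ] with s hs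
        refine lintegral_mono_ae ?_
        filter_upwards [hV.ae_integrable] with x hx
        exact enorm_cum_sub_le hx hs
    _ = ∫⁻ s, ∫⁻ r, {p : ℝ × ℝ | p.1 - τ < p.2 ∧ p.2 ≤ p.1}.indicator (fun p => n p.2) (s, r)
          ∂m ∂m := by
        refine lintegral_congr fun s => ?_
        rw [lintegral_lintegral_swap]
        · rw [← lintegral_indicator measurableSet_Ioc]
          rfl
        · exact (hV.meas.comp measurable_swap).enorm.aemeasurable
    _ = ∫⁻ r, ∫⁻ s, {p : ℝ × ℝ | p.1 - τ < p.2 ∧ p.2 ≤ p.1}.indicator (fun p => n p.2) (s, r)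
          ∂m ∂m :=
        lintegral_lintegral_swap ((hnm.comp measurable_snd).indicator hS).aemeasurable
    _ ≤ ∫⁻ r, ENNReal.ofReal τ * n r ∂m := by
        refine lintegral_mono fun r => ?_
        calc ∫⁻ s, {p : ℝ × ℝ | p.1 - τ < p.2 ∧ p.2 ≤ p.1}.indicator (fun p => n p.2) (s, r) ∂m
            ≤ ∫⁻ s, (Ico r (r + τ)).indicator (fun _ => n r) s ∂m := by
              refine lintegral_mono fun s => ?_
              by_cases h : s - τ < r ∧ r ≤ s
              · rw [indicator_of_mem (by exact h),
                  indicator_of_mem (show s ∈ Ico r (r + τ) from ⟨h.2, by linarith [h.1]⟩)]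
              · rw [indicator_of_notMem (by exact h)]
                exact zero_le
          _ = n r * m (Ico r (r + τ)) := by
              rw [lintegral_indicator measurableSet_Ico, setLIntegral_const]
          _ ≤ n r * ENNReal.ofReal τ := by
              gcongr
              refine (Measure.restrict_apply_le _ _).trans_eq ?_
              rw [Real.volume_Ico]
              congr 1
              ring
          _ = _ := mul_comm _ _
    _ = _ := lintegral_const_mul _ hnm

/-- Approximate solutions: the values of the Euler scheme are close in `L¹` to the primitive of the
corresponding second member. -/
theorem exists_euler [IsFiniteMeasure μ] (hT : 0 < T) (hK : Ker μ K M) (hM : 0 ≤ M)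
    (hf : L12 (μT T) μ f) (hg : Measurable g) (hg2 : MemLp g 2 μ) :
    ∃ C, 0 ≤ C ∧ ∀ n : ℕ, ∃ U : ℝ → X → ℝ, Measurable (Function.uncurry U) ∧
      (∀ s, MemLp (U s) 2 μ) ∧
      Integrable (fun p : ℝ × X => g p.2 +
        cum (μT T) (fun r y => f r y - signLap μ K (U r) y) p.1 p.2 - U p.1 p.2)
        ((μT T).prod μ) ∧
      ∫ p : ℝ × X, |g p.2 + cum (μT T) (fun r y => f r y - signLap μ K (U r) y) p.1 p.2 -
        U p.1 p.2| ∂((μT T).prod μ) ≤ C / (n + 1) := by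
  set m := μT T with hm
  -- This bounds the `L¹` norm of the second member `f - η` for every step size, because values of
  -- the operator never exceed `M`. With `τ = T / (n + 1)` it leads to the constant `T * A`.
  set A : ℝ≥0∞ := ∫⁻ s, ∫⁻ x, (‖f s x‖ₑ + ENNReal.ofReal M) ∂μ ∂m with hA
  have hAt : A ≠ ∞ := by
    have h1 := hf.integrable.2
    rw [hasFiniteIntegral_iff_enorm, lintegral_prod _ hf.meas.enorm.aemeasurable] at h1
    have : A = ∫⁻ s, ∫⁻ x, ‖f s x‖ₑ ∂μ ∂m + ENNReal.ofReal M * μ univ * m univ := by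
      rw [hA]
      simp_rw [lintegral_add_right _ measurable_const, lintegral_const]
    rw [this]
    exact (ENNReal.add_lt_top.2 ⟨h1, by finiteness⟩).ne
  refine ⟨T * A.toReal, by positivity, fun n => ?_⟩
  set τ : ℝ := T / (n + 1) with hτ
  have hτ0 : 0 < τ := by positivity
  set U : ℝ → X → ℝ := fun s => eulerVal μ m K f g τ (stepIndex τ s) with hU
  have hUm : Measurable (Function.uncurry U) :=
    measurable_uncurry_of_stepIndex (measurable_eulerVal hK.meas hf.meas hg)
  set η : ℝ → X → ℝ := fun r => signLap μ K (U r) with hη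
  have hηm : Measurable (Function.uncurry η) := measurable_uncurry_signLap hK.meas hUm
  have hηb : ∀ᵐ x ∂μ, ∀ s, |η s x| ≤ M := (hK.ae_abs_signLap_le hM).mono fun x hx s => hx _
  have hηp : ∀ᵐ p ∂(m.prod μ), |η p.1 p.2| ≤ M := by
    rw [Measure.ae_prod_iff_ae_ae
      (p := fun p : ℝ × X => |η p.1 p.2| ≤ M) (measurableSet_le hηm.abs measurable_const)]
    exact Eventually.of_forall fun s => hηb.mono fun x hx => hx s
  have hηl : L12 m μ η := L12.of_bounded hηm hηp
  have hVl : L12 m μ (fun r y => f r y - η r y) := hf.sub hηl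
  have hσ : ∀ᵐ s ∂m, stepIndex τ s * τ ∈ Ico (s - τ) s ∧ stepIndex τ s * τ ≤ T := by
    filter_upwards [ae_mem_Ioc T] with s hs
    have := stepIndex_mul_mem hτ0 hs.1
    exact ⟨this, this.2.le.trans hs.2⟩
  -- The step function is its own generated primitive, evaluated at the preceding node; the error is
  -- therefore a time increment of length at most `τ`.
  have hUeq : ∀ᵐ s ∂m, ∀ᵐ x ∂μ, U s x =
      g x + cum m (fun r y => f r y - η r y) (stepIndex τ s * τ) x := by
    filter_upwards [hσ] with s hs
    filter_upwards [hf.ae_integrable, hηl.ae_integrable, hK.ae_abs_signLap_le hM]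
      with x h1 h2 h3
    have h4 : cum m η (stepIndex τ s * τ) x = τ * eulerSum μ m K f g τ (stepIndex τ s) x :=
      cum_stepIndex_eq_sum (a := fun k => signLap μ K (eulerVal μ m K f g τ k)) hτ0
        (fun k => h3 _) rfl (fun k => eulerSum_succ m k x) _ hs.2
    have h5 : cum m (fun r y => f r y - η r y) (stepIndex τ s * τ) x =
        cum m f (stepIndex τ s * τ) x - cum m η (stepIndex τ s * τ) x :=
      integral_sub h1.integrableOn h2.integrableOn
    rw [h5, h4]
    simp only [hU, eulerVal]
    ring
  have hmeas : Measurable (fun p : ℝ × X => g p.2 +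
      cum m (fun r y => f r y - η r y) p.1 p.2 - U p.1 p.2) :=
    ((hg.comp measurable_snd).add (measurable_cum hVl.meas)).sub hUm
  have hle : ∫⁻ p : ℝ × X, ‖g p.2 + cum m (fun r y => f r y - η r y) p.1 p.2 - U p.1 p.2‖ₑ
      ∂(m.prod μ) ≤ ENNReal.ofReal τ * A := by
    rw [lintegral_prod _ hmeas.enorm.aemeasurable]
    calc _ = ∫⁻ s, ∫⁻ x, ‖cum m (fun r y => f r y - η r y) s x -
          cum m (fun r y => f r y - η r y) (stepIndex τ s * τ) x‖ₑ ∂μ ∂m := by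
          refine lintegral_congr_ae (hUeq.mono fun s hs => lintegral_congr_ae (hs.mono fun x hx => ?_))
          simp only
          rw [hx, add_sub_add_left_eq_sub]
      _ ≤ _ := lintegral_lintegral_enorm_cum_sub_le hVl (hσ.mono fun s hs => hs.1)
      _ ≤ _ := by
          gcongr
          refine lintegral_mono fun s => lintegral_mono_ae (hηb.mono fun x hx => ?_)
          refine enorm_sub_le.trans (add_le_add le_rfl ?_)
          rw [Real.enorm_eq_ofReal_abs]
          exact ENNReal.ofReal_le_ofReal (hx s)
  refine ⟨U, hUm, fun s => memLp_eulerVal hK hM hf hg hg2 _,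
    ⟨hmeas.aestronglyMeasurable, ?_⟩, ?_⟩
  · rw [hasFiniteIntegral_iff_enorm]
    exact hle.trans_lt (by finiteness)
  · have h1 := integral_norm_eq_lintegral_enorm (μ := m.prod μ) hmeas.aestronglyMeasurable
    simp only [Real.norm_eq_abs] at h1
    rw [h1]
    refine (ENNReal.toReal_mono (by finiteness) hle).trans_eq ?_
    rw [ENNReal.toReal_mul, ENNReal.toReal_ofReal hτ0.le, hτ]
    ring

end Euler

/-! ### Existence of solutions on a finite measure space -/

section Existence

variable {X : Type*} [MeasurableSpace X] {μ : Measure X} {K : X → X → ℝ} {M T : ℝ}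
  {f : ℝ → X → ℝ} {g : X → ℝ}

/-- Monotonicity of the `sign` selection, in the form needed to compare two Euler approximations at
a fixed time. -/
theorem integral_sub_mul_signLap_sub_nonpos [IsFiniteMeasure μ] (hK : Ker μ K M) {a b : X → ℝ}
    (ham : Measurable a) (hbm : Measurable b) (ha : MemLp a 2 μ) (hb : MemLp b 2 μ) :
    ∫ x, (a x - b x) * (signLap μ K b x - signLap μ K a x) ∂μ ≤ 0 := by
  have hs : ∀ u : X → ℝ, Measurable u →
      Measurable (fun p : X × X => Real.sign (u p.2 - u p.1)) := fun u hu =>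
    measurable_realSign.comp ((hu.comp measurable_snd).sub (hu.comp measurable_fst))
  have h := integral_mul_kernel_nonpos (a := fun x y => Real.sign (a y - a x) - Real.sign (b y - b x))
    hK ((hs a ham).sub (hs b hbm)).aestronglyMeasurable (C := 2)
    (Eventually.of_forall fun p => (abs_sub _ _).trans (by
      linarith [abs_sign_le (a p.2 - a p.1), abs_sign_le (b p.2 - b p.1)]))
    (Eventually.of_forall fun p => by
      rw [← neg_sub (a p.1) (a p.2), ← neg_sub (b p.1) (b p.2), Real.sign_neg, Real.sign_neg]
      ring)
    (U := fun x => a x - b x) (ha.sub hb)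
    (Eventually.of_forall fun p => by
      have := absSubdiff_monotone (sign_mem_absSubdiff (a p.2 - a p.1))
        (sign_mem_absSubdiff (b p.2 - b p.1))
      linarith)
  refine le_trans (le_of_eq ?_) h
  have one : MemLp (fun _ : X => (1 : ℝ)) 2 μ := memLp_const 1
  have ra := (integrable_kernel_mul hK.sq (a := fun x y => Real.sign (a y - a x))
    (hs a ham).aestronglyMeasurable (Eventually.of_forall fun p => abs_sign_le _) one).prod_right_ae
  have rb := (integrable_kernel_mul hK.sq (a := fun x y => Real.sign (b y - b x))
    (hs b hbm).aestronglyMeasurable (Eventually.of_forall fun p => abs_sign_le _) one).prod_right_ae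
  refine integral_congr_ae ?_
  filter_upwards [ra, rb] with x h1 h2
  simp only [one_mul] at h1 h2
  simp only [signLap, mul_sub]
  rw [integral_sub h1 h2]
  ring

/-- Two approximate solutions are close in `L²` at all times. -/
theorem integral_sq_cum_sub_le [IsFiniteMeasure μ] (hK : Ker μ K M) (hM : 0 ≤ M)
    (hf : L12 (μT T) μ f) {U₁ U₂ : ℝ → X → ℝ} {c₁ c₂ : ℝ}
    (hm₁ : Measurable (Function.uncurry U₁)) (hm₂ : Measurable (Function.uncurry U₂))
    (h2₁ : ∀ s, MemLp (U₁ s) 2 μ) (h2₂ : ∀ s, MemLp (U₂ s) 2 μ)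
    (hi₁ : Integrable (fun p : ℝ × X => g p.2 +
        cum (μT T) (fun r y => f r y - signLap μ K (U₁ r) y) p.1 p.2 - U₁ p.1 p.2) ((μT T).prod μ))
    (hi₂ : Integrable (fun p : ℝ × X => g p.2 +
        cum (μT T) (fun r y => f r y - signLap μ K (U₂ r) y) p.1 p.2 - U₂ p.1 p.2) ((μT T).prod μ))
    (hc₁ : ∫ p : ℝ × X, |g p.2 + cum (μT T) (fun r y => f r y - signLap μ K (U₁ r) y) p.1 p.2 -
        U₁ p.1 p.2| ∂((μT T).prod μ) ≤ c₁)
    (hc₂ : ∫ p : ℝ × X, |g p.2 + cum (μT T) (fun r y => f r y - signLap μ K (U₂ r) y) p.1 p.2 -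
        U₂ p.1 p.2| ∂((μT T).prod μ) ≤ c₂) (t : ℝ) :
    ∫ x, cum (μT T) (fun r y => signLap μ K (U₂ r) y - signLap μ K (U₁ r) y) t x ^ 2 ∂μ ≤
      4 * M * (c₁ + c₂) := by
  set m := μT T with hm
  set η₁ : ℝ → X → ℝ := fun r => signLap μ K (U₁ r) with hη₁
  set η₂ : ℝ → X → ℝ := fun r => signLap μ K (U₂ r) with hη₂
  have n₁ : Measurable (Function.uncurry η₁) := measurable_uncurry_signLap hK.meas hm₁
  have n₂ : Measurable (Function.uncurry η₂) := measurable_uncurry_signLap hK.meas hm₂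
  have hb := hK.ae_abs_signLap_le hM
  have hl : ∀ η : ℝ → X → ℝ, Measurable (Function.uncurry η) →
      (∀ᵐ x ∂μ, ∀ s, |η s x| ≤ M) → L12 m μ η := fun η h1 h2 => by
    refine L12.of_bounded h1 (C := M) ?_
    rw [Measure.ae_prod_iff_ae_ae
      (p := fun p : ℝ × X => |η p.1 p.2| ≤ M) (measurableSet_le h1.abs measurable_const)]
    exact Eventually.of_forall fun s => h2.mono fun x hx => hx s
  have l₁ : L12 m μ η₁ := hl η₁ n₁ (hb.mono fun x hx s => hx _)
  have l₂ : L12 m μ η₂ := hl η₂ n₂ (hb.mono fun x hx s => hx _)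
  have lV : L12 m μ (fun r y => η₂ r y - η₁ r y) := l₂.sub l₁
  -- The primitive of `V` is the difference of the two primitives generated by `U₁` and `U₂`: the
  -- terms with `g` and `f` cancel.
  set V : ℝ → X → ℝ := fun r y => η₂ r y - η₁ r y with hV
  have hen := lV.integral_sq_eq (U := fun _ => 0) measurable_const (memLp_const 0) t
  simp only [zero_add, ne_eq, OfNat.ofNat_ne_zero, not_false_eq_true, zero_pow,
    integral_zero] at hen
  rw [hen]
  have hψ := (lV.integrable_mul_cum (U := fun _ => 0) measurable_const
    (memLp_const 0)).integral_prod_left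
  simp only [zero_add] at hψ
  set e₁ : ℝ → X → ℝ := fun s x => g x + cum m (fun r y => f r y - η₁ r y) s x - U₁ s x with he₁
  set e₂ : ℝ → X → ℝ := fun s x => g x + cum m (fun r y => f r y - η₂ r y) s x - U₂ s x with he₂
  have hkey : ∀ᵐ s ∂m, ∫ x, V s x * cum m V s x ∂μ ≤
      2 * M * (∫ x, |e₁ s x| ∂μ + ∫ x, |e₂ s x| ∂μ) := by
    filter_upwards [hi₁.prod_right_ae, hi₂.prod_right_ae] with s i₁ i₂
    have hVb : ∀ᵐ x ∂μ, |V s x| ≤ 2 * M := by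
      filter_upwards [hb] with x hx
      exact (abs_sub _ _).trans (by linarith [hx (U₁ s), hx (U₂ s)])
    have hVm : Measurable (V s) := lV.meas.of_uncurry_left
    have hV2 : MemLp (V s) 2 μ := MemLp.of_bound hVm.aestronglyMeasurable _ hVb
    have j1 : Integrable (fun x => (U₁ s x - U₂ s x) * V s x) μ :=
      ((h2₁ s).sub (h2₂ s)).integrable_mul hV2
    have j2 : Integrable (fun x => 2 * M * (|e₁ s x| + |e₂ s x|)) μ :=
      (i₁.abs.add i₂.abs).const_mul _
    calc ∫ x, V s x * cum m V s x ∂μ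
        ≤ ∫ x, ((U₁ s x - U₂ s x) * V s x + 2 * M * (|e₁ s x| + |e₂ s x|)) ∂μ := by
          refine integral_mono_ae (hV2.integrable_mul (lV.memLp_cum s)) (j1.add j2) ?_
          filter_upwards [hVb, hf.ae_integrable, l₁.ae_integrable, l₂.ae_integrable]
            with x h1 h2 h3 h4
          have c₁ : e₁ s x = g x + (cum m f s x - cum m η₁ s x) - U₁ s x := by
            simp only [he₁, cum]
            rw [integral_sub h2.integrableOn h3.integrableOn]
          have c₂ : e₂ s x = g x + (cum m f s x - cum m η₂ s x) - U₂ s x := by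
            simp only [he₂, cum]
            rw [integral_sub h2.integrableOn h4.integrableOn]
          have c₃ : cum m V s x = cum m η₂ s x - cum m η₁ s x :=
            integral_sub h4.integrableOn h3.integrableOn
          -- Up to the residuals `e₁ - e₂`, the primitive equals `U₁ - U₂`, against which `V`
          -- integrates to a nonpositive number. The residuals are only small in `L¹`, which
          -- suffices since `|V| ≤ 2M`; the energy identity doubles this into `4M`.
          have c₄ : cum m V s x = (U₁ s x - U₂ s x) + (e₁ s x - e₂ s x) := by
            rw [c₁, c₂, c₃]; ring
          rw [c₄, mul_add, mul_comm (V s x) (U₁ s x - U₂ s x)]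
          refine add_le_add le_rfl ((le_abs_self _).trans ?_)
          rw [abs_mul]
          exact mul_le_mul h1 (abs_sub _ _) (abs_nonneg _) (by positivity)
      _ = ∫ x, (U₁ s x - U₂ s x) * V s x ∂μ + 2 * M * (∫ x, |e₁ s x| ∂μ + ∫ x, |e₂ s x| ∂μ) := by
          rw [integral_add j1 j2, integral_const_mul, integral_add i₁.abs i₂.abs]
      _ ≤ _ := by
          have := integral_sub_mul_signLap_sub_nonpos hK (a := U₁ s) (b := U₂ s)
            hm₁.of_uncurry_left hm₂.of_uncurry_left (h2₁ s) (h2₂ s)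
          simp only [hV, hη₁, hη₂]
          linarith
  have i₁ := hi₁.abs.integral_prod_left
  have i₂ := hi₂.abs.integral_prod_left
  have hE : ∫ s in Iic t, ∫ x, V s x * cum m V s x ∂μ ∂m ≤ 2 * M * (c₁ + c₂) := by
    calc ∫ s in Iic t, ∫ x, V s x * cum m V s x ∂μ ∂m
        ≤ ∫ s in Iic t, 2 * M * (∫ x, |e₁ s x| ∂μ + ∫ x, |e₂ s x| ∂μ) ∂m :=
          integral_mono_ae hψ.integrableOn ((i₁.add i₂).const_mul _).integrableOn
            (ae_restrict_of_ae hkey)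
      _ ≤ ∫ s, 2 * M * (∫ x, |e₁ s x| ∂μ + ∫ x, |e₂ s x| ∂μ) ∂m := by
          refine setIntegral_le_integral ((i₁.add i₂).const_mul _) (Eventually.of_forall fun s => ?_)
          simp only [Pi.zero_apply]
          positivity
      _ = 2 * M * (∫ p : ℝ × X, |e₁ p.1 p.2| ∂(m.prod μ) + ∫ p : ℝ × X, |e₂ p.1 p.2| ∂(m.prod μ)) := by
          rw [integral_const_mul, integral_add i₁ i₂, integral_prod _ hi₁.abs,
            integral_prod _ hi₂.abs]
      _ ≤ _ := by gcongr
  linarith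

end Existence

/-! ### Weak limits of antisymmetric sign fields -/

section Existence

variable {X : Type*} [MeasurableSpace X] {μ : Measure X} {K : X → X → ℝ} {M T : ℝ}
  {f : ℝ → X → ℝ} {g : X → ℝ} {m : Measure ℝ}

/-- Exchange of the two space variables. -/
def swapSpace : ℝ × X × X ≃ᵐ ℝ × X × X :=
  (MeasurableEquiv.refl ℝ).prodCongr MeasurableEquiv.prodComm

theorem swapSpace_apply (z : ℝ × X × X) : swapSpace z = (z.1, z.2.2, z.2.1) := rfl

theorem measurePreserving_swapSpace [SFinite m] [SFinite μ] :
    MeasurePreserving (swapSpace : ℝ × X × X ≃ᵐ ℝ × X × X) (m.prod (μ.prod μ))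
      (m.prod (μ.prod μ)) :=
  (MeasurePreserving.id m).prod Measure.measurePreserving_swap

/-- The antisymmetric part of any weak limit is again a weak limit, because the `w n` are
antisymmetric and the swap preserves the measure. Choosing it makes antisymmetry hold everywhere,
hence on every time slice. -/
theorem exists_antisymm_weak_limit [IsFiniteMeasure m] [IsFiniteMeasure μ]
    (w : ℕ → ℝ × X × X → ℝ) (hw : ∀ n, Measurable (w n)) (hb : ∀ n z, |w n z| ≤ 1)
    (ha : ∀ n z, w n (swapSpace z) = -w n z) :
    ∃ v : ℝ × X × X → ℝ, Measurable v ∧ (∀ z, v (swapSpace z) = -v z) ∧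
      (∀ᵐ z ∂(m.prod (μ.prod μ)), |v z| ≤ 1) ∧
      ∀ h : ℝ × X × X → ℝ, MemLp h 2 (m.prod (μ.prod μ)) →
      Tendsto (fun n => ∫ z, w n z * h z ∂(m.prod (μ.prod μ))) (hyperfilter ℕ : Filter ℕ)
        (𝓝 (∫ z, v z * h z ∂(m.prod (μ.prod μ)))) := by
  set ν := m.prod (μ.prod μ) with hν
  have hσ : MeasurePreserving (swapSpace : ℝ × X × X ≃ᵐ ℝ × X × X) ν ν :=
    measurePreserving_swapSpace
  have hσσ : ∀ z : ℝ × X × X, swapSpace (swapSpace z) = z := fun z => rfl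
  obtain ⟨v, hvm, hv2, hv⟩ := exists_weak_limit (ν := ν) w hw hb
  have hvs2 : MemLp (fun z => v (swapSpace z)) 2 ν := hv2.comp_measurePreserving hσ
  have hm' : Measurable fun z => (v z - v (swapSpace z)) / 2 :=
    (hvm.sub (hvm.comp swapSpace.measurable)).div_const 2
  have hm2 : MemLp (fun z => (v z - v (swapSpace z)) / 2) 2 ν := by
    simp_rw [div_eq_mul_inv]
    exact (hv2.sub hvs2).mul_const _
  have hlim : ∀ h : ℝ × X × X → ℝ, MemLp h 2 ν →
      Tendsto (fun n => ∫ z, w n z * h z ∂ν) (hyperfilter ℕ : Filter ℕ)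
        (𝓝 (∫ z, (v z - v (swapSpace z)) / 2 * h z ∂ν)) := by
    intro h hh
    have hhs : MemLp (fun z => h (swapSpace z)) 2 ν := hh.comp_measurePreserving hσ
    have t1 := ((hv h hh).sub (hv _ hhs)).div_const 2
    have e1 : ∀ n, ∫ z, w n z * h (swapSpace z) ∂ν = -∫ z, w n z * h z ∂ν := fun n => by
      rw [← integral_neg,
        ← hσ.integral_comp swapSpace.measurableEmbedding (fun z => -(w n z * h z))]
      refine integral_congr_ae (Eventually.of_forall fun z => ?_)
      simp only
      rw [ha]
      ring
    have e2 : ∫ z, v z * h (swapSpace z) ∂ν = ∫ z, v (swapSpace z) * h z ∂ν := by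
      rw [← hσ.integral_comp swapSpace.measurableEmbedding (fun z => v z * h (swapSpace z))]
      rfl
    have e3 : ∫ z, (v z - v (swapSpace z)) / 2 * h z ∂ν =
        (∫ z, v z * h z ∂ν - ∫ z, v z * h (swapSpace z) ∂ν) / 2 := by
      have j1 : Integrable (fun z => v z * h z) ν := hv2.integrable_mul hh
      have j2 : Integrable (fun z => v (swapSpace z) * h z) ν := hvs2.integrable_mul hh
      rw [e2, ← integral_sub j1 j2, ← integral_div]
      refine integral_congr_ae (Eventually.of_forall fun z => ?_)
      simp only
      ring
    rw [e3]
    refine t1.congr fun n => ?_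
    rw [e1]
    ring
  refine ⟨fun z => (v z - v (swapSpace z)) / 2, hm', fun z => ?_, ?_, hlim⟩
  · simp only [hσσ]; ring
  · exact ae_abs_le_one_of_weak_limit hw hb hm' hm2 hlim

/-- The value of the operator for the time dependent sign field `w`. -/
noncomputable def fieldLap (μ : Measure X) (K : X → X → ℝ) (w : ℝ × X × X → ℝ) (s : ℝ) (x : X) : ℝ :=
  -∫ y, K x y * w (s, x, y) ∂μ

theorem measurable_fieldLap [SFinite μ] (hK : Measurable (Function.uncurry K))
    {w : ℝ × X × X → ℝ} (hw : Measurable w) :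
    Measurable (Function.uncurry (fieldLap μ K w)) := by
  refine (StronglyMeasurable.integral_prod_right' (f := fun p : (ℝ × X) × X =>
    K p.1.2 p.2 * w (p.1.1, p.1.2, p.2)) ?_).measurable.neg
  exact ((hK.comp (by fun_prop : Measurable fun p : (ℝ × X) × X => (p.1.2, p.2))).mul
    (hw.comp (by fun_prop))).stronglyMeasurable

theorem ae_abs_fieldLap_le [SFinite m] [SFinite μ] (hK : Ker μ K M) (hM : 0 ≤ M)
    {w : ℝ × X × X → ℝ} (hw : Measurable w) (hb : ∀ᵐ z ∂(m.prod (μ.prod μ)), |w z| ≤ 1) :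
    ∀ᵐ p ∂(m.prod μ), |fieldLap μ K w p.1 p.2| ≤ M := by
  rw [Measure.ae_prod_iff_ae_ae (p := fun p : ℝ × X => |fieldLap μ K w p.1 p.2| ≤ M)
    (measurableSet_le (measurable_fieldLap hK.meas hw).abs measurable_const)]
  filter_upwards [Measure.ae_ae_of_ae_prod hb] with s hs
  filter_upwards [hK.ae_abs_integral_le hM (w := fun x y => w (s, x, y)) hs] with x hx
  rw [fieldLap, abs_neg]
  exact hx

theorem ae_abs_cum_le_of_bounded [IsFiniteMeasure m] [SFinite μ] {V : ℝ → X → ℝ} (hM : 0 ≤ M)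
    (hV : ∀ᵐ p ∂(m.prod μ), |V p.1 p.2| ≤ M) :
    ∀ᵐ x ∂μ, ∀ t, |cum m V t x| ≤ M * m.real univ := by
  filter_upwards [ae_ae_of_ae_prod_swap hV] with x hx t
  refine (norm_integral_le_of_norm_le_const (C := M)
    (f := fun s => V s x) (ae_restrict_of_ae hx)).trans ?_
  gcongr
  rw [measureReal_restrict_apply_univ]
  exact measureReal_mono (subset_univ _)

/-- These are the test functions against which weak convergence of sign fields becomes weak
convergence, at the fixed time `t`, of the primitives of the operator values. -/
theorem memLp_test [IsFiniteMeasure m] [IsFiniteMeasure μ] (hK : Ker μ K M) {h : X → ℝ}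
    (hh : Measurable h) {B : ℝ} (hB : ∀ᵐ x ∂μ, |h x| ≤ B) (t : ℝ) :
    MemLp (fun z : ℝ × X × X => (Iic t).indicator (fun _ => (1 : ℝ)) z.1 * (h z.2.1 * K z.2.1 z.2.2))
      2 (m.prod (μ.prod μ)) := by
  have hmeas : Measurable (fun z : ℝ × X × X =>
      (Iic t).indicator (fun _ => (1 : ℝ)) z.1 * (h z.2.1 * K z.2.1 z.2.2)) :=
    ((measurable_const.indicator measurableSet_Iic).comp measurable_fst).mul
      ((hh.comp (by fun_prop)).mul (hK.meas.comp measurable_snd))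
  have hB' : ∀ᵐ z ∂(m.prod (μ.prod μ)), |h z.2.1| ≤ B :=
    (Measure.quasiMeasurePreserving_fst.comp Measure.quasiMeasurePreserving_snd).ae
      (p := fun x => |h x| ≤ B) hB
  refine MemLp.of_le_mul (hK.sq.comp_snd m) hmeas.aestronglyMeasurable (c := B) ?_
  filter_upwards [hB'] with z hz
  rw [norm_mul, norm_mul, ← mul_assoc]
  refine mul_le_mul_of_nonneg_right ?_ (norm_nonneg _)
  refine (mul_le_of_le_one_left (norm_nonneg _) ?_).trans hz
  by_cases hs : z.1 ∈ Iic t <;> simp [hs]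

/-- Fubini: testing the primitive of `fieldLap` in space is testing `w` in space and time. -/
theorem integral_mul_cum_fieldLap [IsFiniteMeasure m] [IsFiniteMeasure μ] (hK : Ker μ K M)
    (hM : 0 ≤ M) {w : ℝ × X × X → ℝ} (hw : Measurable w)
    (hb : ∀ᵐ z ∂(m.prod (μ.prod μ)), |w z| ≤ 1) {h : X → ℝ}
    (hh : Measurable h) {B : ℝ} (hB : ∀ᵐ x ∂μ, |h x| ≤ B) (t : ℝ) :
    ∫ x, h x * cum m (fieldLap μ K w) t x ∂μ = -∫ z : ℝ × X × X, w z *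
      ((Iic t).indicator (fun _ => (1 : ℝ)) z.1 * (h z.2.1 * K z.2.1 z.2.2)) ∂(m.prod (μ.prod μ)) := by
  have hw2 : MemLp w 2 (m.prod (μ.prod μ)) := MemLp.of_bound hw.aestronglyMeasurable 1 hb
  have hi : Integrable (fun z : ℝ × X × X => w z * ((Iic t).indicator (fun _ => (1 : ℝ)) z.1 *
      (h z.2.1 * K z.2.1 z.2.2))) (m.prod (μ.prod μ)) :=
    hw2.integrable_mul (memLp_test hK hh hB t)
  have h2 : MemLp h 2 μ := MemLp.of_bound hh.aestronglyMeasurable B hB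
  have e1 : ∀ᵐ s ∂m, ∫ p : X × X, w (s, p) *
      ((Iic t).indicator (fun _ => (1 : ℝ)) s * (h p.1 * K p.1 p.2)) ∂(μ.prod μ) =
      (Iic t).indicator (fun s => ∫ x, -(h x * fieldLap μ K w s x) ∂μ) s := by
    filter_upwards [Measure.ae_ae_of_ae_prod hb] with s hs
    have hj := integrable_kernel_mul hK.sq (a := fun x y => w (s, x, y))
      (hw.comp measurable_prodMk_left).aestronglyMeasurable hs h2
    by_cases hst : s ∈ Iic t
    · rw [indicator_of_mem hst, indicator_of_mem hst]
      rw [show (fun p : X × X => w (s, p) * (1 * (h p.1 * K p.1 p.2))) =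
        fun p : X × X => h p.1 * (K p.1 p.2 * w (s, p.1, p.2)) by ext p; ring,
        integral_prod _ hj]
      refine integral_congr_ae (Eventually.of_forall fun x => ?_)
      simp only [fieldLap]
      rw [integral_const_mul]
      ring
    · simp [indicator_of_notMem hst]
  have hF : Integrable (fun p : ℝ × X => h p.2 * fieldLap μ K w p.1 p.2) (m.prod μ) := by
    have hl : MemLp (fun p : ℝ × X => fieldLap μ K w p.1 p.2) 2 (m.prod μ) :=
      MemLp.of_bound (measurable_fieldLap hK.meas hw).aestronglyMeasurable M
        (ae_abs_fieldLap_le hK hM hw hb)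
    exact (h2.comp_snd m).integrable_mul hl
  have hF' : Integrable (fun p : ℝ × X => h p.2 * fieldLap μ K w p.1 p.2)
      ((m.restrict (Iic t)).prod μ) :=
    hF.mono_measure (Measure.prod_mono Measure.restrict_le_self le_rfl)
  rw [integral_prod _ hi, integral_congr_ae e1, integral_indicator measurableSet_Iic]
  simp_rw [integral_neg]
  rw [neg_neg, integral_integral_swap hF']
  refine integral_congr_ae (Eventually.of_forall fun x => ?_)
  simp only [cum]
  rw [integral_const_mul]

end Existence

/-! ### From weak to strong convergence, and closedness of the sign graph -/

section Existence

variable {X : Type*} [MeasurableSpace X] {μ : Measure X} {K : X → X → ℝ} {M T : ℝ}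
  {f : ℝ → X → ℝ} {g : X → ℝ} {m : Measure ℝ}

/-- Strong convergence in space, uniformly in time, from weak convergence of the sign fields and the
Cauchy estimate. -/
theorem integral_sq_cum_fieldLap_sub_le [IsFiniteMeasure m] [IsFiniteMeasure μ] (hK : Ker μ K M)
    (hM : 0 ≤ M) {w : ℕ → ℝ × X × X → ℝ} (hw : ∀ n, Measurable (w n)) (hb : ∀ n z, |w n z| ≤ 1)
    {v : ℝ × X × X → ℝ} (hv : Measurable v) (hv1 : ∀ᵐ z ∂(m.prod (μ.prod μ)), |v z| ≤ 1)
    (hlim : ∀ h : ℝ × X × X → ℝ, MemLp h 2 (m.prod (μ.prod μ)) →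
      Tendsto (fun n => ∫ z, w n z * h z ∂(m.prod (μ.prod μ))) (hyperfilter ℕ : Filter ℕ)
        (𝓝 (∫ z, v z * h z ∂(m.prod (μ.prod μ)))))
    {C : ℝ} {t : ℝ} (hC : ∀ n k : ℕ, ∫ x, (cum m (fieldLap μ K (w k)) t x -
      cum m (fieldLap μ K (w n)) t x) ^ 2 ∂μ ≤ C / (n + 1) + C / (k + 1)) (n : ℕ) :
    ∫ x, (cum m (fieldLap μ K v) t x - cum m (fieldLap μ K (w n)) t x) ^ 2 ∂μ ≤ C / (n + 1) := by
  have hb' : ∀ n, ∀ᵐ z ∂(m.prod (μ.prod μ)), |w n z| ≤ 1 := fun n => Eventually.of_forall (hb n)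
  have hcm : ∀ u : ℝ × X × X → ℝ, Measurable u → Measurable (cum m (fieldLap μ K u) t) :=
    fun u hu => (measurable_cum (measurable_fieldLap hK.meas hu)).of_uncurry_left
  have hcb : ∀ u : ℝ × X × X → ℝ, Measurable u → (∀ᵐ z ∂(m.prod (μ.prod μ)), |u z| ≤ 1) →
      ∀ᵐ x ∂μ, |cum m (fieldLap μ K u) t x| ≤ M * m.real univ := fun u hu hu1 =>
    (ae_abs_cum_le_of_bounded hM (ae_abs_fieldLap_le hK hM hu hu1)).mono fun x hx => hx t
  set c := cum m (fieldLap μ K v) t with hc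
  set a : ℕ → X → ℝ := fun k => cum m (fieldLap μ K (w k)) t with ha
  have hdm : ∀ k, Measurable fun x => c x - a k x := fun k => (hcm v hv).sub (hcm _ (hw k))
  have hdb : ∀ k, ∀ᵐ x ∂μ, |c x - a k x| ≤ 2 * (M * m.real univ) := fun k => by
    filter_upwards [hcb v hv hv1, hcb _ (hw k) (hb' k)] with x h1 h2
    exact (abs_sub _ _).trans (by simp only [hc, ha]; linarith)
  have hd2 : ∀ k, MemLp (fun x => c x - a k x) 2 μ := fun k =>
    MemLp.of_bound (hdm k).aestronglyMeasurable _ (hdb k)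
  have hc2 : MemLp c 2 μ := MemLp.of_bound (hcm v hv).aestronglyMeasurable _ (hcb v hv hv1)
  have ha2 : ∀ k, MemLp (a k) 2 μ := fun k =>
    MemLp.of_bound (hcm _ (hw k)).aestronglyMeasurable _ (hcb _ (hw k) (hb' k))
  -- Weak convergence of `a k` to `c`, tested against the bounded function `c - a n`.
  have hprod : Tendsto (fun k => ∫ x, (c x - a n x) * (c x - a k x) ∂μ) (hyperfilter ℕ : Filter ℕ)
      (𝓝 0) := by
    have h1 := (hlim _ (memLp_test hK (hdm n) (hdb n) t)).sub_const
      (∫ z : ℝ × X × X, v z * ((Iic t).indicator (fun _ => (1 : ℝ)) z.1 *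
        ((c z.2.1 - a n z.2.1) * K z.2.1 z.2.2)) ∂(m.prod (μ.prod μ)))
    rw [sub_self] at h1
    refine h1.congr fun k => ?_
    have e1 := integral_mul_cum_fieldLap hK hM hv hv1 (hdm n) (hdb n) t (m := m)
    have e2 := integral_mul_cum_fieldLap hK hM (hw k) (hb' k) (hdm n) (hdb n) t (m := m)
    have j1 : Integrable (fun x => (c x - a n x) * c x) μ := (hd2 n).integrable_mul hc2
    have j2 : Integrable (fun x => (c x - a n x) * a k x) μ := (hd2 n).integrable_mul (ha2 k)
    simp_rw [mul_sub (c _ - a n _)]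
    rw [integral_sub j1 j2]
    simp only [hc, ha] at e1 e2 ⊢
    rw [e1, e2]
    ring
  have hlim2 : Tendsto (fun k : ℕ => C / (n + 1) + C / (k + 1) +
      2 * ∫ x, (c x - a n x) * (c x - a k x) ∂μ) (hyperfilter ℕ : Filter ℕ)
      (𝓝 (C / (n + 1) + 0 + 2 * 0)) := by
    refine (tendsto_const_nhds.add ?_).add (hprod.const_mul 2)
    exact (tendsto_const_div_atTop_nhds_zero_nat C).comp (tendsto_add_atTop_nat 1) |>.mono_left
      Nat.hyperfilter_le_atTop |>.congr fun k => by simp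
  rw [add_zero, mul_zero, add_zero] at hlim2
  refine ge_of_tendsto hlim2 (Eventually.of_forall fun k => ?_)
  have i1 : Integrable (fun x => (c x - a n x) ^ 2) μ := (hd2 n).integrable_sq
  have i2 : Integrable (fun x => (a k x - a n x) ^ 2) μ := ((ha2 k).sub (ha2 n)).integrable_sq
  have i3 : Integrable (fun x => (c x - a n x) * (c x - a k x)) μ := (hd2 n).integrable_mul (hd2 k)
  -- Weak lower semicontinuity by hand: expand the square of `a k - a n = (c - a n) - (c - a k)` and
  -- drop `(c - a k)²`. The Cauchy bound then survives as `k` tends to infinity along the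
  -- ultrafilter.
  have h1 : ∫ x, (c x - a n x) ^ 2 ∂μ ≤
      ∫ x, ((a k x - a n x) ^ 2 + 2 * ((c x - a n x) * (c x - a k x))) ∂μ := by
    refine integral_mono i1 (i2.add (i3.const_mul 2)) fun x => ?_
    simp only
    nlinarith [sq_nonneg (c x - a k x)]
  rw [integral_add i2 (i3.const_mul 2), integral_const_mul] at h1
  have h2 := hC n k
  linarith

/-- A weak limit of sign fields of strongly converging functions is a sign field of the limit. -/
theorem ae_mem_absSubdiff_of_weak_limit [IsFiniteMeasure m] [IsFiniteMeasure μ]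
    {U : ℕ → ℝ → X → ℝ} {u : ℝ → X → ℝ} (hU : ∀ n, Measurable (Function.uncurry (U n)))
    (hu : Measurable (Function.uncurry u))
    (hi : ∀ n, Integrable (fun p : ℝ × X => U n p.1 p.2 - u p.1 p.2) (m.prod μ))
    (h0 : Tendsto (fun n => ∫ p : ℝ × X, |U n p.1 p.2 - u p.1 p.2| ∂(m.prod μ)) atTop (𝓝 0))
    {v : ℝ × X × X → ℝ} (hv : Measurable v) (hv1 : ∀ᵐ z ∂(m.prod (μ.prod μ)), |v z| ≤ 1)
    (hlim : ∀ h : ℝ × X × X → ℝ, MemLp h 2 (m.prod (μ.prod μ)) →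
      Tendsto (fun n => ∫ z, Real.sign (U n z.1 z.2.2 - U n z.1 z.2.1) * h z ∂(m.prod (μ.prod μ)))
        (hyperfilter ℕ : Filter ℕ) (𝓝 (∫ z, v z * h z ∂(m.prod (μ.prod μ))))) :
    ∀ᵐ z ∂(m.prod (μ.prod μ)), v z ∈ absSubdiff (u z.1 z.2.2 - u z.1 z.2.1) := by
  set ν := m.prod (μ.prod μ) with hν
  have hdiff : ∀ k : ℝ → X → ℝ, Measurable (Function.uncurry k) →
      Measurable fun z : ℝ × X × X => k z.1 z.2.2 - k z.1 z.2.1 := fun k hk =>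
    (hk.comp (by fun_prop : Measurable fun z : ℝ × X × X => (z.1, z.2.2))).sub
      (hk.comp (by fun_prop : Measurable fun z : ℝ × X × X => (z.1, z.2.1)))
  set r : ℝ × X × X → ℝ := fun z => u z.1 z.2.2 - u z.1 z.2.1 with hr
  have hrm : Measurable r := hdiff u hu
  -- The natural test function `r` need not be square integrable. Dividing by `1 + |r|` makes it
  -- bounded while keeping its sign and its zeros.
  set h : ℝ × X × X → ℝ := fun z => r z / (1 + |r z|) with hh
  have hhm : Measurable h := hrm.div (measurable_const.add hrm.abs)
  have hpos : ∀ z, 0 < 1 + |r z| := fun z => by positivity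
  have hhb : ∀ z, |h z| ≤ 1 := fun z => by
    rw [hh]
    simp only
    rw [abs_div, abs_of_pos (hpos z), div_le_one (hpos z)]
    linarith
  have hh2 : MemLp h 2 ν := MemLp.of_bound hhm.aestronglyMeasurable 1 (Eventually.of_forall hhb)
  -- integrals of functions of one space variable
  have hone : ∀ q : ℝ × X → ℝ, Integrable q (m.prod μ) →
      Integrable (fun z : ℝ × X × X => q (z.1, z.2.1)) ν ∧
      ∫ z : ℝ × X × X, q (z.1, z.2.1) ∂ν = μ.real univ * ∫ p, q p ∂(m.prod μ) := by
    intro q hq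
    have ha := measurePreserving_prodAssoc m μ μ
    have hq1 : Integrable (fun y : (ℝ × X) × X => q y.1) ((m.prod μ).prod μ) := hq.comp_fst μ
    constructor
    · rw [← ha.integrable_comp_emb MeasurableEquiv.prodAssoc.measurableEmbedding]
      exact hq1
    · rw [← ha.integral_comp MeasurableEquiv.prodAssoc.measurableEmbedding]
      exact integral_fun_fst q
  have htwo : ∀ q : ℝ × X → ℝ, Integrable q (m.prod μ) →
      Integrable (fun z : ℝ × X × X => q (z.1, z.2.2)) ν ∧
      ∫ z : ℝ × X × X, q (z.1, z.2.2) ∂ν = μ.real univ * ∫ p, q p ∂(m.prod μ) := by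
    intro q hq
    have hσ : MeasurePreserving (swapSpace : ℝ × X × X ≃ᵐ ℝ × X × X) ν ν :=
      measurePreserving_swapSpace
    obtain ⟨h1, h2⟩ := hone q hq
    exact ⟨(hσ.integrable_comp_emb swapSpace.measurableEmbedding).2 h1,
      (hσ.integral_comp swapSpace.measurableEmbedding
        (fun z : ℝ × X × X => q (z.1, z.2.1))).trans h2⟩
  have habs : Integrable (fun z => |h z|) ν := hh2.abs.integrable (by norm_num)
  have hvh : Integrable (fun z => v z * h z) ν :=
    (MemLp.of_bound (p := 2) hv.aestronglyMeasurable 1 hv1).integrable_mul hh2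
  -- A factor 2 comes from `|sign(rₙ) r - |r|| ≤ 2 |r - rₙ|`; the other 2 counts the two space
  -- variables, each leaving a factor `μ(X)` after integration.
  have hclose : ∀ n, |∫ z, Real.sign (U n z.1 z.2.2 - U n z.1 z.2.1) * h z ∂ν - ∫ z, |h z| ∂ν| ≤
      4 * μ.real univ * ∫ p : ℝ × X, |U n p.1 p.2 - u p.1 p.2| ∂(m.prod μ) := by
    intro n
    obtain ⟨j1, k1⟩ := hone _ (hi n).abs
    obtain ⟨j2, k2⟩ := htwo _ (hi n).abs
    have hs2 : MemLp (fun z : ℝ × X × X => Real.sign (U n z.1 z.2.2 - U n z.1 z.2.1)) 2 ν :=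
      MemLp.of_bound (measurable_realSign.comp (hdiff _ (hU n))).aestronglyMeasurable 1
        (Eventually.of_forall fun z => abs_sign_le _)
    have hsi : Integrable (fun z => Real.sign (U n z.1 z.2.2 - U n z.1 z.2.1) * h z) ν :=
      hs2.integrable_mul hh2
    rw [← integral_sub hsi habs]
    have hpt : ∀ z : ℝ × X × X,
        abs (Real.sign (U n z.1 z.2.2 - U n z.1 z.2.1) * h z - |h z|) ≤
        2 * (|U n z.1 z.2.1 - u z.1 z.2.1| + |U n z.1 z.2.2 - u z.1 z.2.2|) := by
      intro z
      set rn := U n z.1 z.2.2 - U n z.1 z.2.1 with hrn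
      have e1 : Real.sign rn * h z - |h z| = (Real.sign rn * r z - |r z|) / (1 + |r z|) := by
        simp only [hh]
        rw [abs_div, abs_of_pos (hpos z)]
        ring
      have e2 : Real.sign rn * r z - |r z| = Real.sign rn * (r z - rn) + (|rn| - |r z|) := by
        linear_combination sign_mul_self_eq_abs rn
      have e3 : |r z - rn| ≤ |U n z.1 z.2.1 - u z.1 z.2.1| + |U n z.1 z.2.2 - u z.1 z.2.2| := by
        rw [show r z - rn = (U n z.1 z.2.1 - u z.1 z.2.1) - (U n z.1 z.2.2 - u z.1 z.2.2) by
          simp only [hr, hrn]; ring]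
        exact abs_sub _ _
      have e4 : abs (Real.sign rn * r z - |r z|) ≤ 2 * |r z - rn| := by
        rw [e2]
        refine (abs_add_le _ _).trans ?_
        have a1 : |Real.sign rn * (r z - rn)| ≤ |r z - rn| := by
          rw [abs_mul]
          exact mul_le_of_le_one_left (abs_nonneg _) (abs_sign_le _)
        have a2 : abs (|rn| - |r z|) ≤ |r z - rn| := by
          rw [abs_sub_comm (r z)]
          exact abs_abs_sub_abs_le_abs_sub _ _
        linarith
      rw [e1, abs_div, abs_of_pos (hpos z)]
      refine (div_le_self (abs_nonneg _) (by linarith [abs_nonneg (r z)])).trans ?_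
      linarith
    refine (abs_integral_le_integral_abs).trans ((integral_mono (hsi.sub habs).abs
      ((j1.add j2).const_mul 2) hpt).trans_eq ?_)
    simp only [Pi.add_apply]
    rw [integral_const_mul, integral_add j1 j2, k1, k2]
    ring
  have hlim1 : Tendsto (fun n => ∫ z, Real.sign (U n z.1 z.2.2 - U n z.1 z.2.1) * h z ∂ν) atTop
      (𝓝 (∫ z, |h z| ∂ν)) := by
    rw [tendsto_iff_dist_tendsto_zero]
    refine squeeze_zero (fun _ => dist_nonneg) hclose ?_
    simpa using h0.const_mul (4 * μ.real univ)
  -- Weak and strong limits agree, so `∫ (|h| - v h) = 0`. The integrand is nonnegative because `|v|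
  -- ≤ 1`, hence `v h = |h|` and `v r = |r|` almost everywhere.
  have heq := tendsto_nhds_unique (hlim h hh2) (hlim1.mono_left Nat.hyperfilter_le_atTop)
  have hz : ∫ z, (|h z| - v z * h z) ∂ν = 0 := by
    rw [integral_sub habs hvh, heq, sub_self]
  have hnn : 0 ≤ᵐ[ν] fun z => |h z| - v z * h z := by
    filter_upwards [hv1] with z hz1
    simp only [Pi.zero_apply, sub_nonneg]
    refine (le_abs_self _).trans ?_
    rw [abs_mul]
    exact mul_le_of_le_one_left (abs_nonneg _) hz1
  rw [integral_eq_zero_iff_of_nonneg_ae hnn (habs.sub hvh)] at hz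
  filter_upwards [hz, hv1] with z h1 h2
  refine mem_absSubdiff_iff.2 ⟨h2, ?_⟩
  simp only [Pi.zero_apply, hh] at h1
  rw [abs_div, abs_of_pos (hpos z), mul_div_assoc', ← sub_div, div_eq_zero_iff] at h1
  rcases h1 with h1 | h1
  · simp only [hr] at h1; linarith
  · exact absurd h1 (hpos z).ne'

end Existence

/-! ### Convergence of the Euler scheme -/

section Existence

variable {X : Type*} [MeasurableSpace X] {μ : Measure X} {K : X → X → ℝ} {M T : ℝ}
  {f : ℝ → X → ℝ} {g : X → ℝ} {m : Measure ℝ}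

/-- The existence theorem in abstract form. The limit sign field `v` determines `η`, and `η`
determines the limit function; it remains to show that the Euler values converge strongly to that
function, after which closedness of the sign graph applies on almost every time slice. -/
theorem exists_inLap [IsFiniteMeasure μ] (hT : 0 < T) (hK : Ker μ K M) (hM : 0 ≤ M)
    (hf : L12 (μT T) μ f) (hg : Measurable g) (hg2 : MemLp g 2 μ) :
    ∃ η : ℝ → X → ℝ, L12 (μT T) μ η ∧
      ∀ᵐ t ∂(μT T), InLap μ K (fun x => g x + cum (μT T) (fun s y => f s y - η s y) t x) (η t) := by
  obtain ⟨C, hC0, hex⟩ := exists_euler hT hK hM hf hg hg2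
  choose U hUm hU2 hUi hUc using hex
  set m := μT T with hm
  set ν := m.prod (μ.prod μ) with hν
  set w : ℕ → ℝ × X × X → ℝ := fun n z => Real.sign (U n z.1 z.2.2 - U n z.1 z.2.1) with hw
  have hwm : ∀ n, Measurable (w n) := fun n => measurable_realSign.comp
    (((hUm n).comp (by fun_prop : Measurable fun z : ℝ × X × X => (z.1, z.2.2))).sub
      ((hUm n).comp (by fun_prop : Measurable fun z : ℝ × X × X => (z.1, z.2.1))))
  have hwb : ∀ n z, |w n z| ≤ 1 := fun n z => abs_sign_le _
  obtain ⟨v, hvm, hva, hv1, hlim⟩ := exists_antisymm_weak_limit (m := m) (μ := μ) w hwm hwb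
    (fun n z => by
      simp only [hw, swapSpace_apply]
      rw [← Real.sign_neg, neg_sub])
  set η : ℝ → X → ℝ := fieldLap μ K v with hη
  have hl : ∀ k : ℝ × X × X → ℝ, Measurable k → (∀ᵐ z ∂ν, |k z| ≤ 1) →
      L12 m μ (fieldLap μ K k) := fun k hk hk1 =>
    L12.of_bounded (measurable_fieldLap hK.meas hk) (ae_abs_fieldLap_le hK hM hk hk1)
  have hηl : L12 m μ η := hl v hvm hv1
  have hηn : ∀ n, L12 m μ (fieldLap μ K (w n)) := fun n =>
    hl _ (hwm n) (Eventually.of_forall (hwb n))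
  -- The Cauchy estimate between levels `n` and `k` passes to the weak limit in `k`. By unfolding,
  -- `signLap` of `U n` is `fieldLap` of `w n`.
  have hstrong : ∀ n t, ∫ x, (cum m η t x - cum m (fieldLap μ K (w n)) t x) ^ 2 ∂μ ≤
      4 * M * C / (n + 1) := by
    intro n t
    refine integral_sq_cum_fieldLap_sub_le hK hM hwm hwb hvm hv1 hlim (fun n k => ?_) n
    have h := integral_sq_cum_sub_le hK hM hf (hUm n) (hUm k) (hU2 n) (hU2 k) (hUi n) (hUi k)
      (hUc n) (hUc k) t
    calc _ = ∫ x, cum m (fun r y => signLap μ K (U k r) y - signLap μ K (U n r) y) t x ^ 2 ∂μ := by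
          refine integral_congr_ae ?_
          filter_upwards [(hηn n).ae_integrable, (hηn k).ae_integrable] with x h1 h2
          congr 1
          exact (integral_sub h2.integrableOn h1.integrableOn).symm
      _ ≤ _ := h
      _ = _ := by ring
  set u : ℝ → X → ℝ := fun t x => g x + cum m (fun s y => f s y - η s y) t x with hu
  have hum : Measurable (Function.uncurry u) :=
    (hg.comp measurable_snd).add (measurable_cum (hf.sub hηl).meas)
  set d : ℕ → ℝ × X → ℝ := fun n p => cum m η p.1 p.2 - cum m (fieldLap μ K (w n)) p.1 p.2 with hd
  have hdm : ∀ n, Measurable (d n) := fun n =>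
    (measurable_cum hηl.meas).sub (measurable_cum (hηn n).meas)
  have hdb : ∀ n, ∀ᵐ p ∂(m.prod μ), |d n p| ≤ 2 * (M * m.real univ) := by
    intro n
    have h1 := ae_abs_cum_le_of_bounded hM (ae_abs_fieldLap_le hK hM hvm hv1)
    have h2 := ae_abs_cum_le_of_bounded hM
      (ae_abs_fieldLap_le hK hM (hwm n) (Eventually.of_forall (hwb n) : ∀ᵐ z ∂ν, |w n z| ≤ 1))
    filter_upwards [Measure.quasiMeasurePreserving_snd.ae h1,
      Measure.quasiMeasurePreserving_snd.ae h2] with p h3 h4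
    exact (abs_sub _ _).trans (by linarith [h3 p.1, h4 p.1])
  have hd2 : ∀ n, MemLp (d n) 2 (m.prod μ) := fun n =>
    MemLp.of_bound (hdm n).aestronglyMeasurable _ (hdb n)
  have hdi : ∀ n, Integrable (d n) (m.prod μ) := fun n => (hd2 n).integrable (by norm_num)
  have hdsq : ∀ n, ∫ p, d n p ^ 2 ∂(m.prod μ) ≤ m.real univ * (4 * M * C / (n + 1)) := by
    intro n
    rw [integral_prod _ (hd2 n).integrable_sq]
    refine (integral_mono (hd2 n).integrable_sq.integral_prod_left (integrable_const _)
      (fun s => hstrong n s)).trans_eq ?_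
    rw [integral_const, smul_eq_mul]
  have hone : MemLp (fun _ : ℝ × X => (1 : ℝ)) 2 (m.prod μ) := memLp_const 1
  set c₁ := (eLpNorm (fun _ : ℝ × X => (1 : ℝ)) 2 (m.prod μ)).toReal with hc₁
  have hdabs : ∀ n, ∫ p, |d n p| ∂(m.prod μ) ≤ √(m.real univ * (4 * M * C / (n + 1))) * c₁ := by
    intro n
    have h1 := (le_abs_self _).trans (MemLp.abs_integral_mul_le (hd2 n).abs hone)
    simp only [mul_one] at h1
    refine h1.trans ?_
    gcongr
    rw [← Real.sqrt_sq (ENNReal.toReal_nonneg (a := eLpNorm _ 2 (m.prod μ))),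
      ← MemLp.integral_sq_eq (hd2 n).abs]
    refine Real.sqrt_le_sqrt ?_
    exact (integral_congr_ae (Eventually.of_forall fun p => sq_abs (d n p))).trans_le (hdsq n)
  -- The Euler error splits into the distance between primitives, small in `L²` by `hstrong`, and
  -- the consistency residual, small in `L¹` by `exists_euler`.
  have hq : ∀ n, ∀ᵐ p ∂(m.prod μ), U n p.1 p.2 - u p.1 p.2 = d n p - (g p.2 +
      cum m (fun r y => f r y - signLap μ K (U n r) y) p.1 p.2 - U n p.1 p.2) := by
    intro n
    have h0 : ∀ᵐ x ∂μ, ∀ s, U n s x - u s x = d n (s, x) - (g x +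
        cum m (fun r y => f r y - signLap μ K (U n r) y) s x - U n s x) := by
      filter_upwards [hf.ae_integrable, hηl.ae_integrable, (hηn n).ae_integrable] with x h1 h2 h3 s
      have e1 : cum m (fun s y => f s y - η s y) s x = cum m f s x - cum m η s x :=
        integral_sub h1.integrableOn h2.integrableOn
      have e2 : cum m (fun r y => f r y - signLap μ K (U n r) y) s x =
          cum m f s x - cum m (fieldLap μ K (w n)) s x :=
        integral_sub h1.integrableOn h3.integrableOn
      simp only [hu, hd]
      rw [e1, e2]
      ring
    exact (Measure.quasiMeasurePreserving_snd.ae h0).mono fun p hp => hp p.1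
  have hqi : ∀ n, Integrable (fun p : ℝ × X => U n p.1 p.2 - u p.1 p.2) (m.prod μ) := fun n =>
    ((hdi n).sub (hUi n)).congr ((hq n).mono fun p hp => hp.symm)
  have hq0 : Tendsto (fun n => ∫ p : ℝ × X, |U n p.1 p.2 - u p.1 p.2| ∂(m.prod μ)) atTop (𝓝 0) := by
    have hle : ∀ n : ℕ, ∫ p : ℝ × X, |U n p.1 p.2 - u p.1 p.2| ∂(m.prod μ) ≤
        √(m.real univ * (4 * M * C / (n + 1))) * c₁ + C / (n + 1) := fun n => by
      refine le_trans ?_ (add_le_add (hdabs n) (hUc n))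
      rw [← integral_add (hdi n).abs (hUi n).abs]
      refine integral_mono_ae (hqi n).abs ((hdi n).abs.add (hUi n).abs) ?_
      filter_upwards [hq n] with p hp
      rw [hp]
      exact abs_sub _ _
    refine squeeze_zero (fun n => integral_nonneg fun p => abs_nonneg _) hle ?_
    have h1 : ∀ a : ℝ, Tendsto (fun n : ℕ => a / ((n : ℝ) + 1)) atTop (𝓝 0) := fun a =>
      ((tendsto_const_div_atTop_nhds_zero_nat a).comp (tendsto_add_atTop_nat 1)).congr
        fun k => by simp
    have h2 := (((h1 (4 * M * C)).const_mul (m.real univ)).sqrt.mul_const c₁).add (h1 C)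
    simpa using h2
  have hmem := ae_mem_absSubdiff_of_weak_limit hUm hum hqi hq0 hvm hv1 hlim
  refine ⟨η, hηl, ?_⟩
  filter_upwards [Measure.ae_ae_of_ae_prod hmem, Measure.ae_ae_of_ae_prod hv1] with t h1 h2
  refine ⟨fun x y => v (t, x, y), (hvm.comp measurable_prodMk_left).aestronglyMeasurable, h2,
    Eventually.of_forall fun p => ?_, h1, Eventually.of_forall fun x => rfl⟩
  have := hva (t, p.1, p.2)
  rw [swapSpace_apply] at this
  change v (t, p.1, p.2) = -v (t, p.2, p.1)
  rw [this, neg_neg]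

end Existence

/-! ### Well-posedness and stability on `Ω` -/

section Continuous

variable {d : ℕ} {K K₁ K₂ : Pt d → Pt d → ℝ} {M M₁ M₂ T : ℝ} {f f₁ f₂ : ℝ → Pt d → ℝ}
  {g g₁ g₂ : Pt d → ℝ} {u u₁ u₂ : ℝ → Pt d → ℝ}

instance : IsProbabilityMeasure (μΩ d) := by
  refine ⟨?_⟩
  rw [μΩ, Measure.restrict_apply_univ, dom, Real.volume_Icc_pi]
  simp

theorem IsSolution.weakSol (h : IsSolution K f g T u) : WeakSol (μΩ d) K f g T u := by
  obtain ⟨-, h0, v, η, hv, heq, hη⟩ := h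
  refine ⟨v, η, hv.1.1, fun t ht => ?_, heq, hη.mono fun t ht => ht.2.2⟩
  filter_upwards [hv.2 t ht, h0] with x h1 h2
  rw [h1, h2]

theorem IsSolution.exists_mildSol (hK : Ker (μΩ d) K M) (hM : 0 ≤ M) (hg : MemLp g 2 (μΩ d))
    (hf : MemL1L 2 T f) (h : IsSolution K f g T u) : ∃ V U, MildSol (μΩ d) K f g T u V U :=
  h.weakSol.exists_mildSol hK hM hg hf.1 hf.2

theorem IsSolution.memCL_two (hK : Ker (μΩ d) K M) (hM : 0 ≤ M) (hg : MemLp g 2 (μΩ d))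
    (hf : MemL1L 2 T f) (h : IsSolution K f g T u) : MemCL 2 T u := by
  obtain ⟨V, U, hm⟩ := h.exists_mildSol hK hM hg hf
  exact ⟨hm.memLp_at, hm.tendsto⟩

theorem MemL1L.sub_lt_top (hf₁ : MemL1L 2 T f₁) (hf₂ : MemL1L 2 T f₂) :
    ∫⁻ t, eLpNorm (fun x => f₁ t x - f₂ t x) 2 (μΩ d) ∂(μT T) < ∞ := by
  have hm : AEMeasurable (fun t => eLpNorm (f₁ t) 2 (μΩ d)) (μT T) := by
    simp_rw [eLpNorm_eq_lintegral_rpow_enorm_toReal (two_ne_zero (α := ℝ≥0∞)) ENNReal.ofNat_ne_top]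
    exact (AEMeasurable.lintegral_prod_right'
      (f := fun p : ℝ × Pt d => ‖f₁ p.1 p.2‖ₑ ^ (2 : ℝ≥0∞).toReal)
      (hf₁.1.enorm.pow_const _)).pow_const _
  have hle : ∀ᵐ t ∂(μT T), eLpNorm (fun x => f₁ t x - f₂ t x) 2 (μΩ d) ≤
      eLpNorm (f₁ t) 2 (μΩ d) + eLpNorm (f₂ t) 2 (μΩ d) := by
    filter_upwards [hf₁.1.prodMk_left, hf₂.1.prodMk_left] with t h1 h2
    exact eLpNorm_sub_le h1 h2 (by norm_num)
  refine (lintegral_mono_ae hle).trans_lt ?_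
  rw [lintegral_add_left' hm]
  exact ENNReal.add_lt_top.2 ⟨hf₁.2, hf₂.2⟩

theorem IsSolution.eLpNorm_sub_le (hT : 0 ≤ T) (hK₁ : Ker (μΩ d) K₁ M₁) (hK₂ : Ker (μΩ d) K₂ M₂)
    (hM₁ : 0 ≤ M₁) (hM₂ : 0 ≤ M₂) (hf₁ : MemL1L 2 T f₁) (hf₂ : MemL1L 2 T f₂)
    (hg₁ : MemLp g₁ 2 (μΩ d)) (hg₂ : MemLp g₂ 2 (μΩ d))
    (h₁ : IsSolution K₁ f₁ g₁ T u₁) (h₂ : IsSolution K₂ f₂ g₂ T u₂) :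
    ∀ t ∈ Icc 0 T, eLpNorm (u₁ t - u₂ t) 2 (μΩ d) ≤ eLpNorm (fun x => g₁ x - g₂ x) 2 (μΩ d) +
      normL1L 2 T (fun t x => f₁ t x - f₂ t x) +
      ENNReal.ofReal T * normTwoSq (fun x y => K₁ x y - K₂ x y) := by
  obtain ⟨V₁, U₁, m₁⟩ := h₁.exists_mildSol hK₁ hM₁ hg₁ hf₁
  obtain ⟨V₂, U₂, m₂⟩ := h₂.exists_mildSol hK₂ hM₂ hg₂ hf₂
  exact m₁.eLpNorm_sub_le hT hK₁ hK₂ hM₁ hM₂ hf₁.1 hf₂.1 (hf₁.sub_lt_top hf₂) m₂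

theorem IsSolution.isUniqueSolution (hT : 0 ≤ T) (hK : Ker (μΩ d) K M) (hM : 0 ≤ M)
    (hg : MemLp g 2 (μΩ d)) (hf : MemL1L 2 T f) (h : IsSolution K f g T u) :
    IsUniqueSolution K f g T u := by
  refine ⟨h, fun v hv t ht => ?_⟩
  have h0 := hv.eLpNorm_sub_le hT hK hK hM hM hf hf hg hg h t ht
  have e : eLpNorm (fun _ : Pt d => (0 : ℝ)) 2 (μΩ d) = 0 := eLpNorm_zero
  have e' : eLpNorm (fun _ : Pt d × Pt d => (0 : ℝ)) 2 ((μΩ d).prod (μΩ d)) = 0 := eLpNorm_zero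
  have h1 : eLpNorm (v t - u t) 2 (μΩ d) ≤ 0 := by
    refine h0.trans_eq ?_
    simp [normL1L, normTwoSq, Function.uncurry_def, e, e']
  have hm := ((hv.memCL_two hK hM hg hf).1 t ht).1.sub ((h.memCL_two hK hM hg hf).1 t ht).1
  have h2 := (eLpNorm_eq_zero_iff hm two_ne_zero).1 (le_antisymm h1 zero_le)
  filter_upwards [h2] with x hx
  exact sub_eq_zero.1 hx

theorem MemL1L.exists_l12 {X : Type*} [MeasurableSpace X] {μ : Measure X} [SFinite μ]
    {f : ℝ → X → ℝ} (hf : AEStronglyMeasurable (Function.uncurry f) ((μT T).prod μ))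
    (hf2 : ∫⁻ t, eLpNorm (f t) 2 μ ∂(μT T) < ∞) :
    ∃ F : ℝ → X → ℝ, L12 (μT T) μ F ∧ ∀ᵐ p ∂((μT T).prod μ), f p.1 p.2 = F p.1 p.2 := by
  set F : ℝ → X → ℝ := Function.curry (hf.mk _) with hF
  have he : ∀ᵐ p ∂((μT T).prod μ), f p.1 p.2 = F p.1 p.2 := hf.ae_eq_mk
  refine ⟨F, ⟨?_, ?_⟩, he⟩
  · rw [hF, Function.uncurry_curry]
    exact hf.stronglyMeasurable_mk.measurable
  · refine lt_of_eq_of_lt (lintegral_congr_ae ?_) hf2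
    filter_upwards [Measure.ae_ae_of_ae_prod he] with t ht
    exact (eLpNorm_congr_ae ht).symm

theorem cum_zero_eq {X : Type*} (V : ℝ → X → ℝ) (x : X) : cum (μT T) V 0 x = 0 := by
  rw [cum]
  refine setIntegral_measure_zero _ ?_
  rw [μT, Measure.restrict_apply measurableSet_Iic]
  refine measure_mono_null (t := {0}) (fun t ht => le_antisymm ht.1 ht.2.1) (by simp)

/-- The abstract existence theorem applied to measurable representatives of `f` and `g`. The
resulting primitive is continuous into `L²`, hence into `L¹` because `Ω` has measure one. -/
theorem exists_isSolution (hT : 0 < T) (hK : Ker (μΩ d) K M) (hM : 0 ≤ M)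
    (hg : MemLp g 2 (μΩ d)) (hf : MemL1L 2 T f) : ∃ u, IsSolution K f g T u := by
  obtain ⟨F, hF, hfF⟩ := MemL1L.exists_l12 hf.1 hf.2
  set G := hg.1.mk g with hG
  have hgG : g =ᵐ[μΩ d] G := hg.1.ae_eq_mk
  have hG2 : MemLp G 2 (μΩ d) := (memLp_congr_ae hgG).1 hg
  have hGm : Measurable G := hg.1.stronglyMeasurable_mk.measurable
  obtain ⟨η, hη, hin⟩ := exists_inLap hT hK hM hF hGm hG2
  set V : ℝ → Pt d → ℝ := fun s y => F s y - η s y with hV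
  have hVl : L12 (μT T) (μΩ d) V := hF.sub hη
  set u : ℝ → Pt d → ℝ := fun t x => G x + cum (μT T) V t x with hu
  have hu2 : ∀ t, MemLp (u t) 2 (μΩ d) := fun t => hG2.add (hVl.memLp_cum t)
  have h12 : ∀ h : Pt d → ℝ, AEStronglyMeasurable h (μΩ d) →
      eLpNorm h 1 (μΩ d) ≤ eLpNorm h 2 (μΩ d) := fun h hh =>
    eLpNorm_le_eLpNorm_of_exponent_le (by norm_num) hh
  refine ⟨u, ⟨fun t _ => (hu2 t).mono_exponent (by norm_num), fun t₀ _ => ?_⟩, ?_, V, η,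
    ⟨⟨hVl.meas.aestronglyMeasurable, ?_⟩, fun t ht => ?_⟩, ?_, ?_⟩
  · refine tendsto_of_tendsto_of_tendsto_of_le_of_le tendsto_const_nhds
      ((hVl.tendsto_eLpNorm_cum_sub t₀).mono_left nhdsWithin_le_nhds) (fun _ => zero_le)
      (fun t => ?_)
    refine (h12 _ ((hu2 t).1.sub (hu2 t₀).1)).trans_eq ?_
    congr 1
    ext x
    simp only [hu, Pi.sub_apply]
    ring
  · filter_upwards [hgG] with x hx
    simp only [hu]
    rw [cum_zero_eq, add_zero, hx]
  · exact (lintegral_mono fun t => h12 _ hVl.meas.of_uncurry_left.aestronglyMeasurable).trans_lt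
      hVl.fin
  · refine Eventually.of_forall fun x => ?_
    simp only [hu]
    rw [cum_zero_eq, add_zero, intervalIntegral_eq_setIntegral_Iic ht]
    rfl
  · filter_upwards [hfF] with p hp
    simp only [hV]
    rw [hp]
    ring
  · filter_upwards [hin] with t ht
    exact ⟨(hu2 t).mono_exponent (by norm_num), ht.memLp hK hM 1, ht⟩

/-- The only use of the `L^{∞,2}` assumption. Since `Ω` has measure one, the supremum of the row
`L²` norms bounds both the row `L¹` norms and the norm in `L²(Ω²)`. -/
theorem Data.exists_ker (h : Data d K f g T) : ∃ M, 0 ≤ M ∧ Ker (μΩ d) K M := by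
  have hs : ∀ᵐ x ∂(μΩ d), eLpNorm (K x) 2 (μΩ d) ≤ normLinfTwo K := by
    filter_upwards [ae_restrict_mem (measurableSet_Icc : MeasurableSet (dom d))] with x hx
    exact le_iSup₂ (f := fun x (_ : x ∈ dom d) => eLpNorm (K x) 2 (μΩ d)) x hx
  have hKm : ∀ x, Measurable (K x) := fun x => h.meas.of_uncurry_left
  refine ⟨(normLinfTwo K).toReal, ENNReal.toReal_nonneg, h.meas, h.nonneg, h.symm, ?_, ?_⟩
  · filter_upwards [hs] with x hx
    rw [ENNReal.ofReal_toReal h.bdd.ne]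
    refine le_trans ?_ hx
    rw [← eLpNorm_one_eq_lintegral_enorm]
    exact eLpNorm_le_eLpNorm_of_exponent_le (by norm_num) (hKm x).aestronglyMeasurable
  · refine ⟨h.meas.aestronglyMeasurable, ?_⟩
    have : eLpNorm (Function.uncurry K) 2 ((μΩ d).prod (μΩ d)) ≤ normLinfTwo K := by
      rw [eLpNorm_two_le_iff, lintegral_prod _ (h.meas.enorm.pow_const 2).aemeasurable]
      calc _ ≤ ∫⁻ _, normLinfTwo K ^ 2 ∂(μΩ d) := by
            refine lintegral_mono_ae (hs.mono fun x hx => ?_)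
            exact eLpNorm_two_le_iff.1 hx
        _ = _ := by simp
    exact this.trans_lt h.bdd

end Continuous

/-! ### Meshes -/

namespace Mesh

variable {d n : ℕ} (P : Mesh d n)

theorem measurableSet_cell (i : Idx d n) : MeasurableSet (P.cell i) :=
  MeasurableSet.univ_pi fun _ => measurableSet_Ioc

theorem node_castSucc_lt_succ (k : Fin d) (j : Fin n) :
    P.node k j.castSucc < P.node k j.succ := P.strictMono k (Fin.castSucc_lt_succ)

theorem node_nonneg (k : Fin d) (j : Fin (n + 1)) : 0 ≤ P.node k j := by
  rw [← P.node_zero k]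
  exact (P.strictMono k).monotone (Fin.zero_le j)

theorem node_le_one (k : Fin d) (j : Fin (n + 1)) : P.node k j ≤ 1 := by
  rw [← P.node_last k]
  exact (P.strictMono k).monotone (Fin.le_last j)

theorem cell_subset_dom (i : Idx d n) : P.cell i ⊆ dom d := fun _ hx =>
  ⟨fun k => (P.node_nonneg k _).trans (hx k (mem_univ k)).1.le,
    fun k => (hx k (mem_univ k)).2.trans (P.node_le_one k _)⟩

theorem volume_cell (i : Idx d n) : volume (P.cell i) =
    ∏ k, ENNReal.ofReal (P.node k (i k).succ - P.node k (i k).castSucc) := by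
  rw [cell, Real.volume_pi_Ioc]

theorem volume_cell_ne_top (i : Idx d n) : volume (P.cell i) ≠ ∞ := by
  rw [volume_cell]
  exact ENNReal.prod_ne_top fun k _ => ENNReal.ofReal_ne_top

theorem vol_pos (i : Idx d n) : 0 < P.vol i := by
  refine ENNReal.toReal_pos ?_ (P.volume_cell_ne_top i)
  rw [volume_cell]
  refine Finset.prod_ne_zero_iff.2 fun k _ => ?_
  simpa using P.node_castSucc_lt_succ k (i k)

theorem exists_mem_Ioc_node (k : Fin d) {t : ℝ} (h0 : 0 < t) (h1 : t ≤ 1) :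
    ∃ j : Fin n, t ∈ Ioc (P.node k j.castSucc) (P.node k j.succ) := by
  by_contra! hcon
  have h : ∀ j : Fin (n + 1), P.node k j < t := by
    intro j
    induction j using Fin.induction with
    | zero => rw [P.node_zero]; exact h0
    | succ j ih =>
      by_contra! hle
      exact hcon j ⟨ih, hle⟩
  have := h (Fin.last n)
  rw [P.node_last] at this
  linarith

theorem exists_mem_cell {x : Pt d} (hx : x ∈ univ.pi fun _ : Fin d => Ioc (0 : ℝ) 1) :
    ∃ i, x ∈ P.cell i := by
  choose i hi using fun k => P.exists_mem_Ioc_node k (hx k (mem_univ k)).1 (hx k (mem_univ k)).2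
  exact ⟨i, fun k _ => hi k⟩

/-- Cells are open on the left, so they miss only the null set of points with some zero coordinate.
-/
theorem ae_exists_mem_cell : ∀ᵐ x ∂(μΩ d), ∃ i, x ∈ P.cell i := by
  have h : (univ.pi fun _ : Fin d => Ioc (0 : ℝ) 1) =ᵐ[volume] dom d :=
    Measure.univ_pi_Ioc_ae_eq_Icc (f := (0 : Pt d)) (g := 1)
  rw [μΩ, ← Measure.restrict_congr_set h]
  filter_upwards [ae_restrict_mem (MeasurableSet.univ_pi fun _ => measurableSet_Ioc)] with x hx
  exact P.exists_mem_cell hx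

theorem eq_of_mem_cell {x : Pt d} {i j : Idx d n} (hi : x ∈ P.cell i) (hj : x ∈ P.cell j) :
    i = j := by
  ext k
  have h1 := hi k (mem_univ k)
  have h2 := hj k (mem_univ k)
  by_contra hne
  rcases lt_or_gt_of_ne (fun h => hne (congrArg Fin.val h) : i k ≠ j k) with h | h
  · have := (P.strictMono k).monotone (Fin.succ_le_castSucc_iff.2 h)
    linarith [h1.2, h2.1]
  · have := (P.strictMono k).monotone (Fin.succ_le_castSucc_iff.2 h)
    linarith [h2.2, h1.1]

theorem inj_apply {x : Pt d} {i : Idx d n} (hx : x ∈ P.cell i) (v : Idx d n → ℝ) :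
    P.inj v x = v i := by
  rw [inj, Finset.sum_eq_single i, indicator_of_mem hx]
  · intro j _ hj
    exact indicator_of_notMem (fun h => hj (P.eq_of_mem_cell h hx)) _
  · simp

theorem injK_apply {x y : Pt d} {i j : Idx d n} (hx : x ∈ P.cell i) (hy : y ∈ P.cell j)
    (A : Idx d n → Idx d n → ℝ) : P.injK A x y = A i j := by
  rw [injK, Finset.sum_eq_single i, Finset.sum_eq_single j, indicator_of_mem (mk_mem_prod hx hy)]
  · intro k _ hk
    exact indicator_of_notMem (fun h => hk (P.eq_of_mem_cell h.2 hy)) _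
  · simp
  · intro k _ hk
    refine Finset.sum_eq_zero fun l _ => ?_
    exact indicator_of_notMem (fun h => hk (P.eq_of_mem_cell h.1 hx)) _
  · simp

theorem measurable_inj (v : Idx d n → ℝ) : Measurable (P.inj v) :=
  Finset.measurable_fun_sum _ fun i _ => measurable_const.indicator (P.measurableSet_cell i)

theorem measurable_injK (A : Idx d n → Idx d n → ℝ) : Measurable (Function.uncurry (P.injK A)) :=
  Finset.measurable_fun_sum _ fun i _ => Finset.measurable_fun_sum _ fun j _ =>
    (measurable_const.indicator ((P.measurableSet_cell i).prod (P.measurableSet_cell j)) :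
      Measurable ((P.cell i ×ˢ P.cell j).indicator fun _ => A i j))

theorem abs_inj_le (v : Idx d n → ℝ) (x : Pt d) : |P.inj v x| ≤ ∑ i, |v i| := by
  refine (Finset.abs_sum_le_sum_abs _ _).trans (Finset.sum_le_sum fun i _ => ?_)
  exact norm_indicator_le_norm_self (fun _ => v i) x

theorem abs_injK_le (A : Idx d n → Idx d n → ℝ) (x y : Pt d) :
    |P.injK A x y| ≤ ∑ i, ∑ j, |A i j| := by
  refine (Finset.abs_sum_le_sum_abs _ _).trans (Finset.sum_le_sum fun i _ => ?_)
  refine (Finset.abs_sum_le_sum_abs _ _).trans (Finset.sum_le_sum fun j _ => ?_)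
  exact norm_indicator_le_norm_self (fun _ => A i j) (x, y)

theorem integral_inj (v : Idx d n → ℝ) : ∫ x, P.inj v x ∂(μΩ d) = ∑ i, P.vol i * v i := by
  simp only [inj]
  rw [integral_finsetSum _ fun i _ => (integrable_const (v i)).indicator (P.measurableSet_cell i)]
  refine Finset.sum_congr rfl fun i _ => ?_
  rw [integral_indicator (P.measurableSet_cell i), μΩ,
    Measure.restrict_restrict (P.measurableSet_cell i), inter_eq_left.2 (P.cell_subset_dom i),
    integral_const, measureReal_restrict_apply_univ, smul_eq_mul]
  rfl

/-- The row bound is crude and grows with the mesh, which is harmless because the stability estimate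
does not involve it. -/
theorem ker_injK {A : Idx d n → Idx d n → ℝ} (h0 : ∀ i j, 0 ≤ A i j) (hs : ∀ i j, A i j = A j i) :
    Ker (μΩ d) (P.injK A) (∑ i, ∑ j, |A i j|) where
  meas := P.measurable_injK A
  nonneg x y := Finset.sum_nonneg fun i _ => Finset.sum_nonneg fun j _ =>
    indicator_nonneg (fun _ _ => h0 i j) _
  symm x y := by
    rw [injK, injK, Finset.sum_comm]
    refine Finset.sum_congr rfl fun i _ => Finset.sum_congr rfl fun j _ => ?_
    rw [hs j i]
    by_cases hx : x ∈ P.cell j <;> by_cases hy : y ∈ P.cell i <;> simp [indicator, hx, hy]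
  row := Eventually.of_forall fun x => by
    refine (lintegral_mono (g := fun _ => ENNReal.ofReal (∑ i, ∑ j, |A i j|)) fun y => ?_).trans_eq
      (by simp)
    rw [Real.enorm_eq_ofReal_abs]
    exact ENNReal.ofReal_le_ofReal (P.abs_injK_le A x y)
  sq := MemLp.of_bound (P.measurable_injK A).aestronglyMeasurable _
    (Eventually.of_forall fun p => P.abs_injK_le A p.1 p.2)

theorem memLp_inj (v : Idx d n → ℝ) (q : ℝ≥0∞) : MemLp (P.inj v) q (μΩ d) :=
  MemLp.of_bound (P.measurable_inj v).aestronglyMeasurable _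
    (Eventually.of_forall fun x => P.abs_inj_le v x)

end Mesh

/-! ### Semi-discrete solutions: extension to the continuum, and existence -/

theorem lintegral_eLpNorm_lt_top_of_bound {X : Type*} [MeasurableSpace X] {μ : Measure X}
    [IsFiniteMeasure μ] {m : Measure ℝ} {V : ℝ → X → ℝ} {c : ℝ → ℝ} (hc : Integrable c m)
    (h : ∀ t x, |V t x| ≤ c t) (q : ℝ≥0∞) : ∫⁻ t, eLpNorm (V t) q μ ∂m < ∞ := by
  have h1 : ∀ t, eLpNorm (V t) q μ ≤ μ univ ^ q.toReal⁻¹ * ENNReal.ofReal (c t) := fun t =>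
    eLpNorm_le_of_ae_bound (Eventually.of_forall (h t))
  refine (lintegral_mono h1).trans_lt ?_
  rw [lintegral_const_mul' _ _ (by finiteness)]
  refine ENNReal.mul_lt_top (by finiteness) (lt_of_le_of_lt (lintegral_mono fun t => ?_) hc.2)
  exact Real.ofReal_le_enorm _

namespace Mesh

variable {d n : ℕ} (P : Mesh d n) {T : ℝ}

theorem memL1L_inj {F : ℝ → Idx d n → ℝ} (hF : ∀ i, Integrable (fun t => F t i) (μT T))
    (q : ℝ≥0∞) : MemL1L q T (fun t => P.inj (F t)) := by
  constructor
  · refine Finset.aestronglyMeasurable_fun_sum _ fun i _ => ?_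
    have h1 : AEStronglyMeasurable (fun p : ℝ × Pt d => F p.1 i) ((μT T).prod (μΩ d)) :=
      (hF i).1.comp_fst
    have h2 := h1.indicator (measurable_snd (P.measurableSet_cell i) :
      MeasurableSet {p : ℝ × Pt d | p.2 ∈ P.cell i})
    refine h2.congr (Eventually.of_forall fun p => ?_)
    by_cases hp : p.2 ∈ P.cell i <;> simp [indicator, hp]
  · exact lintegral_eLpNorm_lt_top_of_bound (c := fun t => ∑ i, |F t i|)
      (integrable_finsetSum _ fun i _ => (hF i).abs) (fun t x => P.abs_inj_le (F t) x) q

theorem integrable_proj {f : ℝ → Pt d → ℝ} (hf : MemL1L 2 T f) (i : Idx d n) :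
    Integrable (fun t => P.proj (f t) i) (μT T) := by
  obtain ⟨F, hF, hfF⟩ := MemL1L.exists_l12 hf.1 hf.2
  have h1 : Integrable (Function.uncurry f) ((μT T).prod (μΩ d)) :=
    hF.integrable.congr (hfF.mono fun p hp => hp.symm)
  have h2 : Integrable (Function.uncurry f) ((μT T).prod (volume.restrict (P.cell i))) :=
    h1.mono_measure (Measure.prod_mono le_rfl
      (Measure.restrict_mono_set _ (P.cell_subset_dom i)))
  exact h2.integral_prod_left.const_mul _

theorem projK_nonneg {K : Pt d → Pt d → ℝ} (hK : ∀ x y, 0 ≤ K x y) (i j : Idx d n) :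
    0 ≤ P.projK K i j :=
  mul_nonneg (inv_nonneg.2 (mul_nonneg (P.vol_pos i).le (P.vol_pos j).le))
    (integral_nonneg fun _ => hK _ _)

theorem projK_symm {K : Pt d → Pt d → ℝ} (hK : ∀ x y, K x y = K y x) (i j : Idx d n) :
    P.projK K i j = P.projK K j i := by
  rw [projK, projK, mul_comm (P.vol i)]
  congr 1
  rw [Measure.volume_eq_prod, ← Measure.prod_restrict, ← Measure.prod_restrict,
    ← integral_prod_swap]
  refine integral_congr_ae (Eventually.of_forall fun p => ?_)
  exact hK _ _

/-- The continuum extension of a semi-discrete solution solves the problem with the extended kernel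
and data. -/
theorem IsSemidiscreteSolution.isSolution_inj {A : Idx d n → Idx d n → ℝ} {F : ℝ → Idx d n → ℝ}
    {b₀ : Idx d n → ℝ} {b : ℝ → Idx d n → ℝ} (h : P.IsSemidiscreteSolution A F b₀ T b) :
    IsSolution (P.injK A) (fun t => P.inj (F t)) (P.inj b₀) T (fun t => P.inj (b t)) := by
  obtain ⟨h0, v, η, hv, hb, heq, hη⟩ := h
  have hpair : ∀ᵐ p ∂((μΩ d).prod (μΩ d)), ∃ i j, p.1 ∈ P.cell i ∧ p.2 ∈ P.cell j := by
    filter_upwards [Measure.quasiMeasurePreserving_fst.ae P.ae_exists_mem_cell,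
      Measure.quasiMeasurePreserving_snd.ae P.ae_exists_mem_cell] with p ⟨i, hi⟩ ⟨j, hj⟩
    exact ⟨i, j, hi, hj⟩
  refine ⟨⟨fun t _ => P.memLp_inj _ 1, fun t₀ ht₀ => ?_⟩, by simp only [h0]; rfl,
    fun t => P.inj (v t), fun t => P.inj (η t), ⟨P.memL1L_inj hv 1, fun t ht => ?_⟩, ?_, ?_⟩
  · have hle : ∀ t, eLpNorm (P.inj (b t) - P.inj (b t₀)) 1 (μΩ d) ≤
        ENNReal.ofReal (∑ i, |b t i - b t₀ i|) := fun t => by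
      refine (eLpNorm_le_of_ae_bound (C := ∑ i, |b t i - b t₀ i|) ?_).trans_eq (by simp)
      filter_upwards [P.ae_exists_mem_cell] with x ⟨i, hi⟩
      rw [Pi.sub_apply, P.inj_apply hi, P.inj_apply hi]
      exact Finset.single_le_sum (f := fun i => |b t i - b t₀ i|) (fun _ _ => abs_nonneg _)
        (Finset.mem_univ i)
    refine tendsto_of_tendsto_of_tendsto_of_le_of_le tendsto_const_nhds ?_ (fun _ => zero_le) hle
    rw [← ENNReal.ofReal_zero]
    refine ENNReal.tendsto_ofReal ?_
    have hc : ∀ i, Tendsto (fun t => |b t i - b t₀ i|) (𝓝[Icc 0 T] t₀) (𝓝 0) := by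
      intro i
      have hcont : Continuous fun t => |(∫ s in Iic t, v s i ∂(μT T)) - ∫ s in Iic t₀, v s i ∂(μT T)| :=
        ((continuous_setIntegral_Iic (hv i)).sub continuous_const).abs
      have h1 := (hcont.tendsto t₀).mono_left (nhdsWithin_le_nhds (s := Icc 0 T))
      simp only [sub_self, abs_zero] at h1
      refine h1.congr' ?_
      filter_upwards [self_mem_nhdsWithin] with t ht
      rw [hb t ht, hb t₀ ht₀, intervalIntegral_eq_setIntegral_Iic ht,
        intervalIntegral_eq_setIntegral_Iic ht₀, add_sub_add_left_eq_sub]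
    simpa using tendsto_finsetSum Finset.univ fun i _ => hc i
  · filter_upwards [P.ae_exists_mem_cell] with x ⟨i, hi⟩
    simp_rw [P.inj_apply hi]
    exact hb t ht i
  · have h1 : ∀ᵐ p ∂((μT T).prod (μΩ d)), ∀ i, v p.1 i = -η p.1 i + F p.1 i :=
      Measure.quasiMeasurePreserving_fst.ae heq
    filter_upwards [h1, Measure.quasiMeasurePreserving_snd.ae P.ae_exists_mem_cell]
      with p hp ⟨i, hi⟩
    rw [P.inj_apply hi, P.inj_apply hi, P.inj_apply hi]
    exact hp i
  · filter_upwards [hη] with t ⟨w, w1, w2, w3, w4⟩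
    refine ⟨P.memLp_inj _ 1, P.memLp_inj _ 1, P.injK w,
      (P.measurable_injK w).aestronglyMeasurable, ?_, ?_, ?_, ?_⟩
    · filter_upwards [hpair] with p ⟨i, j, hi, hj⟩
      rw [P.injK_apply hi hj]
      exact w1 i j
    · filter_upwards [hpair] with p ⟨i, j, hi, hj⟩
      rw [P.injK_apply hi hj, P.injK_apply hj hi]
      exact w2 i j
    · filter_upwards [hpair] with p ⟨i, j, hi, hj⟩
      rw [P.injK_apply hi hj, P.inj_apply hi, P.inj_apply hj]
      exact w3 i j
    · filter_upwards [P.ae_exists_mem_cell] with x ⟨i, hi⟩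
      -- For `x` in a fixed cell the integrand is constant in `y` on each cell, so the integral is
      -- the sum weighted by cell volumes that defines the discrete operator.
      have e : ∫ y, P.injK A x y * P.injK w x y ∂(μΩ d) =
          ∫ y, P.inj (fun j => A i j * w i j) y ∂(μΩ d) := by
        refine integral_congr_ae ?_
        filter_upwards [P.ae_exists_mem_cell] with y ⟨j, hj⟩
        rw [P.injK_apply hi hj, P.injK_apply hi hj, P.inj_apply hj]
      rw [P.inj_apply hi, w4 i, e, P.integral_inj]
      simp_rw [mul_assoc]

/-- The counting measure on the cells, weighted by their volumes. -/
noncomputable def cellMeasure : Measure (Idx d n) :=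
  Measure.sum fun i => ENNReal.ofReal (P.vol i) • Measure.dirac i

theorem cellMeasure_singleton (i : Idx d n) : P.cellMeasure {i} = ENNReal.ofReal (P.vol i) := by
  rw [cellMeasure, Measure.sum_apply _ (measurableSet_singleton i), tsum_fintype,
    Finset.sum_eq_single i]
  · simp
  · intro j _ hj
    simp [hj]
  · simp

instance : IsFiniteMeasure P.cellMeasure := by
  refine ⟨?_⟩
  rw [cellMeasure, Measure.sum_apply _ MeasurableSet.univ, tsum_fintype]
  simp

/-- Every cell has positive volume, so the almost everywhere conclusions of the abstract theory hold
for all indices. -/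
theorem ae_cellMeasure_iff {p : Idx d n → Prop} : (∀ᵐ i ∂P.cellMeasure, p i) ↔ ∀ i, p i := by
  refine ⟨fun h i => ?_, fun h => Eventually.of_forall h⟩
  by_contra hi
  have h1 : P.cellMeasure {i} = 0 := measure_mono_null (by simpa using hi) h
  rw [cellMeasure_singleton, ENNReal.ofReal_eq_zero] at h1
  exact absurd h1 (not_le.2 (P.vol_pos i))

theorem integral_cellMeasure (c : Idx d n → ℝ) :
    ∫ i, c i ∂P.cellMeasure = ∑ i, P.vol i * c i := by
  rw [integral_fintype Integrable.of_finite]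
  refine Finset.sum_congr rfl fun i _ => ?_
  rw [Measure.real, cellMeasure_singleton, ENNReal.toReal_ofReal (P.vol_pos i).le, smul_eq_mul]

/-- The discrete 1-Laplacian is the abstract operator on the finite space of cells weighted by
volume, so `exists_inLap` applies directly. -/
theorem exists_isSemidiscreteSolution (hT : 0 < T) {A : Idx d n → Idx d n → ℝ}
    (h0 : ∀ i j, 0 ≤ A i j) (hs : ∀ i j, A i j = A j i) {F : ℝ → Idx d n → ℝ}
    (hF : ∀ i, Integrable (fun t => F t i) (μT T)) (b₀ : Idx d n → ℝ) :
    ∃ b, P.IsSemidiscreteSolution A F b₀ T b := by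
  set μ := P.cellMeasure with hμ
  set C : ℝ := ∑ i, ∑ j, |A i j| with hC
  have hAC : ∀ i j, |A i j| ≤ C := fun i j =>
    (Finset.single_le_sum (f := fun j => |A i j|) (fun _ _ => abs_nonneg _)
      (Finset.mem_univ j)).trans (Finset.single_le_sum (f := fun i => ∑ j, |A i j|)
        (fun _ _ => Finset.sum_nonneg fun _ _ => abs_nonneg _) (Finset.mem_univ i))
  have hK : Ker μ A (ENNReal.ofReal C * μ univ).toReal := by
    refine ⟨Measurable.of_discrete, h0, hs, Eventually.of_forall fun i => ?_,
      MemLp.of_bound Measurable.of_discrete.aestronglyMeasurable C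
        (Eventually.of_forall fun p => hAC _ _)⟩
    rw [ENNReal.ofReal_toReal (by finiteness), ← lintegral_const]
    refine lintegral_mono fun j => ?_
    rw [Real.enorm_eq_ofReal_abs]
    exact ENNReal.ofReal_le_ofReal (hAC i j)
  set G : ℝ → Idx d n → ℝ := fun t i => (hF i).1.mk _ t with hG
  have hFG : ∀ᵐ t ∂(μT T), ∀ i, F t i = G t i := ae_all_iff.2 fun i => (hF i).1.ae_eq_mk
  have hGi : ∀ i, Integrable (fun t => G t i) (μT T) := fun i => (hF i).congr (hF i).1.ae_eq_mk
  have hGl : L12 (μT T) μ G := by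
    refine ⟨measurable_from_prod_countable_left fun i =>
      (hF i).1.stronglyMeasurable_mk.measurable, ?_⟩
    refine lintegral_eLpNorm_lt_top_of_bound (c := fun t => ∑ i, |G t i|)
      (integrable_finsetSum _ fun i _ => (hGi i).abs) (fun t i => ?_) 2
    exact Finset.single_le_sum (f := fun i => |G t i|) (fun _ _ => abs_nonneg _) (Finset.mem_univ i)
  obtain ⟨η, hη, hin⟩ := exists_inLap hT hK ENNReal.toReal_nonneg hGl
    (Measurable.of_discrete (f := b₀)) (MemLp.of_discrete)
  have hV := hGl.sub hη
  refine ⟨fun t i => b₀ i + cum (μT T) (fun s y => G s y - η s y) t i, ?_,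
    fun t i => G t i - η t i, η, P.ae_cellMeasure_iff.1 hV.ae_integrable, fun t ht i => ?_, ?_, ?_⟩
  · ext i
    exact (congrArg (b₀ i + ·) (cum_zero_eq _ i)).trans (add_zero _)
  · simp only [intervalIntegral_eq_setIntegral_Iic ht]
    rw [cum_zero_eq, add_zero]
    rfl
  · filter_upwards [hFG] with t ht i
    rw [ht i]
    ring
  · filter_upwards [hin] with t ⟨w, _, w1, w2, w3, w4⟩
    have hall : ∀ {p : Idx d n × Idx d n → Prop}, (∀ᵐ q ∂(μ.prod μ), p q) → ∀ i j, p (i, j) :=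
      fun h i => P.ae_cellMeasure_iff.1 (P.ae_cellMeasure_iff.1 (Measure.ae_ae_of_ae_prod h) i)
    refine ⟨w, hall w1, hall w2, hall w3, fun i => ?_⟩
    rw [P.ae_cellMeasure_iff.1 w4 i, P.integral_cellMeasure]
    simp_rw [mul_assoc]

end Mesh

/-! ### Approximation by cell averages -/

section Average

/-- The mean `a` is the best constant in `L²`: the difference of the two sides is `ν(E) (a - c)²`.
The zero measure is separated because of the inverse of its mass. -/
theorem lintegral_sub_average_sq_le {E : Type*} [MeasurableSpace E] {ν : Measure E}
    [IsFiniteMeasure ν] {u : E → ℝ} (hu : MemLp u 2 ν) (c : ℝ) :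
    ∫⁻ x, ‖(ν.real univ)⁻¹ * (∫ y, u y ∂ν) - u x‖ₑ ^ 2 ∂ν ≤ ∫⁻ x, ‖u x - c‖ₑ ^ 2 ∂ν := by
  rcases eq_or_ne (ν.real univ) 0 with h0 | h0
  · have : ν = 0 := by
      rw [Measure.real, ENNReal.toReal_eq_zero_iff] at h0
      exact Measure.measure_univ_eq_zero.1 (h0.resolve_right (measure_ne_top _ _))
    simp [this]
  set a := (ν.real univ)⁻¹ * (∫ y, u y ∂ν) with ha
  have hav : ∫ y, u y ∂ν = ν.real univ * a := by rw [ha]; field_simp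
  have hi : Integrable u ν := hu.integrable one_le_two
  have h1 : Integrable (fun x => (a - u x) ^ 2) ν := ((memLp_const a).sub hu).integrable_sq
  have h2 : Integrable (fun x => (u x - c) ^ 2) ν := (hu.sub (memLp_const c)).integrable_sq
  have e : ∀ r : ℝ, ‖r‖ₑ ^ 2 = ENNReal.ofReal (r ^ 2) := fun r => by
    rw [Real.enorm_eq_ofReal_abs, ← ENNReal.ofReal_pow (abs_nonneg r), sq_abs]
  simp_rw [e]
  rw [← ofReal_integral_eq_lintegral_ofReal h1 (Eventually.of_forall fun _ => sq_nonneg _),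
    ← ofReal_integral_eq_lintegral_ofReal h2 (Eventually.of_forall fun _ => sq_nonneg _)]
  refine ENNReal.ofReal_le_ofReal (sub_nonneg.1 ?_)
  rw [← integral_sub h2 h1]
  have h3 : ∫ x, ((u x - c) ^ 2 - (a - u x) ^ 2) ∂ν = ν.real univ * (a - c) ^ 2 := by
    have : ∀ x, (u x - c) ^ 2 - (a - u x) ^ 2 = 2 * (a - c) * u x - (a - c) * (a + c) :=
      fun x => by ring
    simp_rw [this]
    rw [integral_sub (hi.const_mul _) (integrable_const _), integral_const_mul, hav,
      integral_const, smul_eq_mul]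
    ring
  rw [h3]
  positivity

variable {E : Type*} [AddCommGroup E] [MeasureSpace E] [MeasurableAdd₂ E]
  [SFinite (volume : Measure E)] [(volume : Measure E).IsAddLeftInvariant] {ι : Type*} [Fintype ι]
  {A Q : ι → Set E} {S Z : Set E} {u v : E → ℝ} {c B : ℝ≥0∞}

/-- Translation by `x` turns the pair `(x, z)` into a point and a difference lying in `Z`. The sets
`A i` are disjoint, so summing over `i` costs nothing, and Tonelli leaves for each shift the squared
increment of `u` over `S`. -/
theorem sum_lintegral_lintegral_le (hA : ∀ i, MeasurableSet (A i)) (hQ : ∀ i, MeasurableSet (Q i))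
    (hS : MeasurableSet S) (hAS : ∀ i, A i ⊆ S) (hQS : ∀ i, Q i ⊆ S)
    (hd : Pairwise (Function.onFun Disjoint A)) (hAQ : ∀ i, ∀ x ∈ A i, ∀ z, x + z ∈ Q i → z ∈ Z)
    (hZ : MeasurableSet Z) (hu : Measurable u)
    (hB : ∀ z ∈ Z, ∫⁻ x in {x | x ∈ S ∧ x + z ∈ S}, ‖u (x + z) - u x‖ₑ ^ 2 ≤ B) :
    ∑ i, ∫⁻ z in Q i, ∫⁻ x in A i, ‖u z - u x‖ₑ ^ 2 ≤ volume Z * B := by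
  have hm : Measurable fun p : E × E => ‖u p.1 - u p.2‖ₑ ^ 2 :=
    ((hu.comp measurable_fst).sub (hu.comp measurable_snd)).enorm.pow_const _
  have hT : MeasurableSet {p : E × E | p.1 + p.2 ∈ S} := (measurable_fst.add measurable_snd) hS
  set H : E → E → ℝ≥0∞ := fun x z =>
    {p : E × E | p.1 + p.2 ∈ S}.indicator (fun p => ‖u (p.1 + p.2) - u p.1‖ₑ ^ 2) (x, z) with hH
  have hHm : Measurable (Function.uncurry H) :=
    (((hu.comp (measurable_fst.add measurable_snd)).sub
      (hu.comp measurable_fst)).enorm.pow_const 2).indicator hT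
  have h1 : ∀ i, ∫⁻ z in Q i, ∫⁻ x in A i, ‖u z - u x‖ₑ ^ 2 ≤
      ∫⁻ x in A i, ∫⁻ z in Z, H x z := by
    intro i
    rw [lintegral_lintegral_swap hm.aemeasurable]
    refine setLIntegral_mono' (hA i) fun x hx => ?_
    rw [← lintegral_indicator (hQ i), ← lintegral_indicator hZ,
      ← lintegral_add_left_eq_self _ x]
    refine lintegral_mono fun z => ?_
    by_cases hz : x + z ∈ Q i
    · have hzS : (x, z) ∈ {p : E × E | p.1 + p.2 ∈ S} := hQS i hz
      rw [indicator_of_mem hz, indicator_of_mem (hAQ i x hx z hz), hH]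
      simp only
      rw [indicator_of_mem hzS]
    · rw [indicator_of_notMem hz]
      exact zero_le
  calc ∑ i, ∫⁻ z in Q i, ∫⁻ x in A i, ‖u z - u x‖ₑ ^ 2
      ≤ ∑ i, ∫⁻ x in A i, ∫⁻ z in Z, H x z := Finset.sum_le_sum fun i _ => h1 i
    _ = ∫⁻ x in ⋃ i, A i, ∫⁻ z in Z, H x z := by
        rw [lintegral_iUnion hA hd, tsum_fintype]
    _ ≤ ∫⁻ x in S, ∫⁻ z in Z, H x z := lintegral_mono_set (iUnion_subset hAS)
    _ = ∫⁻ z in Z, ∫⁻ x in S, H x z := lintegral_lintegral_swap hHm.aemeasurable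
    _ ≤ ∫⁻ _ in Z, B := by
        refine setLIntegral_mono' hZ fun z hz => (le_of_eq ?_).trans (hB z hz)
        have hzS : MeasurableSet {x | x + z ∈ S} := (measurable_id.add_const z) hS
        rw [show {x | x ∈ S ∧ x + z ∈ S} = {x | x + z ∈ S} ∩ S from by
          ext x; exact and_comm, ← Measure.restrict_restrict hzS, ← lintegral_indicator hzS]
        rfl
    _ = volume Z * B := by rw [setLIntegral_const, mul_comm]

/-- On `A i` the average beats each constant `u z` with `z ∈ Q i`; this is averaged over `z`. Taking
`Q i` instead of `A i` is what tolerates thin or small cells: only the ratio of the volumes of `Z`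
and `Q i` enters. -/
theorem lintegral_sub_sq_le_of_average (hA : ∀ i, MeasurableSet (A i))
    (hQ : ∀ i, MeasurableSet (Q i))
    (hS : MeasurableSet S) (hAS : ∀ i, A i ⊆ S) (hQS : ∀ i, Q i ⊆ S)
    (hcov : ∀ᵐ x ∂volume.restrict S, ∃ i, x ∈ A i) (hfin : volume S ≠ ∞)
    (hd : Pairwise (Function.onFun Disjoint A)) (hAQ : ∀ i, ∀ x ∈ A i, ∀ z, x + z ∈ Q i → z ∈ Z)
    (hZ : MeasurableSet Z) (hZ0 : volume Z ≠ 0) (hZt : volume Z ≠ ∞)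
    (hc : ∀ i, volume Z ≤ c * volume (Q i)) (hu : Measurable u)
    (hu2 : MemLp u 2 (volume.restrict S))
    (hv : ∀ i, ∀ x ∈ A i, v x = (volume.real (A i))⁻¹ * ∫ y in A i, u y)
    (hB : ∀ z ∈ Z, ∫⁻ x in {x | x ∈ S ∧ x + z ∈ S}, ‖u (x + z) - u x‖ₑ ^ 2 ≤ B) :
    ∫⁻ x in S, ‖v x - u x‖ₑ ^ 2 ≤ c * B := by
  have h1 : ∀ i, volume Z * ∫⁻ x in A i, ‖v x - u x‖ₑ ^ 2 ≤
      c * ∫⁻ z in Q i, ∫⁻ x in A i, ‖u z - u x‖ₑ ^ 2 := by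
    intro i
    have : IsFiniteMeasure (volume.restrict (A i)) :=
      ⟨by rw [Measure.restrict_apply_univ]; exact (measure_mono (hAS i)).trans_lt hfin.lt_top⟩
    refine (mul_le_mul_left (hc i) _).trans ?_
    rw [mul_assoc]
    refine mul_le_mul_right ?_ c
    rw [mul_comm, ← setLIntegral_const]
    refine lintegral_mono fun z => ?_
    have h2 := lintegral_sub_average_sq_le (hu2.mono_measure (Measure.restrict_mono_set _ (hAS i)))
      (u z)
    rw [measureReal_restrict_apply_univ] at h2
    calc ∫⁻ x in A i, ‖v x - u x‖ₑ ^ 2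
        = ∫⁻ x in A i, ‖(volume.real (A i))⁻¹ * (∫ y in A i, u y) - u x‖ₑ ^ 2 :=
          setLIntegral_congr_fun (hA i) fun x hx => by rw [hv i x hx]
      _ ≤ ∫⁻ x in A i, ‖u x - u z‖ₑ ^ 2 := h2
      _ = ∫⁻ x in A i, ‖u z - u x‖ₑ ^ 2 :=
          lintegral_congr fun x => by rw [← enorm_neg, neg_sub]
  have h2 : volume Z * ∑ i, ∫⁻ x in A i, ‖v x - u x‖ₑ ^ 2 ≤ volume Z * (c * B) := by
    rw [Finset.mul_sum]
    refine (Finset.sum_le_sum fun i _ => h1 i).trans ?_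
    rw [← Finset.mul_sum, mul_left_comm]
    exact mul_le_mul_right (sum_lintegral_lintegral_le hA hQ hS hAS hQS hd hAQ hZ hu hB) c
  have h3 : ∫⁻ x in S, ‖v x - u x‖ₑ ^ 2 ≤ ∑ i, ∫⁻ x in A i, ‖v x - u x‖ₑ ^ 2 := by
    rw [← tsum_fintype (L := .unconditional _), ← lintegral_iUnion hA hd]
    refine lintegral_mono' (Measure.restrict_mono_ae ?_) le_rfl
    filter_upwards [(ae_restrict_iff' hS).1 hcov] with x hx hxS
    exact mem_iUnion.2 (hx hxS)
  exact h3.trans ((ENNReal.mul_le_mul_iff_right hZ0 hZt).1 h2)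

/-- The `L²` distance between a function and its cell averages is controlled by its modulus of
smoothness, if each cell `A i` is matched with a comparison set `Q i` of volume comparable to that
of a set `Z` containing all differences between points of `Q i` and `A i`. -/
theorem eLpNorm_sub_le_modulus (hA : ∀ i, MeasurableSet (A i))
    (hQ : ∀ i, MeasurableSet (Q i))
    (hS : MeasurableSet S) (hAS : ∀ i, A i ⊆ S) (hQS : ∀ i, Q i ⊆ S)
    (hcov : ∀ᵐ x ∂volume.restrict S, ∃ i, x ∈ A i) (hfin : volume S ≠ ∞)
    (hd : Pairwise (Function.onFun Disjoint A)) (hAQ : ∀ i, ∀ x ∈ A i, ∀ z, x + z ∈ Q i → z ∈ Z)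
    (hZ : MeasurableSet Z) (hZ0 : volume Z ≠ 0) (hZt : volume Z ≠ ∞) (hc1 : 1 ≤ c)
    (hc : ∀ i, volume Z ≤ c * volume (Q i)) (hu : MemLp u 2 (volume.restrict S))
    (hv : ∀ i, ∀ x ∈ A i, v x = (volume.real (A i))⁻¹ * ∫ y in A i, u y)
    {len : E → ℝ} {h : ℝ} (hlen : ∀ z ∈ Z, len z < h) :
    eLpNorm (fun x => v x - u x) 2 (volume.restrict S) ≤ c * modulus len S u h := by
  -- A measurable representative is needed for Tonelli. Translation preserves null sets, so the
  -- increments are unaffected almost everywhere.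
  set U := hu.1.mk u with hU
  have huU : u =ᵐ[volume.restrict S] U := hu.1.ae_eq_mk
  have huU' := (ae_restrict_iff' hS).1 huU
  have hmain : ∫⁻ x in S, ‖v x - U x‖ₑ ^ 2 ≤ c * modulus len S u h ^ 2 := by
    refine lintegral_sub_sq_le_of_average hA hQ hS hAS hQS hcov hfin hd hAQ hZ hZ0 hZt hc
      hu.1.stronglyMeasurable_mk.measurable ((memLp_congr_ae huU).1 hu) (fun i x hx => ?_)
      fun z hz => ?_
    · rw [hv i x hx, integral_congr_ae (ae_restrict_of_ae_restrict_of_subset (hAS i) huU)]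
    · have hzS : MeasurableSet {x | x ∈ S ∧ x + z ∈ S} := hS.inter ((measurable_id.add_const z) hS)
      have hle : eLpNorm (fun x => u (x + z) - u x) 2 (volume.restrict {x | x ∈ S ∧ x + z ∈ S}) ≤
          modulus len S u h :=
        le_iSup₂ (f := fun z (_ : len z < h) => eLpNorm (fun x => u (x + z) - u x) 2
          (volume.restrict {x | x ∈ S ∧ x + z ∈ S})) z (hlen z hz)
      refine (le_of_eq ?_).trans (eLpNorm_two_le_iff.1 hle)
      refine lintegral_congr_ae ((ae_restrict_iff' hzS).2 ?_)
      filter_upwards [huU', (measurePreserving_add_right volume z).quasiMeasurePreserving.ae huU']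
        with x h1 h2 hx
      rw [h1 hx.1, h2 hx.2]
  rw [eLpNorm_two_le_iff, mul_pow]
  calc ∫⁻ x in S, ‖v x - u x‖ₑ ^ 2 = ∫⁻ x in S, ‖v x - U x‖ₑ ^ 2 :=
        lintegral_congr_ae (huU.mono fun x hx => by simp only [hx])
    _ ≤ c * modulus len S u h ^ 2 := hmain
    -- The sharp factor would be `√c`; since `c ≥ 1`, it is weakened to `c`.
    _ ≤ c ^ 2 * modulus len S u h ^ 2 := mul_le_mul_left (le_self_pow₀ hc1 two_ne_zero) _

end Average

theorem modulus_le_lipSemi {E : Type*} [AddCommGroup E] [MeasureSpace E] (len : E → ℝ) (S : Set E) (s : ℝ) (u : E → ℝ)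
    {h : ℝ} (hh : 0 < h) :
    modulus len S u h ≤ ENNReal.ofReal (h ^ s) * lipSemi len S s u := by
  have h1 : ENNReal.ofReal (h ^ (-s)) * modulus len S u h ≤ lipSemi len S s u :=
    le_iSup₂ (f := fun h (_ : 0 < h) => ENNReal.ofReal (h ^ (-s)) * modulus len S u h) h hh
  calc modulus len S u h
      = ENNReal.ofReal (h ^ s) * (ENNReal.ofReal (h ^ (-s)) * modulus len S u h) := by
        rw [← mul_assoc, ← ENNReal.ofReal_mul (by positivity), ← Real.rpow_add hh,
          add_neg_cancel, Real.rpow_zero, ENNReal.ofReal_one, one_mul]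
    _ ≤ _ := mul_le_mul_right h1 _

/-! ### The projection error on a mesh -/

namespace Mesh

variable {d n : ℕ}

theorem pos_of_one_le (P : Mesh d n) (hd : 1 ≤ d) : 0 < n := by
  rcases Nat.eq_zero_or_pos n with rfl | h
  · have h0 := P.node_zero ⟨0, hd⟩
    have h1 := P.node_last ⟨0, hd⟩
    rw [Fin.last_zero] at h1
    exact absurd (h0.symm.trans h1) zero_ne_one
  · exact h

variable (P : Mesh d n)

theorem sub_le_size (k : Fin d) (j : Fin n) :
    P.node k j.succ - P.node k j.castSucc ≤ P.size :=
  (le_ciSup (f := fun j : Fin n => P.node k j.succ - P.node k j.castSucc)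
    (finite_range _).bddAbove j).trans
    (le_ciSup (f := fun k : Fin d => ⨆ j : Fin n, (P.node k j.succ - P.node k j.castSucc))
      (finite_range _).bddAbove k)

theorem size_pos (hd : 1 ≤ d) : 0 < P.size :=
  (sub_pos.2 (P.node_castSucc_lt_succ ⟨0, hd⟩ ⟨0, P.pos_of_one_le hd⟩)).trans_le
    (P.sub_le_size _ _)

theorem size_le_one (hd : 1 ≤ d) : P.size ≤ 1 := by
  have : Nonempty (Fin d) := ⟨⟨0, hd⟩⟩
  have : Nonempty (Fin n) := ⟨⟨0, P.pos_of_one_le hd⟩⟩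
  refine ciSup_le fun k => ciSup_le fun j => ?_
  linarith [P.node_le_one k j.succ, P.node_nonneg k j.castSucc]

/-- A cube of side `P.size` in `[0,1]^d` containing the cell `i`. -/
noncomputable def cube (i : Idx d n) : Set (Pt d) :=
  univ.pi fun k => Icc (min (P.node k (i k).castSucc) (1 - P.size))
    (min (P.node k (i k).castSucc) (1 - P.size) + P.size)

/-- The cube `[-δ, δ]^d`, where `δ` is the mesh size. -/
noncomputable def diffCube : Set (Pt d) := univ.pi fun _ => Icc (-P.size) P.size

theorem measurableSet_cube (i : Idx d n) : MeasurableSet (P.cube i) :=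
  MeasurableSet.univ_pi fun _ => measurableSet_Icc

theorem measurableSet_diffCube : MeasurableSet P.diffCube :=
  MeasurableSet.univ_pi fun _ => measurableSet_Icc

theorem volume_cube (i : Idx d n) : volume (P.cube i) = ENNReal.ofReal P.size ^ d := by
  rw [cube, volume_pi_pi]
  simp

theorem volume_diffCube : volume P.diffCube = 2 ^ d * ENNReal.ofReal P.size ^ d := by
  rw [diffCube, volume_pi_pi, ← mul_pow]
  simp only [Real.volume_Icc, Finset.prod_const, Finset.card_univ, Fintype.card_fin]
  rw [sub_neg_eq_add, ← two_mul, ENNReal.ofReal_mul zero_le_two, ENNReal.ofReal_ofNat]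

theorem cube_subset_dom (hd : 1 ≤ d) (i : Idx d n) : P.cube i ⊆ dom d := fun x hx => by
  have h1 := P.size_le_one hd
  refine ⟨fun k => ?_, fun k => ?_⟩
  · exact (le_min (P.node_nonneg k _) (sub_nonneg.2 h1)).trans (hx k (mem_univ k)).1
  · have := (hx k (mem_univ k)).2
    have h2 := min_le_right (P.node k (i k).castSucc) (1 - P.size)
    simp only [Pi.one_apply]
    linarith

theorem mem_diffCube {i : Idx d n} {x z : Pt d} (hx : x ∈ P.cell i) (hz : x + z ∈ P.cube i) :
    z ∈ P.diffCube := fun k _ => by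
  have h1 := hx k (mem_univ k)
  have h2 := hz k (mem_univ k)
  have h3 := P.sub_le_size k (i k)
  have h4 := P.node_le_one k (i k).succ
  have h5 := min_le_left (P.node k (i k).castSucc) (1 - P.size)
  -- The cube starts at the lower corner of the cell, pushed back where it would leave `[0,1]^d`. In
  -- both cases its lower end is within `δ` of `x`, because `x` is at most the upper node and at
  -- most 1.
  have h6 : x k - P.size ≤ min (P.node k (i k).castSucc) (1 - P.size) :=
    le_min (by linarith [h1.2]) (by linarith [h1.2])
  rw [Pi.add_apply] at h2
  exact ⟨by linarith [h2.1], by linarith [h2.2, h1.1]⟩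

theorem sum_sq_le_of_mem_diffCube {z : Pt d} (hz : z ∈ P.diffCube) :
    ∑ k, z k ^ 2 ≤ d * P.size ^ 2 := by
  refine (Finset.sum_le_sum (g := fun _ => P.size ^ 2) fun k _ => ?_).trans_eq (by simp)
  exact sq_le_sq' (hz k (mem_univ k)).1 (hz k (mem_univ k)).2

theorem pairwise_disjoint_cell : Pairwise (Function.onFun Disjoint P.cell) := fun _ _ hij =>
  disjoint_left.2 fun _ hi hj => hij (P.eq_of_mem_cell hi hj)

theorem eLpNorm_inj_proj_sub_le (hd : 1 ≤ d) {s : ℝ} {g : Pt d → ℝ} (hg : MemLp g 2 (μΩ d)) :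
    eLpNorm (fun x => P.inj (P.proj g) x - g x) 2 (μΩ d) ≤
      ENNReal.ofReal (2 ^ d * (d + 1) ^ s) * lipΩ s g * ENNReal.ofReal (P.size ^ s) := by
  have hδ := P.size_pos hd
  have h0 : volume P.diffCube ≠ 0 := by
    rw [volume_diffCube]
    simp [hδ]
  have ht : volume P.diffCube ≠ ∞ := by
    rw [volume_diffCube]
    finiteness
  -- `2 ^ d` is the volume ratio of `[-δ, δ]^d` to a cube of side `δ`. Differences have length at
  -- most `√d δ`, and `(d + 1) δ` is strictly larger, as the modulus demands.
  refine (eLpNorm_sub_le_modulus (c := 2 ^ d) (h := (d + 1) * P.size) (len := len)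
    P.measurableSet_cell P.measurableSet_cube measurableSet_Icc P.cell_subset_dom
    (P.cube_subset_dom hd) P.ae_exists_mem_cell isCompact_Icc.measure_ne_top
    P.pairwise_disjoint_cell (fun i x hx z hz => P.mem_diffCube hx hz) P.measurableSet_diffCube
    h0 ht (one_le_pow₀ one_le_two) (fun i => by rw [volume_diffCube, volume_cube]) hg
    (fun i x hx => P.inj_apply hx _) fun z hz => ?_).trans ?_
  · refine (Real.sqrt_lt' (by positivity)).2 ((P.sum_sq_le_of_mem_diffCube hz).trans_lt ?_)
    rw [mul_pow]
    have : (0 : ℝ) ≤ d := Nat.cast_nonneg d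
    exact mul_lt_mul_of_pos_right (by nlinarith) (by positivity)
  · refine (mul_le_mul_right (modulus_le_lipSemi len (dom d) s g (by positivity)) _).trans_eq ?_
    rw [Real.mul_rpow (by positivity) hδ.le, ENNReal.ofReal_mul (by positivity),
      ENNReal.ofReal_mul (by positivity), ENNReal.ofReal_pow zero_le_two, ENNReal.ofReal_ofNat,
      lipΩ]
    ring

theorem eLpNorm_injK_projK_sub_le (hd : 1 ≤ d) {s : ℝ} {K : Pt d → Pt d → ℝ}
    (hK : MemLp (Function.uncurry K) 2 ((μΩ d).prod (μΩ d))) :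
    normTwoSq (fun x y => P.injK (P.projK K) x y - K x y) ≤
      ENNReal.ofReal (4 ^ d * (2 * d + 1) ^ s) * lipΩΩ s K * ENNReal.ofReal (P.size ^ s) := by
  have hδ := P.size_pos hd
  have hμ : (μΩ d).prod (μΩ d) = volume.restrict (dom d ×ˢ dom d) :=
    Measure.prod_restrict _ _
  have hvol : ∀ s t : Set (Pt d), volume (s ×ˢ t) = volume s * volume t :=
    fun s t => Measure.prod_prod s t
  have h0 : volume (P.diffCube ×ˢ P.diffCube) ≠ 0 := by
    rw [hvol, volume_diffCube]
    simp [hδ]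
  have ht : volume (P.diffCube ×ˢ P.diffCube) ≠ ∞ := by
    rw [hvol, volume_diffCube]
    finiteness
  have hcov : ∀ᵐ p ∂volume.restrict (dom d ×ˢ dom d),
      ∃ q : Idx d n × Idx d n, p ∈ P.cell q.1 ×ˢ P.cell q.2 := by
    rw [← hμ]
    filter_upwards [Measure.quasiMeasurePreserving_fst.ae P.ae_exists_mem_cell,
      Measure.quasiMeasurePreserving_snd.ae P.ae_exists_mem_cell] with p ⟨i, hi⟩ ⟨j, hj⟩
    exact ⟨(i, j), hi, hj⟩
  have : (volume : Measure (Pt d × Pt d)).IsAddLeftInvariant :=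
    inferInstanceAs ((volume : Measure (Pt d)).prod volume).IsAddLeftInvariant
  rw [normTwoSq]
  rw [hμ] at hK ⊢
  -- The same comparison in dimension `2d`: volume ratio `(2 ^ d)²`, and differences of length at
  -- most `√(2d) δ < (2d + 1) δ`.
  refine (eLpNorm_sub_le_modulus (c := 4 ^ d) (h := (2 * d + 1) * P.size) (len := lenTwo)
    (A := fun q : Idx d n × Idx d n => P.cell q.1 ×ˢ P.cell q.2)
    (Q := fun q : Idx d n × Idx d n => P.cube q.1 ×ˢ P.cube q.2)
    (Z := P.diffCube ×ˢ P.diffCube)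
    (v := Function.uncurry (P.injK (P.projK K))) (u := Function.uncurry K)
    (fun q => (P.measurableSet_cell _).prod (P.measurableSet_cell _))
    (fun q => (P.measurableSet_cube _).prod (P.measurableSet_cube _))
    (measurableSet_Icc.prod measurableSet_Icc)
    (fun q => prod_mono (P.cell_subset_dom _) (P.cell_subset_dom _))
    (fun q => prod_mono (P.cube_subset_dom hd _) (P.cube_subset_dom hd _)) hcov
    (isCompact_Icc.prod isCompact_Icc).measure_ne_top
    (fun q r hqr => disjoint_left.2 fun p hp hp' => hqr (Prod.ext
      (P.eq_of_mem_cell hp.1 hp'.1) (P.eq_of_mem_cell hp.2 hp'.2)))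
    (fun q x hx z hz => ⟨P.mem_diffCube hx.1 hz.1, P.mem_diffCube hx.2 hz.2⟩)
    (P.measurableSet_diffCube.prod P.measurableSet_diffCube)
    h0 ht (one_le_pow₀ (by norm_num)) (fun q => ?_) hK
    (fun q x hx => ?_) fun z hz => ?_).trans ?_
  · simp only [hvol, volume_diffCube, volume_cube]
    rw [show (4 : ℝ≥0∞) = 2 * 2 by norm_num, mul_pow]
    exact le_of_eq (by ring)
  · refine (P.injK_apply hx.1 hx.2 _).trans ?_
    rw [projK, vol, vol, ← measureReal_prod_prod]
    rfl
  · refine (Real.sqrt_lt' (by positivity)).2 ((add_le_add (P.sum_sq_le_of_mem_diffCube hz.1)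
      (P.sum_sq_le_of_mem_diffCube hz.2)).trans_lt ?_)
    rw [mul_pow, ← add_mul]
    have : (0 : ℝ) ≤ d := Nat.cast_nonneg d
    exact mul_lt_mul_of_pos_right (by nlinarith) (by positivity)
  · refine (mul_le_mul_right (modulus_le_lipSemi lenTwo (dom d ×ˢ dom d) s (Function.uncurry K)
      (by positivity)) _).trans_eq ?_
    rw [Real.mul_rpow (by positivity) hδ.le, ENNReal.ofReal_mul (by positivity),
      ENNReal.ofReal_mul (by positivity), ENNReal.ofReal_pow (by norm_num), ENNReal.ofReal_ofNat,
      lipΩΩ]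
    ring

end Mesh

theorem MemL1L.ae_memLp {d : ℕ} {T : ℝ} {f : ℝ → Pt d → ℝ} (hf : MemL1L 2 T f) :
    ∀ᵐ t ∂(μT T), MemLp (f t) 2 (μΩ d) := by
  obtain ⟨F, hF, hfF⟩ := MemL1L.exists_l12 hf.1 hf.2
  filter_upwards [Measure.ae_ae_of_ae_prod hfF, ae_lt_top (measurable_eLpNorm_two hF.meas)
    hF.fin.ne] with t h1 h2
  exact (memLp_congr_ae h1).2 ⟨hF.meas.of_uncurry_left.aestronglyMeasurable, h2⟩

theorem Mesh.normL1L_inj_proj_sub_le {d n : ℕ} (P : Mesh d n) (hd : 1 ≤ d) {s T : ℝ}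
    {f : ℝ → Pt d → ℝ} (hf : MemL1L 2 T f) :
    normL1L 2 T (fun t x => P.inj (P.proj (f t)) x - f t x) ≤
      ENNReal.ofReal (2 ^ d * (d + 1) ^ s) * (∫⁻ t, lipΩ s (f t) ∂(μT T)) *
        ENNReal.ofReal (P.size ^ s) := by
  rw [← lintegral_const_mul' _ _ ENNReal.ofReal_ne_top,
    ← lintegral_mul_const' _ _ ENNReal.ofReal_ne_top]
  exact lintegral_mono_ae (hf.ae_memLp.mono fun t ht => P.eLpNorm_inj_proj_sub_le hd ht)

end NonlocalOneLaplacian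

/-! ### The theorem -/

theorem mainTheorem8 (d : ℕ) (hd : 1 ≤ d) :
    (∀ (K : Pt d → Pt d → ℝ) (f : ℝ → Pt d → ℝ) (g : Pt d → ℝ) (T : ℝ), Data d K f g T →
      -- (i) well-posedness of the continuous problem
      (∃ u, IsSolution K f g T u) ∧
      (∀ u, IsSolution K f g T u → IsUniqueSolution K f g T u) ∧
      ∀ (n : ℕ) (P : Mesh d n),
        -- (i) the semi-discrete problem has a solution, and the continuum extension of any such
        -- solution is the unique solution for the projected kernel and data
        (∃ b, P.IsSemidiscreteSolution (P.projK K) (fun t => P.proj (f t)) (P.proj g) T b) ∧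
        ∀ b, P.IsSemidiscreteSolution (P.projK K) (fun t => P.proj (f t)) (P.proj g) T b →
          IsUniqueSolution (P.injK (P.projK K)) (fun t => P.inj (P.proj (f t)))
            (P.inj (P.proj g)) T (fun t => P.inj (b t)) ∧
          -- (ii) the error estimate
          ∀ u, IsSolution K f g T u →
            MemCL 2 T u ∧ MemCL 2 T (fun t => P.inj (b t)) ∧
            normCL 2 T (fun t x => P.inj (b t) x - u t x) ≤
              eLpNorm (fun x => P.inj (P.proj g) x - g x) 2 (μΩ d) +
              normL1L 2 T (fun t x => P.inj (P.proj (f t)) x - f t x) +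
              ENNReal.ofReal T * normTwoSq (fun x y => P.injK (P.projK K) x y - K x y)) ∧
    -- (iii) the rate; the constant `C` depends only on `d` and `s`
    (∀ s : ℝ, 0 < s → s ≤ 1 → ∃ C : ℝ, 0 < C ∧
      ∀ (K : Pt d → Pt d → ℝ) (f : ℝ → Pt d → ℝ) (g : Pt d → ℝ) (T : ℝ), Data d K f g T →
        MemLipΩ s g → MemLipΩΩ s K → ∫⁻ t, lipΩ s (f t) ∂(μT T) < ∞ →
        ∀ (n : ℕ) (P : Mesh d n) (u : ℝ → Pt d → ℝ) (b : ℝ → Idx d n → ℝ),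
          IsSolution K f g T u →
          P.IsSemidiscreteSolution (P.projK K) (fun t => P.proj (f t)) (P.proj g) T b →
          normCL 2 T (fun t x => P.inj (b t) x - u t x) ≤
            ENNReal.ofReal C *
              (lipΩ s g + ∫⁻ t, lipΩ s (f t) ∂(μT T) + ENNReal.ofReal T * lipΩΩ s K) *
              ENNReal.ofReal (P.size ^ s) ∧
          normCL 2 T (fun t x => P.inj (b t) x - u t x) ≤
            ENNReal.ofReal C * (lipΩ s g + ∫⁻ t, lipΩ s (f t) ∂(μT T) + lipΩΩ s K) *
              ENNReal.ofReal (1 + T) * ENNReal.ofReal (P.size ^ s)) := by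
  have hsd : ∀ {K : Pt d → Pt d → ℝ} {f : ℝ → Pt d → ℝ} {g : Pt d → ℝ} {T : ℝ}, Data d K f g T →
      ∀ {n : ℕ} (P : Mesh d n) {b : ℝ → Idx d n → ℝ},
      P.IsSemidiscreteSolution (P.projK K) (fun t => P.proj (f t)) (P.proj g) T b →
      ∀ {u : ℝ → Pt d → ℝ}, IsSolution K f g T u →
        normCL 2 T (fun t x => P.inj (b t) x - u t x) ≤
          eLpNorm (fun x => P.inj (P.proj g) x - g x) 2 (μΩ d) +
          normL1L 2 T (fun t x => P.inj (P.proj (f t)) x - f t x) +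
          ENNReal.ofReal T * normTwoSq (fun x y => P.injK (P.projK K) x y - K x y) := by
    intro K f g T h n P b hb u hu
    obtain ⟨M, hM, hK⟩ := h.exists_ker
    -- The error estimate is the stability theorem for two continuum problems, one of them with
    -- projected data.
    exact iSup₂_le ((hb.isSolution_inj P).eLpNorm_sub_le h.pos.le
      (P.ker_injK (P.projK_nonneg h.nonneg) (P.projK_symm h.symm)) hK
      (Finset.sum_nonneg fun _ _ => Finset.sum_nonneg fun _ _ => abs_nonneg _) hM
      (P.memL1L_inj (P.integrable_proj h.memf) 2) h.memf (P.memLp_inj _ 2) h.memg hu)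
  refine ⟨fun K f g T h => ?_, fun s hs0 hs1 => ?_⟩
  · obtain ⟨M, hM, hK⟩ := h.exists_ker
    refine ⟨exists_isSolution h.pos hK hM h.memg h.memf,
      fun u hu => hu.isUniqueSolution h.pos.le hK hM h.memg h.memf, fun n P => ?_⟩
    have hA0 := P.projK_nonneg h.nonneg
    have hAs := P.projK_symm h.symm
    have hKA := P.ker_injK hA0 hAs
    have hMA : 0 ≤ ∑ i, ∑ j, |P.projK K i j| :=
      Finset.sum_nonneg fun _ _ => Finset.sum_nonneg fun _ _ => abs_nonneg _
    have hF := P.memL1L_inj (P.integrable_proj h.memf) 2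
    refine ⟨P.exists_isSemidiscreteSolution h.pos hA0 hAs (P.integrable_proj h.memf) _,
      fun b hb => ?_⟩
    have hbs := hb.isSolution_inj P
    exact ⟨hbs.isUniqueSolution h.pos.le hKA hMA (P.memLp_inj _ 2) hF, fun u hu =>
      ⟨hu.memCL_two hK hM h.memg h.memf, hbs.memCL_two hKA hMA (P.memLp_inj _ 2) hF, hsd h P hb hu⟩⟩
  -- The kernel constant dominates the one for functions, so a single `C` serves all three
  -- projection errors.
  · have hC : (2 : ℝ) ^ d * (d + 1) ^ s ≤ 4 ^ d * (2 * d + 1) ^ s := by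
      gcongr
      · norm_num
      · linarith [(Nat.cast_nonneg d : (0 : ℝ) ≤ d)]
    refine ⟨4 ^ d * (2 * d + 1) ^ s, by positivity, fun K f g T h _ hKl _ n P u b hu hb => ?_⟩
    set C := ENNReal.ofReal (4 ^ d * (2 * d + 1) ^ s)
    have hC' := ENNReal.ofReal_le_ofReal hC
    have h1 : normCL 2 T (fun t x => P.inj (b t) x - u t x) ≤ C *
        (lipΩ s g + ∫⁻ t, lipΩ s (f t) ∂(μT T) + ENNReal.ofReal T * lipΩΩ s K) *
          ENNReal.ofReal (P.size ^ s) := by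
      refine (hsd h P hb hu).trans ?_
      calc _ ≤ C * lipΩ s g * ENNReal.ofReal (P.size ^ s) +
            C * (∫⁻ t, lipΩ s (f t) ∂(μT T)) * ENNReal.ofReal (P.size ^ s) +
            ENNReal.ofReal T * (C * lipΩΩ s K * ENNReal.ofReal (P.size ^ s)) := by
            refine add_le_add (add_le_add
              ((P.eLpNorm_inj_proj_sub_le (s := s) hd h.memg).trans ?_)
              ((P.normL1L_inj_proj_sub_le (s := s) hd h.memf).trans ?_))
              (mul_le_mul_right (P.eLpNorm_injK_projK_sub_le hd hKl.1) _)
            · gcongr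
            · gcongr
        _ = _ := by ring
    refine ⟨h1, h1.trans ?_⟩
    -- The second form of the rate only replaces the weights `1` and `T` by the common factor `1 +
    -- T`.
    have h2 : (1 : ℝ≥0∞) ≤ ENNReal.ofReal (1 + T) :=
      ENNReal.one_le_ofReal.2 (by linarith [h.pos])
    have h3 : ENNReal.ofReal T ≤ ENNReal.ofReal (1 + T) :=
      ENNReal.ofReal_le_ofReal (by linarith)
    refine mul_le_mul_left ?_ _
    rw [mul_assoc]
    refine mul_le_mul_right ?_ _
    rw [add_mul, mul_comm (ENNReal.ofReal T)]
    exact add_le_add (le_mul_of_one_le_right' h2) (mul_le_mul_right h3 _)
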